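/- Let $\mathbb K$ be an algebraically closed field of characteristic zero, $T=(\mathbb K^*)^n$ with character lattice $M=\mathbb Z^n$, and $\hat T=\mathbb K^*\times T$ with character lattice $\hat M=\mathbb Z\oplus M$. Let $P\subseteq M_{\mathbb R}$ be a full-dimensional normal lattice polytope, $\Lambda=P\cap M$, $V=\mathbb K^\Lambda$, and let $A$ be the set of nonempty faces of $P$ (including $P$), ordered by inclusion. For $\sigma\in A$ let $\hat X_\sigma\subseteq V$ be the Zariski closure of $\{c\sum_{\chi\in\Lambda\cap\sigma}\chi(t)e_\chi\mid (c,t)\in\hat T\}$; so $\hat X_P$ is the affine cone over the embedded toric variety $X_P\subseteq\mathbb P(V)$. The torus $\hat T$ acts on $\mathbb K[\hat X_P]$ by $(s\cdot g)(x)=g(s^{-1}x)$. Let $(X_\sigma,f_\sigma)_{\sigma\in A}$ be a combinatorial Seshadri stratification: each $f_\sigma\in\mathbb K[\hat X_P]$ is a $\hat T$-eigenfunction of degree $\deg f_\sigma\ge 1$ and weight $\mu_\sigma=(-\deg f_\sigma,\tilde\mu_\sigma)$, such that $-\tilde\mu_\sigma/\deg f_\sigma$ lies in the relative interior of $\sigma$.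 Fix a linearization $>^t$ of the partial order on $A$. Let $\mathfrak C:\tau_r=P>\dots>\tau_0$ be a maximal chain in $A$, and order $\mathbb Q^{\mathfrak C}$ lexicographically, the coefficient of $e_{\tau_r}$ being compared first. * The linear-algebra valuation $\nu_{\mathfrak C}$: for a $\hat T$-eigenfunction $g$ of weight $\lambda=\sum_i a_i\mu_{\tau_i}$ put $\nu_{\mathfrak C}(g)=\sum_i a_ie_{\tau_i}$; for arbitrary $g\ne0$, $\nu_{\mathfrak C}(g)$ is the minimum of the values of the components of $g$ in its decomposition into $\hat T$-eigenfunctions of pairwise distinct weights. * The valuation $\mathcal V_{\mathfrak C}$: for $i\ge1$ let $\mathcal V_i$ be the vanishing multiplicity along $\hat X_{\tau_{i-1}}$ of rational functions on $\hat X_{\tau_i}$, let $\mathcal V_0$ be the vanishing multiplicity at the origin of rational functions on the line $\hat X_{\tau_0}$, and let $b_i=\mathcal V_i(f_{\tau_i}|_{\hat X_{\tau_i}})$. For a rational function $g\neq 0$ on $\hat X_P$ put $g_r=g$ and $g_{i-1}=\bigl(g_i^{b_i}/f_{\tau_i}^{\mathcal V_i(g_i)}\bigr)\big|_{\hat X_{\tau_{i-1}}}$,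 and $$\mathcal V_{\mathfrak C}(g)=\sum_{i=0}^r\frac{\mathcal V_i(g_i)}{b_r\cdots b_i}\,e_{\tau_i}.$$ Regard $\mathbb Q^{\mathfrak C}$ as a subspace of $\mathbb Q^A$, and order $\mathbb Q^A$ lexicographically with respect to $>^t$, the coefficient at the $>^t$-largest face being compared first. Define $\nu(g)=\min_{\mathfrak C}\nu_{\mathfrak C}(g)$ and $\mathcal V(g)=\min_{\mathfrak C}\mathcal V_{\mathfrak C}(g)$, the minima being over all maximal chains in $A$. Then for all $g\in\mathbb K[\hat X_P]\setminus\{0\}$: 1. $\mathcal V_{\mathfrak C}(g)=\nu_{\mathfrak C}(g)$ for every maximal chain $\mathfrak C$ in $A$; 2. $\mathcal V(g)=\nu(g)$. 3. Consequently the associated degenerations coincide: $\mathcal V$ and $\nu$ define the same filtrations $\mathbb K[\hat X_P]_{\ge \underline a}$ and $\mathbb K[\hat X_P]_{>\underline a}$ ($\underline a\in\mathbb Q^A$) and the same Rees algebra $\bigoplus_{\underline a}\mathbb K[\hat X_P]_{\ge\underline a}\,t^{\underline a}$; the associated graded algebras $\mathrm{gr}_{\mathcal V}\mathbb K[\hat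 X_P]$ and $\mathrm{gr}_{\nu}\mathbb K[\hat X_P]$ are identified by the isomorphism induced by the identity of $\mathbb K[\hat X_P]$, compatibly with their decompositions into leaves and into the components given by the degree of functions; the latter components define an algebra grading by $\mathbb N$ on each of the two algebras, and $\mathrm{Proj}(\mathrm{gr}_{\mathcal V}\mathbb K[\hat X_P])\cong\mathrm{Proj}(\mathrm{gr}_{\nu}\mathbb K[\hat X_P])$. -/

import Mathlib

/-- The lexicographic comparison on `ℚ^ι` attached to a strict total order `lt` on `ι`, the entries
at the `lt`-largest indices being compared first. -/
def lexLT {ι : Type*} (lt : ι → ι → Prop) (a b : ι → ℚ) : Prop :=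
  ∃ i, (∀ j, lt i j → a j = b j) ∧ a i < b i

/-- `m` is the smallest element of `S` for the lexicographic order. -/
def IsLexMin {ι : Type*} (lt : ι → ι → Prop) (S : Set (ι → ℚ)) (m : ι → ℚ) : Prop :=
  m ∈ S ∧ ∀ s ∈ S, s = m ∨ lexLT lt m s

open scoped Classical in
/-- The minimum of `S` for the lexicographic order (used for finite nonempty `S` only). -/
noncomputable def lexMin {ι : Type*} (lt : ι → ι → Prop) (S : Set (ι → ℚ)) : ι → ℚ :=
  if h : ∃ m, IsLexMin lt S m then h.choose else 0

/-- A maximal chain `τ_r > ⋯ > τ_0` in a (finite) partially ordered set: it starts at a minimal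
element, ends at a maximal element, and every step is a covering relation. -/
structure MaxChain (α : Type*) [PartialOrder α] where
  r : ℕ
  face : Fin (r + 1) → α
  isMin : IsMin (face 0)
  covBy : ∀ i : Fin r, face i.castSucc ⋖ face i.succ
  isMax : IsMax (face (Fin.last r))

open scoped Classical in
/-- The inclusion `ℚ^C ⊆ ℚ^A`, `(a_i) ↦ ∑ a_i e_{τ_i}`. -/
noncomputable def MaxChain.incl {α : Type*} [PartialOrder α] (C : MaxChain α)
    (a : Fin (C.r + 1) → ℚ) : α → ℚ :=
  fun σ => ∑ i, if C.face i = σ then a i else 0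

noncomputable section RationalFunctions

variable {A B : Type*} [CommRing A] [IsDomain A] [CommRing B] [IsDomain B]

/-- The vanishing multiplicity of a rational function `g ∈ Frac A` along the subvariety with
(prime) ideal `p`: if `g = a / b`, this is `ord a - ord b`, where `ord` is the order of vanishing
in the local ring `A_p`. -/
def vanMult (p : Ideal A) [p.IsPrime] (g : FractionRing A) : ℤ :=
  let ab := IsLocalization.sec (nonZeroDivisors A) g
  ((Ring.ord (Localization.AtPrime p) (algebraMap A _ ab.1)).toNat : ℤ) -
    ((Ring.ord (Localization.AtPrime p) (algebraMap A _ (ab.2 : A))).toNat : ℤ)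

open scoped Classical in
/-- Restriction of a rational function to a closed subvariety: `ρ : A → B` is the restriction of
regular functions, and `g = a / b` with `ρ b ≠ 0` is sent to `ρ a / ρ b`. (Functions that have no
such representation are not regular at the generic point of the subvariety; they get value `0`.) -/
def restrictRat (ρ : A →+* B) (g : FractionRing A) : FractionRing B :=
  if h : ∃ ab : A × A, ρ ab.2 ≠ 0 ∧
      g = algebraMap A (FractionRing A) ab.1 / algebraMap A (FractionRing A) ab.2 then
    algebraMap B (FractionRing B) (ρ h.choose.1) / algebraMap B (FractionRing B) (ρ h.choose.2)
  else 0

/-- The vanishing multiplicity along the subvariety whose restriction map is `ρ : A → B`. -/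
def vanAlong (ρ : A →+* B) (g : FractionRing A) : ℤ :=
  haveI := RingHom.ker_isPrime ρ
  vanMult (RingHom.ker ρ) g

/-- `g ↦ g'|`, where `g' = g ^ b / f ^ v`, with `b` and `v` the vanishing multiplicities of `f` and
of `g` along the subvariety whose restriction map is `ρ`. -/
def divideAndRestrict (ρ : A →+* B) (f g : FractionRing A) : FractionRing B :=
  restrictRat ρ (g ^ vanAlong ρ f / f ^ vanAlong ρ g)

end RationalFunctions

namespace Toric

noncomputable section

variable {n : ℕ}

/-! ### Polytopes -/

/-- The inclusion `M = ℤ^n ⊆ M_ℝ = ℝ^n`. -/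
def toReal (χ : Fin n → ℤ) : Fin n → ℝ := fun i => (χ i : ℝ)

/-- `P` is the convex hull of finitely many (at least one) lattice points. -/
def IsLatticePolytope (P : Set (Fin n → ℝ)) : Prop :=
  ∃ E : Finset (Fin n → ℤ), E.Nonempty ∧ P = convexHull ℝ (toReal '' (E : Set (Fin n → ℤ)))

open scoped Pointwise in
/-- Normality: `(kP ∩ M) + (ℓP ∩ M) = (k + ℓ)P ∩ M` for all `k, ℓ ∈ ℕ`. -/
def IsNormalPolytope (P : Set (Fin n → ℝ)) : Prop :=
  ∀ k l : ℕ, {a : Fin n → ℤ | toReal a ∈ (k : ℝ) • P} + {a | toReal a ∈ (l : ℝ) • P} =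
    {a | toReal a ∈ ((k + l : ℕ) : ℝ) • P}

/-- The set `A` of (nonempty) faces of `P`, `P` included, ordered by inclusion. -/
abbrev Face (P : Set (Fin n → ℝ)) : Type :=
  {F : Set (Fin n → ℝ) // F.Nonempty ∧ IsExposed ℝ P F}

/-- `Λ = P ∩ M`. -/
abbrev LatticePts (P : Set (Fin n → ℝ)) : Type := {χ : Fin n → ℤ // toReal χ ∈ P}

/-! ### Tori and characters -/

/-- The torus `T̂ = K* × T`, with `T = (K*)^n`. -/
abbrev HatTorus (K : Type*) [Field K] (n : ℕ) : Type _ := Kˣ × (Fin n → Kˣ)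

/-- The character lattice `M̂ = ℤ ⊕ M` of `T̂`. -/
abbrev HatM (n : ℕ) : Type := ℤ × (Fin n → ℤ)

variable {K : Type*} [Field K]

/-- The character of `T̂` belonging to an element of `M̂`. -/
def character (w : HatM n) : HatTorus K n →* Kˣ where
  toFun s := s.1 ^ w.1 * ∏ i, s.2 i ^ w.2 i
  map_one' := by simp
  map_mul' s t := by
    simp only [Prod.fst_mul, Prod.snd_mul, Pi.mul_apply, mul_zpow, Finset.prod_mul_distrib]
    exact mul_mul_mul_comm _ _ _ _

lemma character_add (v w : HatM n) (s : HatTorus K n) :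
    character (v + w) s = character v s * character w s := by
  simp only [character, MonoidHom.coe_mk, OneHom.coe_mk, Prod.fst_add, Prod.snd_add, Pi.add_apply,
    zpow_add, Finset.prod_mul_distrib]
  exact mul_mul_mul_comm _ _ _ _

lemma character_zero (s : HatTorus K n) : character (0 : HatM n) s = 1 := by
  simp [character]

/-! ### The affine cones `X̂_σ` and their coordinate rings -/

open scoped Classical in
/-- For a set `σ` (a face of `P`), the set of the points `c ∑_{χ ∈ Λ ∩ σ} χ(t) e_χ` of `V = K^Λ`,
with `(c, t) ∈ T̂`: the cone over the torus orbit `O_σ`. For `σ = P` it is the image of the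
parametrization of `X̂_P`; for `σ = ∅` it is the origin. -/
def orbitCone (K : Type*) [Field K] (P σ : Set (Fin n → ℝ)) : Set (LatticePts P → K) :=
  Set.range fun (s : HatTorus K n) (χ : LatticePts P) =>
    if toReal χ.1 ∈ σ then ((character (1, χ.1) s : Kˣ) : K) else 0

/-- The affine cone `X̂_σ ⊆ V` over the orbit closure `X_σ`: the Zariski closure of the cone over
the orbit. In particular `X̂_P` is the affine cone over `X_P`, and `X̂_∅` is the origin. -/
def hatX (K : Type*) [Field K] (P σ : Set (Fin n → ℝ)) : Set (LatticePts P → K) :=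
  MvPolynomial.zeroLocus K (MvPolynomial.vanishingIdeal K (orbitCone K P σ))

/-- The vanishing ideal of `X̂_σ` in `K[V]`. -/
def hatIdeal (K : Type*) [Field K] (P σ : Set (Fin n → ℝ)) :
    Ideal (MvPolynomial (LatticePts P) K) :=
  MvPolynomial.vanishingIdeal K (hatX K P σ)

/-- The coordinate ring `K[X̂_σ]`. -/
abbrev CoordRing (K : Type*) [Field K] (P σ : Set (Fin n → ℝ)) : Type _ :=
  MvPolynomial (LatticePts P) K ⧸ hatIdeal K P σ

lemma hatIdeal_eq (P σ : Set (Fin n → ℝ)) :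
    hatIdeal K P σ = MvPolynomial.vanishingIdeal K (orbitCone K P σ) :=
  MvPolynomial.zeroLocus_vanishingIdeal_galoisConnection.u_l_u_eq_u _

open scoped Classical in
/-- The comorphism of the parametrization of the cone over `O_σ`. -/
def laurentMap (K : Type*) [Field K] (P σ : Set (Fin n → ℝ)) :
    MvPolynomial (LatticePts P) K →ₐ[K] AddMonoidAlgebra K (HatM n) :=
  MvPolynomial.aeval fun χ =>
    if toReal χ.1 ∈ σ then AddMonoidAlgebra.single ((1, χ.1) : HatM n) (1 : K) else 0

/-- Evaluation of Laurent polynomials at a point of `T̂`. -/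
def evalTorus (s : HatTorus K n) : AddMonoidAlgebra K (HatM n) →ₐ[K] K :=
  AddMonoidAlgebra.lift K K (HatM n)
    { toFun := fun w => ((character w.toAdd s : Kˣ) : K)
      map_one' := by simp [character_zero]
      map_mul' := fun v w => by simp [character_add] }

lemma evalTorus_single (s : HatTorus K n) (w : HatM n) (c : K) :
    evalTorus s (AddMonoidAlgebra.single w c) = c * ((character w s : Kˣ) : K) := by
  simp [evalTorus, AddMonoidAlgebra.lift_single]

lemma evalTorus_laurentMap (P σ : Set (Fin n → ℝ)) (s : HatTorus K n)
    (F : MvPolynomial (LatticePts P) K) :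
    evalTorus s (laurentMap K P σ F) = MvPolynomial.aeval (fun χ : LatticePts P =>
      open scoped Classical in
      if toReal χ.1 ∈ σ then ((character (1, χ.1) s : Kˣ) : K) else 0) F := by
  have h : (evalTorus s).comp (laurentMap K P σ) = MvPolynomial.aeval (fun χ : LatticePts P =>
      open scoped Classical in
      if toReal χ.1 ∈ σ then ((character (1, χ.1) s : Kˣ) : K) else 0) := by
    apply MvPolynomial.algHom_ext
    intro χ
    by_cases hχ : toReal χ.1 ∈ σ <;> simp [laurentMap, hχ, evalTorus_single]
  exact DFunLike.congr_fun h F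

lemma character_injective [CharZero K] :
    Function.Injective (fun w : HatM n => (character w : HatTorus K n →* Kˣ)) := by
  have key : ∀ a b : ℤ, (Units.mk0 (2 : K) two_ne_zero) ^ a = (Units.mk0 (2 : K) two_ne_zero) ^ b →
      a = b := by
    intro a b h
    have h1 : (2 : K) ^ a = (2 : K) ^ b := by simpa using congrArg (Units.val) h
    have h2 : (2 : ℚ) ^ a = (2 : ℚ) ^ b := by
      have : (((2 : ℚ) ^ a : ℚ) : K) = (((2 : ℚ) ^ b : ℚ) : K) := by push_cast; exact h1
      exact_mod_cast this
    exact zpow_right_injective₀ (by norm_num) (by norm_num) h2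
  intro v w h
  have h' : ∀ s : HatTorus K n, character v s = character w s := fun s => DFunLike.congr_fun h s
  refine Prod.ext ?_ (funext fun i => ?_)
  · exact key _ _ (by simpa [character] using h' (Units.mk0 2 two_ne_zero, 1))
  · have := h' (1, Pi.mulSingle i (Units.mk0 2 two_ne_zero))
    simp only [character, MonoidHom.coe_mk, OneHom.coe_mk, one_zpow, one_mul] at this
    rw [Finset.prod_eq_single i, Finset.prod_eq_single i] at this
    · exact key _ _ (by simpa using this)
    all_goals simp +contextual [Pi.mulSingle_eq_of_ne]

lemma eq_zero_of_evalTorus [CharZero K] (u : AddMonoidAlgebra K (HatM n))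
    (h : ∀ s, evalTorus s u = 0) : u = 0 := by
  have hinj : Function.Injective (fun w : HatM n =>
      ((Units.coeHom K).comp (character w) : HatTorus K n →* K)) := by
    intro v w hvw
    refine character_injective (K := K) (MonoidHom.ext fun s => Units.ext ?_)
    exact DFunLike.congr_fun hvw s
  have hli := (linearIndependent_monoidHom (HatTorus K n) K).comp _ hinj
  have := linearIndependent_iff.1 hli u.coeff (by
    funext s
    have hs := h s
    rw [evalTorus, AddMonoidAlgebra.lift_apply] at hs
    rw [Finsupp.linearCombination_apply, Finsupp.sum, Finset.sum_apply]
    simpa [Finsupp.sum] using hs)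
  exact AddMonoidAlgebra.coeff_injective this

lemma hatIdeal_eq_ker [CharZero K] (P σ : Set (Fin n → ℝ)) :
    hatIdeal K P σ = RingHom.ker (laurentMap K P σ) := by
  ext F
  rw [hatIdeal_eq, MvPolynomial.mem_vanishingIdeal_iff, RingHom.mem_ker]
  constructor
  · intro h
    apply eq_zero_of_evalTorus
    intro s
    rw [evalTorus_laurentMap]
    exact h _ ⟨s, rfl⟩
  · rintro h x ⟨s, rfl⟩
    have := evalTorus_laurentMap P σ s F
    rw [h, map_zero] at this
    exact this.symm

instance hatIdeal_isPrime [CharZero K] (P σ : Set (Fin n → ℝ)) : (hatIdeal K P σ).IsPrime := by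
  rw [hatIdeal_eq_ker]
  exact RingHom.ker_isPrime _

open scoped Classical in
lemma laurentMap_monomial (P σ : Set (Fin n → ℝ)) (a : LatticePts P →₀ ℕ) (c : K) :
    laurentMap K P σ (MvPolynomial.monomial a c) =
      if ∀ χ ∈ a.support, toReal χ.1 ∈ σ then
        AddMonoidAlgebra.single (∑ χ ∈ a.support, a χ • ((1, χ.1) : HatM n)) c else 0 := by
  have hprod : ∀ t : Finset (LatticePts P),
      (∏ χ ∈ t, (AddMonoidAlgebra.single ((1, χ.1) : HatM n) (1 : K)) ^ a χ) =
        AddMonoidAlgebra.single (∑ χ ∈ t, a χ • ((1, χ.1) : HatM n)) 1 := by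
    intro t
    induction t using Finset.induction_on with
    | empty => simp [AddMonoidAlgebra.one_def]
    | insert χ t hχ ih =>
      rw [Finset.prod_insert hχ, Finset.sum_insert hχ, ih, AddMonoidAlgebra.single_pow,
        AddMonoidAlgebra.single_mul_single]
      simp
  rw [laurentMap, MvPolynomial.aeval_monomial, Finsupp.prod]
  split_ifs with h
  · rw [Finset.prod_congr rfl (fun χ hχ => by rw [if_pos (h χ hχ)]), hprod]
    simp [AddMonoidAlgebra.single_mul_single]
  · push Not at h
    obtain ⟨χ, hχ, hσ⟩ := h
    rw [Finset.prod_eq_zero hχ, mul_zero]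
    rw [if_neg hσ, zero_pow (Finsupp.mem_support_iff.1 hχ)]

open scoped Classical in
lemma hatIdeal_le_aux [CharZero K] {P σ τ : Set (Fin n → ℝ)} (hστ : σ ⊆ τ) (l : HatM n →+ ℝ)
    (h0 : ∀ χ : LatticePts P, 0 ≤ l (1, χ.1))
    (h1 : ∀ χ : LatticePts P, l (1, χ.1) = 0 ↔ toReal χ.1 ∈ σ) :
    hatIdeal K P τ ≤ hatIdeal K P σ := by
  have key : ∀ (F : MvPolynomial (LatticePts P) K) (w : HatM n), (laurentMap K P σ F).coeff w =
      if l w = 0 then (laurentMap K P τ F).coeff w else 0 := by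
    intro F w
    induction F using MvPolynomial.induction_on' with
    | add p q hp hq =>
      simp only [map_add, AddMonoidAlgebra.coeff_add, Finsupp.add_apply, hp, hq]
      split_ifs <;> simp
    | monomial a c =>
      rw [laurentMap_monomial, laurentMap_monomial]
      have hl : l (∑ χ ∈ a.support, a χ • ((1, χ.1) : HatM n)) = 0 ↔
          ∀ χ ∈ a.support, toReal χ.1 ∈ σ := by
        rw [map_sum, Finset.sum_eq_zero_iff_of_nonneg]
        · refine forall₂_congr fun χ hχ => ?_
          rw [map_nsmul, ← h1 χ, smul_eq_zero_iff_right (Finsupp.mem_support_iff.1 hχ)]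
        · intro χ _
          rw [map_nsmul]
          exact nsmul_nonneg (h0 χ) _
      generalize ∑ χ ∈ a.support, a χ • ((1, χ.1) : HatM n) = w0 at hl ⊢
      by_cases hσ : ∀ χ ∈ a.support, toReal χ.1 ∈ σ
      · have hτ : ∀ χ ∈ a.support, toReal χ.1 ∈ τ := fun χ hχ => hστ (hσ χ hχ)
        rw [if_pos hσ, if_pos hτ]
        by_cases hw : w = w0
        · rw [if_pos (hw ▸ hl.2 hσ)]
        · simp [AddMonoidAlgebra.coeff_single, Ne.symm hw]
      · rw [if_neg hσ]
        by_cases hτ : ∀ χ ∈ a.support, toReal χ.1 ∈ τ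
        · rw [if_pos hτ]
          by_cases hw : w = w0
          · rw [if_neg (fun hlw => hσ (hl.1 (hw ▸ hlw)))]
            simp
          · simp [AddMonoidAlgebra.coeff_single, Ne.symm hw]
        · rw [if_neg hτ]
          simp
  rw [hatIdeal_eq_ker, hatIdeal_eq_ker]
  intro F hF
  rw [RingHom.mem_ker] at hF ⊢
  apply AddMonoidAlgebra.coeff_injective
  ext w
  simp [key F w, hF]

/-- `X̂_σ ⊆ X̂_τ` if `σ` is a face of `P` or empty, and `σ ⊆ τ`. -/
lemma hatIdeal_le [CharZero K] {P σ τ : Set (Fin n → ℝ)} (hσ : IsExposed ℝ P σ) (hστ : σ ⊆ τ) :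
    hatIdeal K P τ ≤ hatIdeal K P σ := by
  rcases Set.eq_empty_or_nonempty σ with rfl | hne
  · refine hatIdeal_le_aux hστ
      ((Int.castAddHom ℝ).comp (AddMonoidHom.fst ℤ (Fin n → ℤ))) ?_ ?_ <;> simp
  · obtain ⟨l, hl⟩ := hσ hne
    obtain ⟨x, hx⟩ := hne
    have hx' := hx
    rw [hl] at hx'
    have hcast : ∀ a b : Fin n → ℤ, toReal (a + b) = toReal a + toReal b := by
      intro a b; funext i; simp [toReal]
    refine hatIdeal_le_aux hστ
      { toFun := fun w => (w.1 : ℝ) * l x - l (toReal w.2)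
        map_zero' := by
          have : toReal (0 : Fin n → ℤ) = 0 := by funext i; simp [toReal]
          simp [this]
        map_add' := fun v w => by simp only [Prod.fst_add, Prod.snd_add, hcast, map_add]
                                  push_cast; ring } ?_ ?_
    · intro χ
      have := hx'.2 _ χ.2
      simpa using this
    · intro χ
      have h1 := hx'.2 _ χ.2
      simp only [AddMonoidHom.coe_mk, ZeroHom.coe_mk, Int.cast_one, one_mul]
      rw [hl]
      constructor
      · intro h
        exact ⟨χ.2, fun y hy => (hx'.2 y hy).trans (by linarith)⟩
      · intro h
        have := h.2 x hx'.1
        linarith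

/-- Restriction of regular functions from `X̂_τ` to `X̂_σ ⊆ X̂_τ`. -/
def restr {P σ τ : Set (Fin n → ℝ)} (h : hatIdeal K P τ ≤ hatIdeal K P σ) :
    CoordRing K P τ →+* CoordRing K P σ :=
  Ideal.Quotient.factor h

/-! ### The action of `T̂`, weight spaces, combinatorial Seshadri stratifications -/

/-- The action on polynomial functions: `(s · g)(x) = g(s⁻¹ · x)`. -/
def actPoly (P : Set (Fin n → ℝ)) (s : HatTorus K n) :
    MvPolynomial (LatticePts P) K →ₐ[K] MvPolynomial (LatticePts P) K :=
  MvPolynomial.aeval fun χ =>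
    MvPolynomial.C ((character (1, χ.1) s⁻¹ : Kˣ) : K) * MvPolynomial.X χ

lemma hatIdeal_le_comap (P : Set (Fin n → ℝ)) (s : HatTorus K n) :
    hatIdeal K P P ≤ (hatIdeal K P P).comap (actPoly P s) := by
  intro F hF
  rw [Ideal.mem_comap]
  rw [hatIdeal_eq, MvPolynomial.mem_vanishingIdeal_iff] at hF ⊢
  rintro _ ⟨t, rfl⟩
  rw [← hF _ ⟨s⁻¹ * t, rfl⟩, actPoly, ← AlgHom.comp_apply]
  congr 1
  apply MvPolynomial.algHom_ext
  intro χ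
  simp [χ.2]

/-- The action of `T̂` on `K[X̂_P]`. -/
def act (P : Set (Fin n → ℝ)) (s : HatTorus K n) : CoordRing K P P →ₐ[K] CoordRing K P P :=
  Ideal.quotientMapₐ _ (actPoly P s) (hatIdeal_le_comap P s)

/-- The space of all `g ∈ K[X̂_P]` with `s · g = w(s) g` for all `s ∈ T̂`. -/
def weightSpace (K : Type*) [Field K] (P : Set (Fin n → ℝ)) (w : HatM n) :
    Submodule K (CoordRing K P P) where
  carrier := {g | ∀ s : HatTorus K n, act P s g = ((character w s : Kˣ) : K) • g}
  zero_mem' := by simp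
  add_mem' ha hb s := by rw [map_add, ha s, hb s, smul_add]
  smul_mem' c g hg s := by rw [map_smul, hg s, smul_comm]

/-- `g` is a `T̂`-eigenfunction of weight `w`. -/
def IsEigenfunction {P : Set (Fin n → ℝ)} (g : CoordRing K P P) (w : HatM n) : Prop :=
  g ≠ 0 ∧ g ∈ weightSpace K P w

/-- The weights that occur in the decomposition of `g` into `T̂`-eigenfunctions of pairwise distinct
weights. -/
def weightsOf {P : Set (Fin n → ℝ)} (g : CoordRing K P P) : Set (HatM n) :=
  {w | ∃ G : HatM n →₀ CoordRing K P P,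
    (∀ v, G v ∈ weightSpace K P v) ∧ (G.sum fun _ h => h) = g ∧ G w ≠ 0}

/-- A combinatorial Seshadri stratification on `X_P`: for every face `σ`, a `T̂`-eigenfunction `f σ`
of weight `μ σ = (-deg (f σ), ·)` and of degree at least one, such that `-μ σ / deg (f σ)` is a point
of the relative interior of `σ`. (The subvarieties are the orbit closures `X_σ`.) -/
structure CombSeshadri (K : Type*) [Field K] (P : Set (Fin n → ℝ)) where
  f : Face P → CoordRing K P P
  μ : Face P → HatM n
  eigen : ∀ σ, IsEigenfunction (f σ) (μ σ)
  one_le_deg : ∀ σ, 1 ≤ -(μ σ).1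
  marking : ∀ σ, ((-(μ σ).1 : ℤ) : ℝ)⁻¹ • toReal (-(μ σ).2) ∈ intrinsicInterior ℝ σ.1

/-! ### The two families of valuations -/

/-- The inclusion `M̂ ⊆ M̂_ℚ`. -/
def toRat (w : HatM n) : ℚ × (Fin n → ℚ) := ((w.1 : ℚ), fun i => (w.2 i : ℚ))

namespace CombSeshadri

variable {P : Set (Fin n → ℝ)} (S : CombSeshadri K P) (C : MaxChain (Face P))

/-- The linear-algebra valuation `ν_C`: the minimum, over the weights `w` occurring in `g`, of the
coordinate vectors of `w` with respect to the basis `(μ_{τ_i})_i` of `M̂_ℚ`. -/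
def nuChain (g : CoordRing K P P) : Fin (C.r + 1) → ℚ :=
  lexMin (· < ·) {a | ∃ w ∈ weightsOf g, toRat w = ∑ i, a i • toRat (S.μ (C.face i))}

/-- The quasi-valuation `ν`: the minimum of the `ν_C` over all maximal chains, in `ℚ^A` with the
lexicographic order given by the linearization `lt` of `A`. -/
def nu (lt : Face P → Face P → Prop) (g : CoordRing K P P) : Face P → ℚ :=
  lexMin lt (Set.range fun C : MaxChain (Face P) => C.incl (S.nuChain C g))

variable [CharZero K]

/-- Restriction `K[X̂_{τ_{j+1}}] → K[X̂_{τ_j}]`. -/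
def stepRestr (j : Fin C.r) :
    CoordRing K P (C.face j.succ).1 →+* CoordRing K P (C.face j.castSucc).1 :=
  restr (hatIdeal_le (C.face j.castSucc).2.2 (C.covBy j).le)

/-- Restriction `K[X̂_{τ_0}] → K[{0}]` to the origin. -/
def originRestr : CoordRing K P (C.face 0).1 →+* CoordRing K P ∅ :=
  restr (hatIdeal_le (fun h => absurd h Set.not_nonempty_empty) (Set.empty_subset _))

/-- `V_i`: for `i > 0` the vanishing multiplicity along `X̂_{τ_{i-1}}` of rational functions on
`X̂_{τ_i}`, for `i = 0` the vanishing multiplicity in the origin of rational functions on the line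
`X̂_{τ_0}`. -/
def mult (i : Fin (C.r + 1)) : FractionRing (CoordRing K P (C.face i).1) → ℤ :=
  Fin.cases (motive := fun i => FractionRing (CoordRing K P (C.face i).1) → ℤ)
    (vanAlong (originRestr (K := K) C)) (fun j => vanAlong (stepRestr (K := K) C j)) i

/-- The extremal function `f_{τ_i}`, restricted to `X̂_{τ_i}`. -/
def extr (i : Fin (C.r + 1)) : FractionRing (CoordRing K P (C.face i).1) :=
  algebraMap (CoordRing K P (C.face i).1) _
    (restr (hatIdeal_le (C.face i).2.2 (C.face i).2.2.subset) (S.f (C.face i)))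

/-- `b_i`, the vanishing multiplicity of `f_{τ_i}` along `X̂_{τ_{i-1}}` (in the origin if `i = 0`). -/
def bond (i : Fin (C.r + 1)) : ℤ := mult C i (S.extr C i)

/-- The sequence `(g_r, …, g_0)` of rational functions: `g_r = g` (as `τ_r = P`, the restriction to
`X̂_{τ_r}` is the identity), and `g_{j}` is the restriction to `X̂_{τ_j}` of
`g_{j+1} ^ b_{j+1} / f_{τ_{j+1}} ^ V_{j+1}(g_{j+1})`. -/
def seq (g : FractionRing (CoordRing K P P)) (i : Fin (C.r + 1)) :
    FractionRing (CoordRing K P (C.face i).1) :=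
  Fin.reverseInduction (motive := fun i => FractionRing (CoordRing K P (C.face i).1))
    (restrictRat (restr (hatIdeal_le (C.face (Fin.last C.r)).2.2
      (C.face (Fin.last C.r)).2.2.subset)) g)
    (fun j h => divideAndRestrict (stepRestr C j) (S.extr C j.succ) h) i

/-- The valuation `V_C` built from renormalized successive vanishing multiplicities; its `i`-th
coordinate is `V_i(g_i) / (b_r ⋯ b_i)`. -/
def cflChain (g : FractionRing (CoordRing K P P)) : Fin (C.r + 1) → ℚ :=
  fun i => (mult C i (S.seq C g i) : ℚ) / ∏ j ∈ Finset.Ici i, (S.bond C j : ℚ)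

/-- The quasi-valuation `V`: the minimum of the `V_C` over all maximal chains. -/
def cfl (lt : Face P → Face P → Prop) (g : CoordRing K P P) : Face P → ℚ :=
  lexMin lt (Set.range fun C : MaxChain (Face P) =>
    C.incl (S.cflChain C (algebraMap _ (FractionRing (CoordRing K P P)) g)))

end CombSeshadri

/-- The homogeneous component `K[X̂_P]_m`. -/
def homogeneousPart (K : Type*) [Field K] (P : Set (Fin n → ℝ)) (m : ℕ) :
    Submodule K (CoordRing K P P) :=
  (MvPolynomial.homogeneousSubmodule (LatticePts P) K m).map
    (Ideal.Quotient.mkₐ K (hatIdeal K P P)).toLinearMap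

end

end Toric

/-! ### Filtration, Rees algebra and associated graded algebra of a quasi-valuation

Here `v` is a map from `R \ {0}` to `ℚ^ι` (its value at `0` is irrelevant), and `lt` is the strict
total order on `ι` that fixes the lexicographic order on `ℚ^ι`. -/

noncomputable section Degeneration

variable {k R ι : Type*} [Field k] [CommRing R] [Algebra k R] (lt : ι → ι → Prop) (v : R → ι → ℚ)

/-- `R_{≥ a}`. -/
def filtGE (a : ι → ℚ) : Set R := {h | h ≠ 0 → v h = a ∨ lexLT lt a (v h)}

/-- `R_{> a}`. -/
def filtGT (a : ι → ℚ) : Set R := {h | h ≠ 0 → lexLT lt a (v h)}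

variable (k) in
/-- The Rees algebra `⨁_a R_{≥ a} t^a` of the filtration, inside `R[t^a : a ∈ ℚ^ι]`. -/
def Rees : Subalgebra k (AddMonoidAlgebra R (ι → ℚ)) :=
  Algebra.adjoin k {x | ∃ a, ∃ h ∈ filtGE lt v a, x = AddMonoidAlgebra.single a h}

variable (k) in
/-- The ideal `⨁_a R_{> a} t^a` of the Rees algebra. -/
def reesIdeal : Ideal (Rees k lt v) :=
  Ideal.span {x | ∃ a, ∃ h ∈ filtGT lt v a,
    (x : AddMonoidAlgebra R (ι → ℚ)) = AddMonoidAlgebra.single a h}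

variable (k) in
/-- The associated graded algebra `gr_v R = ⨁_a R_{≥ a} / R_{> a}`, with the product induced by that
of `R`. -/
abbrev Gr : Type _ := Rees k lt v ⧸ reesIdeal k lt v

variable (k) in
/-- The leaf `R_{≥ a} / R_{> a}` of `gr_v R`. -/
def grLeaf (a : ι → ℚ) : Submodule k (Gr k lt v) :=
  Submodule.span k {y | ∃ h, ∃ x : Rees k lt v,
    (x : AddMonoidAlgebra R (ι → ℚ)) = AddMonoidAlgebra.single a h ∧
      y = Ideal.Quotient.mk (reesIdeal k lt v) x}

/-- The component of degree `m` of `gr_v R`, spanned by the classes of the elements of degree `m`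
of `R`, where `𝒜` is the grading of `R`. -/
def grDegree (𝒜 : ℕ → Submodule k R) (m : ℕ) : Submodule k (Gr k lt v) :=
  Submodule.span k {y | ∃ a, ∃ h ∈ 𝒜 m, ∃ x : Rees k lt v,
    (x : AddMonoidAlgebra R (ι → ℚ)) = AddMonoidAlgebra.single a h ∧
      y = Ideal.Quotient.mk (reesIdeal k lt v) x}

end Degeneration

/-! Everything is read off from exponents. The torus parametrization embeds each `K[X̂_σ]` into the
Laurent polynomials `K[M̂]` (`lau`). The image is the algebra of the semigroup generated by the `(1,
χ)` with `χ ∈ Λ ∩ σ`, weights are the negatives of exponents, and restriction to a face deletes the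
exponents outside that face (`lau_restr_coeff`).

Fix a maximal chain. Each covering of faces raises the dimension by one (`hatSpan_le_of_covers`), so
the vectors `-μ_{τ_i}`, which lie in the relative interiors of the cones over the `τ_i`, form a
basis of `M̂_ℚ`. Let `co` be the coordinates in this basis and let `lead g` be the exponent of `g`
with lexicographically smallest `co`. Being minimal in an ordered group, `lead` is additive on
products and extends to rational functions. Up to signs that cancel, `ν_C(g) = co (lead g)` is the
definition (`nuChain_eq`).

For `V_C`, the `i`-th coordinate is nonnegative on the semigroup of `τ_i` and vanishes exactly on
that of `τ_{i-1}`. By normality, the local ring of `X̂_{τ_i}` along `X̂_{τ_{i-1}}` has a monomial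
uniformizer, so `V_i` is proportional to the `i`-th coordinate of the leading exponent
(`IsFaceStep.exists_vanAlong_eq`). Evaluation at `f_{τ_i}`, which has coordinate one, shows that the
factor is `b_i`. Hence passing from `g_i` to `g_{i-1}` kills the `i`-th coordinate of the leading
exponent and multiplies the lower ones by `b_i` (`IsChainCoord.seq_spec`); the denominators in `V_C`
undo these factors.

The degenerations depend only on the filtrations, hence coincide. For the grading by degree, `ν` is
a minimum over chains and exponents (`exists_nu_eq`), so its filtration is cut out by conditions on
single exponents and is compatible with homogeneous components. -/

set_option linter.unusedSectionVars false

/-! ### Leading exponents of Laurent polynomials -/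

section Lead

variable {k H Γ : Type*} [Field k] [AddCommGroup H] [AddCommGroup Γ] [LinearOrder Γ]
  [IsOrderedAddMonoid Γ] (ξ : H →+ Γ)

/-- `w` is an exponent of `p` at which `ξ` is minimal. -/
def IsLead (p : AddMonoidAlgebra k H) (w : H) : Prop :=
  p.coeff w ≠ 0 ∧ ∀ w', p.coeff w' ≠ 0 → ξ w ≤ ξ w'

variable {ξ}

lemma IsLead.unique (hξ : Function.Injective ξ) {p : AddMonoidAlgebra k H} {v w : H}
    (hv : IsLead ξ p v) (hw : IsLead ξ p w) : v = w :=
  hξ (le_antisymm (hv.2 _ hw.1) (hw.2 _ hv.1))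

variable (ξ) in
lemma exists_isLead {p : AddMonoidAlgebra k H} (hp : p ≠ 0) : ∃ w, IsLead ξ p w := by
  have hne : p.coeff.support.Nonempty := by
    rw [Finsupp.support_nonempty_iff]
    exact fun h => hp (AddMonoidAlgebra.coeff_eq_zero.1 h)
  obtain ⟨w, hw, hmin⟩ := Finset.exists_min_image _ ξ hne
  exact ⟨w, Finsupp.mem_support_iff.1 hw, fun w' hw' => hmin w' (Finsupp.mem_support_iff.2 hw')⟩

lemma exists_add_of_coeff_mul_ne_zero {p q : AddMonoidAlgebra k H} {u : H}
    (h : (p * q).coeff u ≠ 0) : ∃ w v, p.coeff w ≠ 0 ∧ q.coeff v ≠ 0 ∧ w + v = u := by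
  classical
  rw [AddMonoidAlgebra.coeff_mul] at h
  obtain ⟨w, hw, h⟩ := Finset.exists_ne_zero_of_sum_ne_zero h
  obtain ⟨v, hv, h⟩ := Finset.exists_ne_zero_of_sum_ne_zero h
  refine ⟨w, v, Finsupp.mem_support_iff.1 hw, Finsupp.mem_support_iff.1 hv, ?_⟩
  by_contra hne
  simp [hne] at h

/-- No cancellation occurs at `w + v`: by minimality and injectivity of `ξ`, `(w, v)` is the only
pair of exponents of `p` and `q` with this sum. -/
lemma IsLead.mul (hξ : Function.Injective ξ) {p q : AddMonoidAlgebra k H} {v w : H}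
    (hp : IsLead ξ p w) (hq : IsLead ξ q v) : IsLead ξ (p * q) (w + v) := by
  classical
  have key : ∀ w' v', p.coeff w' ≠ 0 → q.coeff v' ≠ 0 → w' + v' = w + v → w' = w ∧ v' = v := by
    intro w' v' hw' hv' h
    have h1 := hp.2 _ hw'
    have h2 := hq.2 _ hv'
    have h3 : ξ w' + ξ v' = ξ w + ξ v := by rw [← map_add, ← map_add, h]
    have h4 : ξ w = ξ w' := by
      refine le_antisymm h1 ?_
      by_contra hlt
      exact (add_lt_add_of_lt_of_le (not_le.1 hlt) h2).ne h3.symm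
    have h5 : w' = w := (hξ h4).symm
    subst h5
    exact ⟨rfl, add_left_cancel h⟩
  constructor
  · rw [AddMonoidAlgebra.coeff_mul, Finsupp.sum, Finset.sum_eq_single w, Finsupp.sum,
      Finset.sum_eq_single v]
    · simpa using ⟨hp.1, hq.1⟩
    · intro v' hv' hne
      rw [if_neg]
      exact fun h => hne (key _ _ hp.1 (Finsupp.mem_support_iff.1 hv') h).2
    · intro h
      exact absurd (Finsupp.mem_support_iff.2 hq.1) h
    · intro w' hw' hne
      refine Finset.sum_eq_zero fun v' hv' => ?_
      dsimp only
      rw [if_neg]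
      exact fun h => hne (key _ _ (Finsupp.mem_support_iff.1 hw') (Finsupp.mem_support_iff.1 hv') h).1
    · intro h
      exact absurd (Finsupp.mem_support_iff.2 hp.1) h
  · intro u hu
    obtain ⟨w', v', hw', hv', rfl⟩ := exists_add_of_coeff_mul_ne_zero hu
    rw [map_add, map_add]
    exact add_le_add (hp.2 _ hw') (hq.2 _ hv')

end Lead

/-! ### Coordinate rings of the cones as semigroup algebras -/

namespace Toric

noncomputable section

variable {n : ℕ} {K : Type*} [Field K]

/-- The semigroup generated by the `(1, χ)` with `χ ∈ Λ ∩ σ`. -/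
def semi (P σ : Set (Fin n → ℝ)) : AddSubmonoid (HatM n) :=
  AddSubmonoid.closure {w | ∃ χ : LatticePts P, toReal χ.1 ∈ σ ∧ w = (1, χ.1)}

lemma mem_semi_of_mem {P σ : Set (Fin n → ℝ)} (χ : LatticePts P) (h : toReal χ.1 ∈ σ) :
    ((1, χ.1) : HatM n) ∈ semi P σ :=
  AddSubmonoid.subset_closure ⟨χ, h, rfl⟩

lemma semi_mono {P σ τ : Set (Fin n → ℝ)} (h : σ ⊆ τ) : semi P σ ≤ semi P τ :=
  AddSubmonoid.closure_mono fun _ ⟨χ, hχ, hw⟩ => ⟨χ, h hχ, hw⟩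

section Functional

variable {Γ : Type*} [AddCommGroup Γ] [LinearOrder Γ] [IsOrderedAddMonoid Γ]
  {P σ τ : Set (Fin n → ℝ)} {l : HatM n →+ Γ}

lemma nonneg_of_mem_semi (h0 : ∀ χ : LatticePts P, toReal χ.1 ∈ τ → 0 ≤ l (1, χ.1))
    {w : HatM n} (hw : w ∈ semi P τ) : 0 ≤ l w := by
  induction hw using AddSubmonoid.closure_induction with
  | mem w h => obtain ⟨χ, hχ, rfl⟩ := h; exact h0 χ hχ
  | zero => simp
  | add v w _ _ hv hw => rw [map_add]; exact add_nonneg hv hw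

/-- A sum of nonnegative values vanishes only termwise, so every generator used to write `w` already
lies over `σ`. -/
lemma mem_semi_of_eq_zero (h0 : ∀ χ : LatticePts P, toReal χ.1 ∈ τ → 0 ≤ l (1, χ.1))
    (h1 : ∀ χ : LatticePts P, toReal χ.1 ∈ τ → l (1, χ.1) = 0 → toReal χ.1 ∈ σ)
    {w : HatM n} (hw : w ∈ semi P τ) (hl : l w = 0) : w ∈ semi P σ := by
  induction hw using AddSubmonoid.closure_induction with
  | mem w h => obtain ⟨χ, hχ, rfl⟩ := h; exact mem_semi_of_mem χ (h1 χ hχ hl)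
  | zero => exact zero_mem _
  | add v w hv hw ihv ihw =>
    rw [map_add] at hl
    have h2 := nonneg_of_mem_semi h0 hv
    have h3 := nonneg_of_mem_semi h0 hw
    obtain ⟨h4, h5⟩ := (add_eq_zero_iff_of_nonneg h2 h3).1 hl
    exact add_mem (ihv h4) (ihw h5)

lemma eq_zero_of_mem_semi (h1 : ∀ χ : LatticePts P, toReal χ.1 ∈ σ → l (1, χ.1) = 0)
    {w : HatM n} (hw : w ∈ semi P σ) : l w = 0 := by
  induction hw using AddSubmonoid.closure_induction with
  | mem w h => obtain ⟨χ, hχ, rfl⟩ := h; exact h1 χ hχ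
  | zero => simp
  | add v w _ _ hv hw => rw [map_add, hv, hw, add_zero]

end Functional

lemma laurentMap_coeff_mem_semi (P σ : Set (Fin n → ℝ)) (F : MvPolynomial (LatticePts P) K)
    {w : HatM n} (h : (laurentMap K P σ F).coeff w ≠ 0) : w ∈ semi P σ := by
  classical
  induction F using MvPolynomial.induction_on' with
  | add p q hp hq =>
    by_cases h1 : (laurentMap K P σ p).coeff w = 0
    · refine hq fun h2 => h ?_
      simp [h1, h2]
    · exact hp h1
  | monomial a c =>
    rw [laurentMap_monomial] at h
    split_ifs at h with hs
    · rw [AddMonoidAlgebra.coeff_single, Finsupp.single_apply] at h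
      split_ifs at h with hw
      · subst hw
        exact sum_mem fun χ hχ => AddSubmonoid.nsmul_mem _ (mem_semi_of_mem χ (hs χ hχ)) _
      · exact absurd rfl h
    · simp at h

variable [CharZero K]

/-- The coordinate ring of `X̂_σ` as a ring of Laurent polynomials. -/
def lau (P σ : Set (Fin n → ℝ)) : CoordRing K P σ →ₐ[K] AddMonoidAlgebra K (HatM n) :=
  Ideal.Quotient.liftₐ (hatIdeal K P σ) (laurentMap K P σ) fun a ha => by
    rwa [hatIdeal_eq_ker] at ha

variable {P σ τ : Set (Fin n → ℝ)}

lemma lau_mk (F : MvPolynomial (LatticePts P) K) :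
    lau P σ (Ideal.Quotient.mk (hatIdeal K P σ) F) = laurentMap K P σ F := rfl

lemma lau_injective : Function.Injective (lau (K := K) P σ) := by
  rw [injective_iff_map_eq_zero]
  intro a ha
  obtain ⟨F, rfl⟩ := Ideal.Quotient.mk_surjective a
  rw [lau_mk] at ha
  rw [Ideal.Quotient.eq_zero_iff_mem, hatIdeal_eq_ker]
  exact ha

lemma lau_ne_zero {a : CoordRing K P σ} (ha : a ≠ 0) : lau P σ a ≠ 0 := by
  rwa [Ne, map_eq_zero_iff _ lau_injective]

lemma mem_semi_of_lau {a : CoordRing K P σ} {w : HatM n} (h : (lau P σ a).coeff w ≠ 0) :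
    w ∈ semi P σ := by
  obtain ⟨F, rfl⟩ := Ideal.Quotient.mk_surjective a
  exact laurentMap_coeff_mem_semi P σ F h

lemma exists_lau_eq_single {w : HatM n} (hw : w ∈ semi P σ) :
    ∃ a : CoordRing K P σ, lau P σ a = AddMonoidAlgebra.single w 1 := by
  classical
  induction hw using AddSubmonoid.closure_induction with
  | mem w h =>
    obtain ⟨χ, hχ, rfl⟩ := h
    refine ⟨Ideal.Quotient.mk _ (MvPolynomial.X χ), ?_⟩
    rw [lau_mk]
    simp [laurentMap, hχ]
  | zero => exact ⟨1, by rw [map_one, AddMonoidAlgebra.one_def]⟩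
  | add v w _ _ hv hw =>
    obtain ⟨a, ha⟩ := hv
    obtain ⟨b, hb⟩ := hw
    exact ⟨a * b, by rw [map_mul, ha, hb, AddMonoidAlgebra.single_mul_single, one_mul]⟩

/-- With `mem_semi_of_lau` this identifies the image of `lau`; it is the means of constructing
regular functions from prescribed exponents. -/
lemma exists_lau_eq {p : AddMonoidAlgebra K (HatM n)} (hp : ∀ w, p.coeff w ≠ 0 → w ∈ semi P σ) :
    ∃ a : CoordRing K P σ, lau P σ a = p := by
  classical
  rw [← AlgHom.mem_range, ← AddMonoidAlgebra.sum_coeff_single p]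
  refine sum_mem fun w hw => ?_
  obtain ⟨a, ha⟩ := exists_lau_eq_single (K := K) (hp w (Finsupp.mem_support_iff.1 hw))
  refine ⟨p.coeff w • a, ?_⟩
  simp [ha]

/-- Restriction to a face is truncation to the exponents on which a supporting functional
vanishes. -/
lemma lau_restr_coeff {Γ : Type*} [AddCommGroup Γ] [LinearOrder Γ] [IsOrderedAddMonoid Γ]
    {l : HatM n →+ Γ} (hστ : σ ⊆ τ)
    (h0 : ∀ χ : LatticePts P, toReal χ.1 ∈ τ → 0 ≤ l (1, χ.1))
    (h1 : ∀ χ : LatticePts P, toReal χ.1 ∈ τ → (l (1, χ.1) = 0 ↔ toReal χ.1 ∈ σ))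
    (h : hatIdeal K P τ ≤ hatIdeal K P σ) (a : CoordRing K P τ) (w : HatM n) :
    (lau P σ (restr h a)).coeff w = open scoped Classical in
      if l w = 0 then (lau P τ a).coeff w else 0 := by
  classical
  obtain ⟨F, rfl⟩ := Ideal.Quotient.mk_surjective a
  have : restr h (Ideal.Quotient.mk _ F) = Ideal.Quotient.mk _ F := rfl
  rw [this, lau_mk, lau_mk]
  induction F using MvPolynomial.induction_on' with
  | add p q hp hq =>
    simp only [map_add, AddMonoidAlgebra.coeff_add, Finsupp.add_apply, hp rfl, hq rfl]
    split_ifs <;> simp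
  | monomial a c =>
    rw [laurentMap_monomial, laurentMap_monomial]
    by_cases hτ : ∀ χ ∈ a.support, toReal χ.1 ∈ τ
    · have hl : l (∑ χ ∈ a.support, a χ • ((1, χ.1) : HatM n)) = 0 ↔
          ∀ χ ∈ a.support, toReal χ.1 ∈ σ := by
        rw [map_sum, Finset.sum_eq_zero_iff_of_nonneg]
        · refine forall₂_congr fun χ hχ => ?_
          rw [map_nsmul, ← h1 χ (hτ χ hχ), smul_eq_zero_iff_right (Finsupp.mem_support_iff.1 hχ)]
        · intro χ hχ
          rw [map_nsmul]
          exact nsmul_nonneg (h0 χ (hτ χ hχ)) _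
      generalize ∑ χ ∈ a.support, a χ • ((1, χ.1) : HatM n) = w0 at hl ⊢
      by_cases hw : w = w0
      · subst hw
        rw [if_pos hτ]
        by_cases hσ : ∀ χ ∈ a.support, toReal χ.1 ∈ σ
        · rw [if_pos hσ, if_pos (hl.2 hσ)]
        · rw [if_neg hσ, if_neg (fun h => hσ (hl.1 h))]
          simp
      · split_ifs <;> simp [AddMonoidAlgebra.coeff_single, Ne.symm hw]
    · have hσ : ¬ ∀ χ ∈ a.support, toReal χ.1 ∈ σ := fun h => hτ fun χ hχ => hστ (h χ hχ)
      rw [if_neg hτ, if_neg hσ]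
      simp

end

end Toric

namespace Toric

noncomputable section

/-! ### The leading exponent on coordinate rings and their fraction fields -/

section LeadRing

variable {n : ℕ} {K : Type*} [Field K] [CharZero K] {P σ τ : Set (Fin n → ℝ)}
  {Γ : Type*} [AddCommGroup Γ] [LinearOrder Γ] [IsOrderedAddMonoid Γ] (ξ : HatM n →+ Γ)

open scoped Classical in
/-- The leading exponent of a regular function on `X̂_σ`. -/
def lead (a : CoordRing K P σ) : HatM n :=
  -- The default value is taken only for `a = 0`.
  if h : ∃ w, IsLead ξ (lau P σ a) w then h.choose else 0

lemma isLead_lead {a : CoordRing K P σ} (ha : a ≠ 0) : IsLead ξ (lau P σ a) (lead ξ a) := by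
  have h := exists_isLead ξ (lau_ne_zero ha)
  rw [lead, dif_pos h]
  exact h.choose_spec

lemma lead_mem_semi {a : CoordRing K P σ} (ha : a ≠ 0) : lead ξ a ∈ semi P σ :=
  mem_semi_of_lau (isLead_lead ξ ha).1

variable {ξ} (hξ : Function.Injective ξ)
include hξ

lemma IsLead.lead_eq {a : CoordRing K P σ} {w : HatM n} (h : IsLead ξ (lau P σ a) w) :
    lead ξ a = w := by
  have ha : a ≠ 0 := by
    rintro rfl
    exact h.1 (by simp)
  exact (isLead_lead ξ ha).unique hξ h

lemma lead_of_lau_eq_single {a : CoordRing K P σ} {w : HatM n} {c : K} (hc : c ≠ 0)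
    (h : lau P σ a = AddMonoidAlgebra.single w c) : lead ξ a = w := by
  classical
  refine IsLead.lead_eq hξ ?_
  rw [h]
  refine ⟨by simpa [AddMonoidAlgebra.coeff_single] using hc, fun w' hw' => ?_⟩
  rw [AddMonoidAlgebra.coeff_single, Finsupp.single_apply] at hw'
  split_ifs at hw' with h
  · rw [h]
  · exact absurd rfl hw'

lemma lead_mul {a b : CoordRing K P σ} (ha : a ≠ 0) (hb : b ≠ 0) :
    lead ξ (a * b) = lead ξ a + lead ξ b := by
  refine IsLead.lead_eq hξ ?_
  rw [map_mul]
  exact (isLead_lead ξ ha).mul hξ (isLead_lead ξ hb)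

lemma lead_one : lead ξ (1 : CoordRing K P σ) = 0 :=
  lead_of_lau_eq_single hξ one_ne_zero (by rw [map_one, AddMonoidAlgebra.one_def])

omit hξ in
variable (ξ) in
/-- The leading exponent of a rational function on `X̂_σ`. -/
def leadFrac (g : FractionRing (CoordRing K P σ)) : HatM n :=
  lead ξ (IsLocalization.sec (nonZeroDivisors (CoordRing K P σ)) g).1 -
    lead ξ ((IsLocalization.sec (nonZeroDivisors (CoordRing K P σ)) g).2 : CoordRing K P σ)

/-- Independence of the representative chosen by `sec`: cross-multiply and use additivity of `lead`.
-/
lemma leadFrac_div {a b : CoordRing K P σ} (ha : a ≠ 0) (hb : b ≠ 0) :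
    leadFrac ξ (algebraMap _ (FractionRing (CoordRing K P σ)) a / algebraMap _ _ b) =
      lead ξ a - lead ξ b := by
  have hinj := IsFractionRing.injective (CoordRing K P σ) (FractionRing (CoordRing K P σ))
  set g := algebraMap _ (FractionRing (CoordRing K P σ)) a / algebraMap _ _ b with hg
  have hb' : algebraMap _ (FractionRing (CoordRing K P σ)) b ≠ 0 := by
    rwa [Ne, map_eq_zero_iff _ hinj]
  have hs := IsLocalization.sec_spec (nonZeroDivisors (CoordRing K P σ)) g
  rw [leadFrac]
  set c := (IsLocalization.sec (nonZeroDivisors (CoordRing K P σ)) g).1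
  set d := (IsLocalization.sec (nonZeroDivisors (CoordRing K P σ)) g).2
  have hd : (d : CoordRing K P σ) ≠ 0 := nonZeroDivisors.ne_zero d.2
  have h : a * d = c * b := by
    apply hinj
    rw [map_mul, map_mul, ← hs, hg]
    field_simp
  have hc : c ≠ 0 := by
    intro hc
    rw [hc, zero_mul] at h
    exact mul_ne_zero ha hd h
  have := congrArg (lead ξ) h
  rw [lead_mul hξ ha hd, lead_mul hξ hc hb] at this
  rw [sub_eq_sub_iff_add_eq_add, ← this]

lemma leadFrac_algebraMap {a : CoordRing K P σ} (ha : a ≠ 0) :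
    leadFrac ξ (algebraMap _ (FractionRing (CoordRing K P σ)) a) = lead ξ a := by
  have := leadFrac_div hξ ha one_ne_zero
  rwa [map_one, div_one, lead_one hξ, sub_zero] at this

omit hξ [CharZero K] in
lemma exists_eq_div [CharZero K] {g : FractionRing (CoordRing K P σ)} (hg : g ≠ 0) :
    ∃ a b : CoordRing K P σ, a ≠ 0 ∧ b ≠ 0 ∧ g = algebraMap _ _ a / algebraMap _ _ b := by
  obtain ⟨a, b, hb, rfl⟩ := IsFractionRing.div_surjective (A := CoordRing K P σ) g
  refine ⟨a, b, ?_, nonZeroDivisors.ne_zero hb, rfl⟩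
  rintro rfl
  simp at hg

lemma leadFrac_mul {g h : FractionRing (CoordRing K P σ)} (hg : g ≠ 0) (hh : h ≠ 0) :
    leadFrac ξ (g * h) = leadFrac ξ g + leadFrac ξ h := by
  obtain ⟨a, b, ha, hb, rfl⟩ := exists_eq_div hg
  obtain ⟨c, d, hc, hd, rfl⟩ := exists_eq_div hh
  rw [div_mul_div_comm, ← map_mul, ← map_mul, leadFrac_div hξ (mul_ne_zero ha hc)
    (mul_ne_zero hb hd), leadFrac_div hξ ha hb, leadFrac_div hξ hc hd, lead_mul hξ ha hc,
    lead_mul hξ hb hd]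
  abel

lemma leadFrac_one : leadFrac ξ (1 : FractionRing (CoordRing K P σ)) = 0 := by
  rw [← map_one (algebraMap (CoordRing K P σ) _), leadFrac_algebraMap hξ one_ne_zero, lead_one hξ]

lemma leadFrac_inv {g : FractionRing (CoordRing K P σ)} (hg : g ≠ 0) :
    leadFrac ξ g⁻¹ = -leadFrac ξ g := by
  rw [eq_neg_iff_add_eq_zero, ← leadFrac_mul hξ (inv_ne_zero hg) hg, inv_mul_cancel₀ hg,
    leadFrac_one hξ]

lemma leadFrac_zpow {g : FractionRing (CoordRing K P σ)} (hg : g ≠ 0) (m : ℤ) :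
    leadFrac ξ (g ^ m) = m • leadFrac ξ g := by
  have key : ∀ m : ℕ, leadFrac ξ (g ^ m) = m • leadFrac ξ g := by
    intro m
    induction m with
    | zero => rw [pow_zero, leadFrac_one hξ, zero_smul]
    | succ m ih => rw [pow_succ, leadFrac_mul hξ (pow_ne_zero _ hg) hg, ih, succ_nsmul]
  cases m with
  | ofNat m => rw [Int.ofNat_eq_natCast, zpow_natCast, key, natCast_zsmul]
  | negSucc m => rw [zpow_negSucc, leadFrac_inv hξ (pow_ne_zero _ hg), key, negSucc_zsmul]

end LeadRing

end

end Toric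

/-! ### Orders of vanishing -/

/-- The order of vanishing at a prime whose local ring is, up to units, the ring of powers of one
element `π`. -/
lemma ord_localization_eq {A : Type*} [CommRing A] [IsDomain A] (p : Ideal A) [p.IsPrime]
    {v : A → ℚ} (hmul : ∀ a b, a ≠ 0 → b ≠ 0 → v (a * b) = v a + v b)
    (hp : ∀ a, a ≠ 0 → (a ∈ p ↔ v a ≠ 0)) (hnonneg : ∀ a, a ≠ 0 → 0 ≤ v a)
    {π : A} (hπ : π ≠ 0) (hd : 0 < v π) (hmin : ∀ a, a ≠ 0 → v a ≠ 0 → v π ≤ v a)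
    (hdvd : ∀ a b, a ≠ 0 → b ≠ 0 → v b ≤ v a → ∃ a' b', b' ∉ p ∧ a' * b = a * b')
    {a : A} (ha : a ≠ 0) :
    ((Ring.ord (Localization.AtPrime p) (algebraMap A _ a)).toNat : ℚ) = v a / v π := by
  set R := Localization.AtPrime p
  have hle : p.primeCompl ≤ nonZeroDivisors A := p.primeCompl_le_nonZeroDivisors
  have : IsDomain R := IsLocalization.isDomain_localization hle
  have hinj : Function.Injective (algebraMap A R) := IsLocalization.injective R hle
  have hone : v 1 = 0 := by
    have := hmul 1 1 one_ne_zero one_ne_zero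
    rw [mul_one] at this
    linarith
  have hpow : ∀ k : ℕ, v (π ^ k) = k * v π := by
    intro k
    induction k with
    | zero => simp [hone]
    | succ k ih => rw [pow_succ, hmul _ _ (pow_ne_zero _ hπ) hπ, ih]; push_cast; ring
  have hunit : ∀ b, b ∉ p → IsUnit (algebraMap A R b) := fun b hb =>
    IsLocalization.map_units R (⟨b, hb⟩ : p.primeCompl)
  have hπp : π ∈ p := (hp π hπ).2 hd.ne'
  -- A nonzero element of `p` has value at least `v π`, so by `hdvd` it is a multiple of `π` up to a
  -- unit of the local ring.
  have hspan : Ideal.span {algebraMap A R π} = IsLocalRing.maximalIdeal R := by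
    apply le_antisymm
    · rw [Ideal.span_singleton_le_iff_mem]
      exact (IsLocalization.AtPrime.to_map_mem_maximal_iff R p π).2 hπp
    · intro x hx
      obtain ⟨b, s, rfl⟩ := IsLocalization.exists_mk'_eq p.primeCompl x
      rw [IsLocalization.AtPrime.mk'_mem_maximal_iff R p] at hx
      rw [IsLocalization.mk'_eq_mul_mk'_one]
      refine Ideal.mul_mem_right _ _ ?_
      rw [Ideal.mem_span_singleton]
      by_cases hb : b = 0
      · simp [hb]
      · obtain ⟨a', b', hb', h⟩ := hdvd b π hb hπ (hmin b hb ((hp b hb).1 hx))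
        have := congrArg (algebraMap A R) h
        rw [map_mul, map_mul] at this
        rw [← (hunit b' hb').dvd_mul_right, ← this]
        exact Dvd.intro_left _ rfl
  have hordπ : Ring.ord R (algebraMap A R π) = 1 := by
    rw [Ring.ord, hspan, Module.length_eq_one_iff, isSimpleModule_iff_isCoatom]
    exact (IsLocalRing.maximalIdeal.isMaximal R).out
  have hq : 0 ≤ v a / v π := div_nonneg (hnonneg a ha) hd.le
  -- Divide by the largest power of `π` that the values allow. The cofactor `a'` then has value
  -- below `v π`, hence value zero by `hmin`, and is a unit; this also shows that `v a / v π` is an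
  -- integer.
  obtain ⟨a', b', hb', h⟩ := hdvd a (π ^ ⌊v a / v π⌋₊) ha (pow_ne_zero _ hπ) (by
    rw [hpow, ← le_div_iff₀ hd]
    exact Nat.floor_le hq)
  have hb0 : b' ≠ 0 := fun h0 => hb' (h0 ▸ p.zero_mem)
  have ha0 : a' ≠ 0 := by
    rintro rfl
    rw [zero_mul] at h
    exact mul_ne_zero ha hb0 h.symm
  have hvb : v b' = 0 := by
    by_contra hne
    exact hb' ((hp b' hb0).2 hne)
  have hv := congrArg v h
  rw [hmul _ _ ha0 (pow_ne_zero _ hπ), hmul _ _ ha hb0, hvb, hpow, add_zero] at hv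
  have hva : v a' = 0 := by
    by_contra hne
    have h1 := hmin a' ha0 hne
    have h2 := Nat.lt_floor_add_one (v a / v π)
    rw [div_lt_iff₀ hd] at h2
    linarith
  have ha' : a' ∉ p := fun h' => (hp a' ha0).1 h' hva
  have hord := congrArg (fun x => Ring.ord R (algebraMap A R x)) h
  have hπ0 : algebraMap A R π ∈ nonZeroDivisors R :=
    mem_nonZeroDivisors_of_ne_zero (by rwa [Ne, map_eq_zero_iff _ hinj])
  rw [map_mul, map_mul, Ring.ord_mul_of_isUnit_left (hunit a' ha'),
    Ring.ord_mul_of_isUnit_right (hunit b' hb'), map_pow, Ring.ord_pow hπ0, hordπ] at hord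
  rw [← hord]
  rw [hva, zero_add] at hv
  rw [← hv, mul_div_assoc, div_self hd.ne', mul_one]
  simp

/-- Stated for the pair chosen by `sec`, which `leadFrac` uses as well, so that the two can be
compared without discussing other representatives. -/
lemma vanMult_eq {A : Type*} [CommRing A] [IsDomain A] (p : Ideal A) [p.IsPrime] {v : A → ℚ}
    {c : ℚ} (h : ∀ a, a ≠ 0 →
      ((Ring.ord (Localization.AtPrime p) (algebraMap A _ a)).toNat : ℚ) = v a / c)
    {g : FractionRing A} (hg : g ≠ 0) :
    (vanMult p g : ℚ) = (v (IsLocalization.sec (nonZeroDivisors A) g).1 -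
      v ((IsLocalization.sec (nonZeroDivisors A) g).2 : A)) / c := by
  have hs := IsLocalization.sec_spec (nonZeroDivisors A) g
  have h2 : ((IsLocalization.sec (nonZeroDivisors A) g).2 : A) ≠ 0 := nonZeroDivisors.coe_ne_zero _
  have h1 : (IsLocalization.sec (nonZeroDivisors A) g).1 ≠ 0 := by
    intro h1
    rw [h1, map_zero] at hs
    refine mul_ne_zero hg ?_ hs
    rwa [Ne, map_eq_zero_iff _ (IsFractionRing.injective A (FractionRing A))]
  rw [vanMult, sub_div, ← h _ h1, ← h _ h2]
  push_cast
  rfl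

/-! ### One step of a chain: vanishing and restriction along a face -/

namespace Toric

noncomputable section

variable {n : ℕ}

/-- `α` is a functional on the semigroup of `τ` that supports the face `σ`, and `u` is an exponent
in the relative interior of the cone over `σ`. -/
structure IsFaceStep (P σ τ : Set (Fin n → ℝ)) (α : HatM n →+ ℚ) (u : HatM n) : Prop where
  sub : σ ⊆ τ
  nonneg : ∀ χ : LatticePts P, toReal χ.1 ∈ τ → 0 ≤ α (1, χ.1)
  eq_zero_iff : ∀ χ : LatticePts P, toReal χ.1 ∈ τ → (α (1, χ.1) = 0 ↔ toReal χ.1 ∈ σ)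
  mem : u ∈ semi P τ
  map_eq_zero : α u = 0
  shift : ∀ w ∈ semi P τ, ∀ w0 ∈ semi P τ, α w0 ≤ α w → ∃ N : ℕ, w - w0 + N • u ∈ semi P τ

section Step

variable {K : Type*} [Field K] [CharZero K] {P σ τ : Set (Fin n → ℝ)}
  {Γ : Type*} [AddCommGroup Γ] [LinearOrder Γ] [IsOrderedAddMonoid Γ] {ξ : HatM n →+ Γ}
  {α : HatM n →+ ℚ} {u : HatM n} (hα : IsFaceStep P σ τ α u)
  (hξα : ∀ w ∈ semi P τ, ∀ w' ∈ semi P τ, ξ w ≤ ξ w' → α w ≤ α w')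
  (h : hatIdeal K P τ ≤ hatIdeal K P σ)
include hα hξα

lemma IsFaceStep.lead_nonneg {a : CoordRing K P τ} (ha : a ≠ 0) : 0 ≤ α (lead ξ a) :=
  nonneg_of_mem_semi hα.nonneg (lead_mem_semi ξ ha)

/-- Restriction only deletes exponents with `α ≠ 0`; the leading one survives and remains minimal
among fewer competitors. -/
lemma IsFaceStep.isLead_restr {a : CoordRing K P τ} (ha : a ≠ 0) (h0 : α (lead ξ a) = 0) :
    IsLead ξ (lau P σ (restr h a)) (lead ξ a) := by
  have hl := isLead_lead ξ ha
  refine ⟨?_, fun w hw => ?_⟩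
  · rw [lau_restr_coeff hα.sub hα.nonneg hα.eq_zero_iff, if_pos h0]
    exact hl.1
  · rw [lau_restr_coeff hα.sub hα.nonneg hα.eq_zero_iff] at hw
    split_ifs at hw with hw0
    · exact hl.2 _ hw
    · exact absurd rfl hw

/-- By `hξα` the leading exponent also minimizes `α`, so if any exponent survives the restriction,
the leading one does. -/
lemma IsFaceStep.restr_ne_zero_iff {a : CoordRing K P τ} (ha : a ≠ 0) :
    restr h a ≠ 0 ↔ α (lead ξ a) = 0 := by
  constructor
  · intro hne
    obtain ⟨w, hw, -⟩ := exists_isLead ξ (lau_ne_zero hne)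
    rw [lau_restr_coeff hα.sub hα.nonneg hα.eq_zero_iff] at hw
    split_ifs at hw with hw0
    · refine le_antisymm ?_ (hα.lead_nonneg hξα ha)
      rw [← hw0]
      exact hξα _ (lead_mem_semi ξ ha) _ (mem_semi_of_lau hw) ((isLead_lead ξ ha).2 _ hw)
    · exact absurd rfl hw
  · intro h0 hzero
    refine (hα.isLead_restr hξα h ha h0).1 ?_
    simp [hzero]

lemma IsFaceStep.lead_restr (hξ : Function.Injective ξ) {a : CoordRing K P τ} (ha : a ≠ 0)
    (h0 : α (lead ξ a) = 0) : lead ξ (restr h a) = lead ξ a :=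
  IsLead.lead_eq hξ (hα.isLead_restr hξα h ha h0)

/-- Since `u` itself lies in the semigroup, enlarging `N` does no harm, and finitely many shifts
have a common bound. -/
lemma IsFaceStep.exists_shift {w0 : HatM n} (hw0 : w0 ∈ semi P τ) (s : Finset (HatM n))
    (hs : ∀ w ∈ s, w ∈ semi P τ ∧ α w0 ≤ α w) :
    ∃ N : ℕ, ∀ w ∈ s, w - w0 + N • u ∈ semi P τ := by
  classical
  induction s using Finset.induction_on with
  | empty => exact ⟨0, by simp⟩
  | insert v s hv ih =>
    obtain ⟨N, hN⟩ := ih fun w hw => hs w (Finset.mem_insert_of_mem hw)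
    obtain ⟨h1, h2⟩ := hs v (Finset.mem_insert_self _ _)
    obtain ⟨M, hM⟩ := hα.shift v h1 w0 hw0 h2
    refine ⟨M + N, fun w hw => ?_⟩
    rw [add_smul, ← add_assoc]
    rcases Finset.mem_insert.1 hw with rfl | hw
    · exact add_mem hM (AddSubmonoid.nsmul_mem _ hα.mem _)
    · rw [add_right_comm]
      exact add_mem (hN w hw) (AddSubmonoid.nsmul_mem _ hα.mem _)

/-- Multiply both functions by the Laurent monomial with exponent `N • u - lead ξ b`. For large `N`
both products are regular, and the second has the exponent `N • u`, where `α` vanishes, so it does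
not restrict to zero. This is the divisibility that makes the local ring a discrete valuation ring.
-/
lemma IsFaceStep.exists_fraction {a b : CoordRing K P τ} (ha : a ≠ 0) (hb : b ≠ 0)
    (hab : α (lead ξ b) ≤ α (lead ξ a)) :
    ∃ a' b' : CoordRing K P τ, restr h b' ≠ 0 ∧ a' * b = a * b' := by
  classical
  have hlb := isLead_lead ξ hb
  obtain ⟨N, hN⟩ := hα.exists_shift hξα (lead_mem_semi ξ hb)
    ((lau P τ a).coeff.support ∪ (lau P τ b).coeff.support) (by
      intro w hw
      rw [Finset.mem_union, Finsupp.mem_support_iff, Finsupp.mem_support_iff] at hw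
      rcases hw with hw | hw
      · have hw' := mem_semi_of_lau hw
        exact ⟨hw', hab.trans
          (hξα _ (lead_mem_semi ξ ha) _ hw' ((isLead_lead ξ ha).2 _ hw))⟩
      · have hw' := mem_semi_of_lau hw
        exact ⟨hw', hξα _ (lead_mem_semi ξ hb) _ hw' (hlb.2 _ hw)⟩)
  have key : ∀ c : CoordRing K P τ, (∀ w, (lau P τ c).coeff w ≠ 0 →
      w - lead ξ b + N • u ∈ semi P τ) → ∃ c' : CoordRing K P τ, lau P τ c' =
        AddMonoidAlgebra.single (N • u - lead ξ b) 1 * lau P τ c := by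
    intro c hc
    refine exists_lau_eq fun w hw => ?_
    rw [AddMonoidAlgebra.coeff_single_mul_apply, one_mul] at hw
    have := hc _ hw
    rwa [show -(N • u - lead ξ b) + w - lead ξ b + N • u = w by abel] at this
  obtain ⟨a', ha'⟩ := key a fun w hw =>
    hN w (Finset.mem_union_left _ (Finsupp.mem_support_iff.2 hw))
  obtain ⟨b', hb'⟩ := key b fun w hw =>
    hN w (Finset.mem_union_right _ (Finsupp.mem_support_iff.2 hw))
  refine ⟨a', b', ?_, lau_injective ?_⟩
  · intro hzero
    have hz : (lau P σ (restr h b')).coeff (N • u) = 0 := by simp [hzero]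
    rw [lau_restr_coeff hα.sub hα.nonneg hα.eq_zero_iff,
      if_pos (by rw [map_nsmul, hα.map_eq_zero, smul_zero]), hb',
      AddMonoidAlgebra.coeff_single_mul_apply, one_mul,
      show -(N • u - lead ξ b) + N • u = lead ξ b by abel] at hz
    exact hlb.1 hz
  · rw [map_mul, map_mul, ha', hb']
    ring

/-- The vanishing multiplicity along `X̂_σ` is proportional to `α` at the leading exponent. -/
lemma IsFaceStep.exists_vanAlong_eq [Finite (LatticePts P)] (hξ : Function.Injective ξ)
    (hpos : ∃ χ : LatticePts P, toReal χ.1 ∈ τ ∧ 0 < α (1, χ.1)) :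
    ∃ d : ℚ, 0 < d ∧ ∀ g : FractionRing (CoordRing K P τ), g ≠ 0 →
      (vanAlong (restr h) g : ℚ) = α (leadFrac ξ g) / d := by
  -- The uniformizer will be the coordinate function of a lattice point of `τ` with smallest
  -- positive `α`.
  obtain ⟨χ, ⟨hχτ, hχ⟩, hmin⟩ := Set.exists_min_image
    {χ : LatticePts P | toReal χ.1 ∈ τ ∧ 0 < α (1, χ.1)} (fun χ => α (1, χ.1))
    (Set.toFinite _) hpos
  -- A semigroup element with nonzero `α` has a generator with positive `α` among its summands, and
  -- the others contribute nonnegatively.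
  have hmin' : ∀ w ∈ semi P τ, α w ≠ 0 → α (1, χ.1) ≤ α w := by
    intro w hw
    induction hw using AddSubmonoid.closure_induction with
    | mem w hw =>
      obtain ⟨ψ, hψ, rfl⟩ := hw
      exact fun hne => hmin ψ ⟨hψ, lt_of_le_of_ne (hα.nonneg ψ hψ) (Ne.symm hne)⟩
    | zero => simp
    | add v w hv hw ihv ihw =>
      intro hne
      rw [map_add] at hne ⊢
      have h1 := nonneg_of_mem_semi hα.nonneg hv
      have h2 := nonneg_of_mem_semi hα.nonneg hw
      by_cases hv0 : α v = 0
      · rw [hv0, zero_add] at hne ⊢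
        exact ihw hne
      · linarith [ihv hv0]
  obtain ⟨π, hπ⟩ := exists_lau_eq_single (K := K) (mem_semi_of_mem χ hχτ)
  have hπ0 : π ≠ 0 := by
    rintro rfl
    rw [map_zero] at hπ
    exact AddMonoidAlgebra.single_ne_zero.2 one_ne_zero hπ.symm
  have hlπ : lead ξ π = (1, χ.1) := lead_of_lau_eq_single hξ one_ne_zero hπ
  refine ⟨α (1, χ.1), hχ, fun g hg => ?_⟩
  have := RingHom.ker_isPrime (restr h)
  have hker : ∀ a : CoordRing K P τ, a ≠ 0 →
      (a ∈ RingHom.ker (restr h) ↔ α (lead ξ a) ≠ 0) := by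
    intro a ha
    rw [RingHom.mem_ker, ← not_iff_not, not_not]
    exact hα.restr_ne_zero_iff hξα h ha
  have hord := fun a (ha : a ≠ 0) => ord_localization_eq (RingHom.ker (restr h))
    (v := fun a => α (lead ξ a)) (π := π)
    (fun a b ha hb => by rw [lead_mul hξ ha hb, map_add]) hker
    (fun a ha => hα.lead_nonneg hξα ha) hπ0 (by rwa [hlπ])
    (fun a ha h0 => by rw [hlπ]; exact hmin' _ (lead_mem_semi ξ ha) h0)
    (fun a b ha hb hab => by
      simp only [RingHom.mem_ker]
      exact hα.exists_fraction hξα h ha hb hab) ha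
  rw [vanAlong, vanMult_eq (RingHom.ker (restr h)) hord hg, leadFrac, map_sub, hlπ]

/-- A fraction of value zero can be rewritten with a denominator that survives on `σ`, so
`restrictRat` does not take its default value. -/
lemma IsFaceStep.leadFrac_restrictRat (hξ : Function.Injective ξ)
    {g : FractionRing (CoordRing K P τ)} (hg : g ≠ 0) (h0 : α (leadFrac ξ g) = 0) :
    restrictRat (restr h) g ≠ 0 ∧ leadFrac ξ (restrictRat (restr h) g) = leadFrac ξ g := by
  have hinj := IsFractionRing.injective (CoordRing K P τ) (FractionRing (CoordRing K P τ))
  have hinj' := IsFractionRing.injective (CoordRing K P σ) (FractionRing (CoordRing K P σ))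
  have hex : ∃ ab : CoordRing K P τ × CoordRing K P τ, restr h ab.2 ≠ 0 ∧
      g = algebraMap _ (FractionRing (CoordRing K P τ)) ab.1 / algebraMap _ _ ab.2 := by
    obtain ⟨a, b, ha, hb, rfl⟩ := exists_eq_div hg
    rw [leadFrac_div hξ ha hb, map_sub, sub_eq_zero] at h0
    obtain ⟨a', b', hb', hab⟩ := hα.exists_fraction hξα h ha hb h0.ge
    refine ⟨(a', b'), hb', ?_⟩
    have hb0 : b' ≠ 0 := by
      rintro rfl
      exact hb' (map_zero _)
    rw [div_eq_div_iff (by rwa [Ne, map_eq_zero_iff _ hinj]) (by rwa [Ne, map_eq_zero_iff _ hinj]),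
      ← map_mul, ← map_mul, hab]
  rw [restrictRat, dif_pos hex]
  obtain ⟨hb', hgab⟩ := hex.choose_spec
  set a := hex.choose.1
  set b := hex.choose.2
  have hb : b ≠ 0 := by
    intro hb
    exact hb' (by rw [hb, map_zero])
  have ha : a ≠ 0 := by
    intro ha
    rw [ha, map_zero, zero_div] at hgab
    exact hg hgab
  have hb0 := (hα.restr_ne_zero_iff hξα h hb).1 hb'
  -- Whatever representative was chosen, its denominator has value zero, hence so does its
  -- numerator.
  rw [hgab, leadFrac_div hξ ha hb, map_sub, hb0, sub_zero] at h0
  have ha' := (hα.restr_ne_zero_iff hξα h ha).2 h0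
  refine ⟨div_ne_zero (by rwa [Ne, map_eq_zero_iff _ hinj'])
    (by rwa [Ne, map_eq_zero_iff _ hinj']), ?_⟩
  rw [leadFrac_div hξ ha' hb', hα.lead_restr hξα h hξ ha h0, hα.lead_restr hξα h hξ hb hb0, hgab,
    leadFrac_div hξ ha hb]

end Step

end

end Toric

/-! ### The lexicographic order -/

section Lex

variable {r : ℕ}

/-- `ℚ^{r+1}` with the lexicographic order that compares the last entries first. -/
def revLex (r : ℕ) : (Fin (r + 1) → ℚ) →+ Lex (Fin (r + 1) → ℚ) where
  toFun a := toLex fun i => a i.rev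
  map_zero' := rfl
  map_add' _ _ := rfl

lemma revLex_injective : Function.Injective (revLex r) := by
  intro a b h
  funext i
  have := congrFun (toLex.injective h) i.rev
  simpa using this

lemma revLex_apply_rev (a : Fin (r + 1) → ℚ) (i : Fin (r + 1)) : revLex r a i.rev = a i :=
  congrArg a (Fin.rev_rev i)

lemma revLex_lt_iff {a b : Fin (r + 1) → ℚ} : revLex r a < revLex r b ↔ lexLT (· < ·) a b := by
  constructor
  · rintro ⟨i, hi, hlt⟩
    refine ⟨i.rev, fun j hj => ?_, hlt⟩
    have := hi j.rev (Fin.rev_lt_iff.2 hj)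
    rwa [revLex_apply_rev, revLex_apply_rev] at this
  · rintro ⟨i, hi, hlt⟩
    refine ⟨i.rev, fun j hj => hi j.rev (Fin.lt_rev_iff.1 hj), ?_⟩
    rwa [revLex_apply_rev, revLex_apply_rev]

lemma apply_le_of_revLex_le {a b : Fin (r + 1) → ℚ} (h : revLex r a ≤ revLex r b)
    {i : Fin (r + 1)} (hi : ∀ j, i < j → a j = b j) : a i ≤ b i := by
  by_contra hlt
  refine (revLex_lt_iff.2 ⟨i, fun j hj => (hi j hj).symm, not_le.1 hlt⟩).not_ge h

end Lex

namespace Toric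

noncomputable section

variable {n : ℕ} {K : Type*} [Field K] {P : Set (Fin n → ℝ)}

/-! ### The successive vanishing multiplicities along a maximal chain -/

/-- The face below the `i`-th face of a chain: the empty face if `i = 0`. -/
def prevFace (C : MaxChain (Face P)) (i : Fin (C.r + 1)) : Set (Fin n → ℝ) :=
  Fin.cases ∅ (fun j => (C.face j.castSucc).1) i

/-- `co` gives the coordinates of the elements of `M̂` in the basis `(-μ_{τ_i})_i`, and these
coordinates support the faces of the chain. -/
structure IsChainCoord (S : CombSeshadri K P) (C : MaxChain (Face P))
    (co : HatM n →+ (Fin (C.r + 1) → ℚ)) : Prop where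
  inj : Function.Injective co
  neg_weight : ∀ i, co (-S.μ (C.face i)) = Pi.single i 1
  mem_semi : ∀ i, -S.μ (C.face i) ∈ semi P (C.face i).1
  eq_zero : ∀ i, ∀ w ∈ semi P (C.face i).1, ∀ j, i < j → co w j = 0
  step : ∀ i, ∃ u, IsFaceStep P (prevFace C i) (C.face i).1
    ((Pi.evalAddMonoidHom (fun _ => ℚ) i).comp co) u

lemma restrictRat_id {A : Type*} [CommRing A] [IsDomain A] (g : FractionRing A) :
    restrictRat (RingHom.id A) g = g := by
  have hex : ∃ ab : A × A, RingHom.id A ab.2 ≠ 0 ∧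
      g = algebraMap A (FractionRing A) ab.1 / algebraMap A (FractionRing A) ab.2 := by
    obtain ⟨a, b, hb, rfl⟩ := IsFractionRing.div_surjective (A := A) g
    exact ⟨(a, b), nonZeroDivisors.ne_zero hb, rfl⟩
  rw [restrictRat, dif_pos hex]
  exact hex.choose_spec.2.symm

variable [CharZero K]

/-- The top face of a chain equals `P` only propositionally, so the first restriction in `seq`
becomes the identity only after substitution. -/
lemma leadFrac_restrictRat_of_eq {Γ : Type*} [AddCommGroup Γ] [LinearOrder Γ]
    [IsOrderedAddMonoid Γ] (ξ : HatM n →+ Γ) {σ : Set (Fin n → ℝ)} (hσ : σ = P)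
    (h : hatIdeal K P P ≤ hatIdeal K P σ) {g : FractionRing (CoordRing K P P)} (hg : g ≠ 0) :
    restrictRat (restr h) g ≠ 0 ∧ leadFrac ξ (restrictRat (restr h) g) = leadFrac ξ g := by
  subst hσ
  have : restr h = RingHom.id (CoordRing K σ σ) := by
    refine RingHom.ext fun a => ?_
    obtain ⟨F, rfl⟩ := Ideal.Quotient.mk_surjective a
    rfl
  rw [this, restrictRat_id]
  exact ⟨hg, rfl⟩

lemma mul_bond_prod_Ioi (S : CombSeshadri K P) (C : MaxChain (Face P)) (i : Fin (C.r + 1)) :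
    (S.bond C i : ℚ) * ∏ k ∈ Finset.Ioi i, (S.bond C k : ℚ) =
      ∏ k ∈ Finset.Ici i, (S.bond C k : ℚ) :=
  Finset.mul_prod_Ioi_eq_prod_Ici (f := fun k => (S.bond C k : ℚ)) i

section Chain

variable {S : CombSeshadri K P} {C : MaxChain (Face P)} {co : HatM n →+ (Fin (C.r + 1) → ℚ)}
  (hco : IsChainCoord S C co)
include hco

lemma IsChainCoord.injective : Function.Injective ((revLex C.r).comp co) :=
  revLex_injective.comp hco.inj

/-- On the semigroup of `τ_i` all coordinates above `i` vanish, so the `i`-th is the first to be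
compared. This supplies the hypothesis `hξα` of the face steps. -/
lemma IsChainCoord.le_of_le {i : Fin (C.r + 1)} {w w' : HatM n} (hw : w ∈ semi P (C.face i).1)
    (hw' : w' ∈ semi P (C.face i).1) (h : (revLex C.r).comp co w ≤ (revLex C.r).comp co w') :
    co w i ≤ co w' i :=
  apply_le_of_revLex_le h fun j hj => by
    rw [hco.eq_zero i w hw j hj, hco.eq_zero i w' hw' j hj]

/-- Otherwise the `i`-th coordinate would vanish on the whole semigroup of `τ_i`, which contains
`-μ_{τ_i}`, where it is one. -/
lemma IsChainCoord.exists_pos (i : Fin (C.r + 1)) :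
    ∃ χ : LatticePts P, toReal χ.1 ∈ (C.face i).1 ∧ 0 < co (1, χ.1) i := by
  by_contra! hcon
  obtain ⟨u, hstep⟩ := hco.step i
  have h1 := eq_zero_of_mem_semi (l := (Pi.evalAddMonoidHom (fun _ => ℚ) i).comp co)
    (fun χ hχ => le_antisymm (hcon χ hχ) (hstep.nonneg χ hχ)) (hco.mem_semi i)
  simp [hco.neg_weight i] at h1

lemma IsChainCoord.exists_mult_eq [Finite (LatticePts P)] (i : Fin (C.r + 1)) :
    ∃ d : ℚ, 0 < d ∧ ∀ g : FractionRing (CoordRing K P (C.face i).1), g ≠ 0 →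
      (CombSeshadri.mult C i g : ℚ) = co (leadFrac ((revLex C.r).comp co) g) i / d := by
  obtain ⟨u, hu⟩ := hco.step i
  have hpos := hco.exists_pos i
  have hle := fun w (hw : w ∈ semi P (C.face i).1) w' hw' h => hco.le_of_le (w' := w') hw hw' h
  induction i using Fin.cases with
  | zero => exact hu.exists_vanAlong_eq hle _ hco.injective hpos
  | succ j => exact hu.exists_vanAlong_eq hle _ hco.injective hpos

variable (hf : ∀ i, ∃ c : K, c ≠ 0 ∧
  lau P (C.face i).1 (restr (hatIdeal_le (C.face i).2.2 (C.face i).2.2.subset) (S.f (C.face i))) =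
    AddMonoidAlgebra.single (-S.μ (C.face i)) c)
include hf

lemma IsChainCoord.extr_ne_zero (i : Fin (C.r + 1)) : S.extr C i ≠ 0 := by
  obtain ⟨c, hc, h⟩ := hf i
  rw [CombSeshadri.extr, Ne, map_eq_zero_iff _ (IsFractionRing.injective _ _)]
  intro h0
  rw [h0, map_zero] at h
  exact AddMonoidAlgebra.single_ne_zero.2 hc h.symm

lemma IsChainCoord.leadFrac_extr (i : Fin (C.r + 1)) :
    leadFrac ((revLex C.r).comp co) (S.extr C i) = -S.μ (C.face i) := by
  obtain ⟨c, hc, h⟩ := hf i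
  rw [CombSeshadri.extr, leadFrac_algebraMap hco.injective,
    lead_of_lau_eq_single hco.injective hc h]
  intro h0
  rw [h0, map_zero] at h
  exact AddMonoidAlgebra.single_ne_zero.2 hc h.symm

/-- The unknown proportionality constant `d` is removed by evaluating at `f_{τ_i}`, whose `i`-th
coordinate is one: `b_i = 1 / d`. -/
lemma IsChainCoord.bond_pos_and_mult_eq [Finite (LatticePts P)] (i : Fin (C.r + 1)) :
    0 < (S.bond C i : ℚ) ∧ ∀ g : FractionRing (CoordRing K P (C.face i).1), g ≠ 0 →
      (CombSeshadri.mult C i g : ℚ) =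
        S.bond C i * co (leadFrac ((revLex C.r).comp co) g) i := by
  obtain ⟨d, hd, h⟩ := hco.exists_mult_eq (K := K) i
  have hb := h _ (hco.extr_ne_zero hf i)
  rw [hco.leadFrac_extr hf i, hco.neg_weight i, Pi.single_eq_same] at hb
  rw [CombSeshadri.bond, hb]
  refine ⟨by positivity, fun g hg => ?_⟩
  rw [h g hg]
  ring

/-- Descending induction along the chain: each step scales the leading exponent by a bond and
subtracts a multiple of one basis vector, so the coordinates still to be read are only scaled. -/
lemma IsChainCoord.seq_spec [Finite (LatticePts P)] {g : CoordRing K P P} (hg : g ≠ 0)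
    (hlast : (C.face (Fin.last C.r)).1 = P) (i : Fin (C.r + 1)) :
    S.seq C (algebraMap _ _ g) i ≠ 0 ∧ ∀ j ≤ i,
      co (leadFrac ((revLex C.r).comp co) (S.seq C (algebraMap _ _ g) i)) j =
        (∏ k ∈ Finset.Ioi i, (S.bond C k : ℚ)) * co (lead ((revLex C.r).comp co) g) j := by
  set ξ := (revLex C.r).comp co with hξ
  induction i using Fin.reverseInduction with
  | last =>
    have hg' : algebraMap _ (FractionRing (CoordRing K P P)) g ≠ 0 := by
      rwa [Ne, map_eq_zero_iff _ (IsFractionRing.injective _ _)]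
    have h := leadFrac_restrictRat_of_eq ξ hlast
      (hatIdeal_le (C.face (Fin.last C.r)).2.2 (C.face (Fin.last C.r)).2.2.subset) hg'
    rw [leadFrac_algebraMap hco.injective hg] at h
    rw [CombSeshadri.seq, Fin.reverseInduction_last]
    refine ⟨h.1, fun j _ => ?_⟩
    have hempty : Finset.Ioi (Fin.last C.r) = ∅ := by
      ext j
      simp [Fin.le_last]
    rw [h.2, hempty, Finset.prod_empty, one_mul]
  | cast i ih =>
    obtain ⟨hne, ih⟩ := ih
    have hseq : S.seq C (algebraMap _ _ g) i.castSucc = divideAndRestrict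
        (CombSeshadri.stepRestr C i) (S.extr C i.succ) (S.seq C (algebraMap _ _ g) i.succ) := by
      rw [CombSeshadri.seq, Fin.reverseInduction_castSucc]
      rfl
    rw [hseq, divideAndRestrict]
    set g' := S.seq C (algebraMap _ _ g) i.succ
    have hf0 := hco.extr_ne_zero hf i.succ
    obtain ⟨hb, hmult⟩ := hco.bond_pos_and_mult_eq hf i.succ
    set b := vanAlong (CombSeshadri.stepRestr C i) (S.extr C i.succ) with hbdef
    have hbond : S.bond C i.succ = b := rfl
    set v := vanAlong (CombSeshadri.stepRestr C i) g' with hv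
    have hv' : (v : ℚ) = b * co (leadFrac ξ g') i.succ := hmult g' hne
    have hG : g' ^ b / S.extr C i.succ ^ v ≠ 0 :=
      div_ne_zero (zpow_ne_zero _ hne) (zpow_ne_zero _ hf0)
    have hlead : leadFrac ξ (g' ^ b / S.extr C i.succ ^ v) =
        b • leadFrac ξ g' - v • -S.μ (C.face i.succ) := by
      rw [div_eq_mul_inv, leadFrac_mul hco.injective (zpow_ne_zero _ hne)
        (inv_ne_zero (zpow_ne_zero _ hf0)), leadFrac_inv hco.injective (zpow_ne_zero _ hf0),
        leadFrac_zpow hco.injective hne, leadFrac_zpow hco.injective hf0,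
        hco.leadFrac_extr hf, sub_eq_add_neg]
    have hcoord : ∀ j, co (leadFrac ξ (g' ^ b / S.extr C i.succ ^ v)) j =
        b * co (leadFrac ξ g') j - v * (Pi.single i.succ 1 : Fin (C.r + 1) → ℚ) j := by
      intro j
      rw [hlead, map_sub, map_zsmul, map_zsmul, hco.neg_weight]
      simp
    obtain ⟨u, hu⟩ := hco.step i.succ
    have hle := fun w (hw : w ∈ semi P (C.face i.succ).1) w' hw' h =>
      hco.le_of_le (w' := w') hw hw' h
    -- As `v` is `b` times the coordinate being removed, the quotient has coordinate zero there, and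
    -- restriction preserves its leading exponent.
    have hres := hu.leadFrac_restrictRat hle
      (hatIdeal_le (C.face i.castSucc).2.2 (C.covBy i).le) hco.injective hG (by
        change co (leadFrac ξ (g' ^ b / S.extr C i.succ ^ v)) i.succ = 0
        rw [hcoord, hv']
        simp)
    refine ⟨hres.1, fun j hj => ?_⟩
    have hj' : j < i.succ := lt_of_le_of_lt hj Fin.castSucc_lt_succ
    refine (congrFun (congrArg co hres.2) j).trans ?_
    rw [hcoord, Pi.single_eq_of_ne hj'.ne, mul_zero, sub_zero, ih j hj'.le, ← mul_assoc, ← hbond,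
      mul_bond_prod_Ioi]
    congr 2
    ext k
    simp [Fin.castSucc_lt_iff_succ_le]

theorem IsChainCoord.cflChain_eq [Finite (LatticePts P)] {g : CoordRing K P P} (hg : g ≠ 0)
    (hlast : (C.face (Fin.last C.r)).1 = P) :
    S.cflChain C (algebraMap _ (FractionRing (CoordRing K P P)) g) =
      co (lead ((revLex C.r).comp co) g) := by
  funext i
  obtain ⟨hne, h⟩ := hco.seq_spec hf hg hlast i
  have hb := fun i => (hco.bond_pos_and_mult_eq hf i).1
  rw [CombSeshadri.cflChain, (hco.bond_pos_and_mult_eq hf i).2 _ hne, h i le_rfl, ← mul_assoc,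
    mul_bond_prod_Ioi]
  exact mul_div_cancel_left₀ _ (Finset.prod_ne_zero_iff.2 fun k _ => (hb k).ne')

end Chain

end

end Toric

/-! ### Lexicographic minima -/

section LexMin

variable {ι : Type*} {lt : ι → ι → Prop}

lemma lexLT_asymm (hlt : IsStrictTotalOrder ι lt) {a b : ι → ℚ} (hab : lexLT lt a b) :
    ¬ lexLT lt b a := by
  obtain ⟨i, hi, hi'⟩ := hab
  rintro ⟨j, hj, hj'⟩
  rcases trichotomous_of lt i j with h | rfl | h
  · exact hj'.ne (hi j h).symm
  · exact lt_asymm hi' hj'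
  · exact hi'.ne (hj i h).symm

lemma IsLexMin.eq (hlt : IsStrictTotalOrder ι lt) {s : Set (ι → ℚ)} {a b : ι → ℚ}
    (ha : IsLexMin lt s a) (hb : IsLexMin lt s b) : a = b := by
  rcases ha.2 b hb.1 with h | h
  · exact h.symm
  · rcases hb.2 a ha.1 with h' | h'
    · exact h'
    · exact absurd h' (lexLT_asymm hlt h)

lemma IsLexMin.lexMin_eq (hlt : IsStrictTotalOrder ι lt) {s : Set (ι → ℚ)} {a : ι → ℚ}
    (ha : IsLexMin lt s a) : lexMin lt s = a := by
  have h : ∃ m, IsLexMin lt s m := ⟨a, ha⟩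
  rw [lexMin, dif_pos h]
  exact h.choose_spec.eq hlt ha

end LexMin

namespace Toric

noncomputable section

variable {n : ℕ} {K : Type*} [Field K]

/-! ### Weight spaces -/

/-- The action of `T̂` on Laurent polynomials. -/
def actLaurent (s : HatTorus K n) :
    AddMonoidAlgebra K (HatM n) →ₐ[K] AddMonoidAlgebra K (HatM n) :=
  AddMonoidAlgebra.lift K _ (HatM n)
    { toFun := fun w => AddMonoidAlgebra.single w.toAdd ((character w.toAdd s⁻¹ : Kˣ) : K)
      map_one' := by simp [character_zero, AddMonoidAlgebra.one_def]
      map_mul' := fun v w => by simp [character_add, AddMonoidAlgebra.single_mul_single] }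

lemma actLaurent_single (s : HatTorus K n) (w : HatM n) (c : K) :
    actLaurent s (AddMonoidAlgebra.single w c) =
      AddMonoidAlgebra.single w (c * ((character w s⁻¹ : Kˣ) : K)) := by
  simp [actLaurent, AddMonoidAlgebra.lift_single]

lemma actLaurent_coeff (s : HatTorus K n) (p : AddMonoidAlgebra K (HatM n)) (w : HatM n) :
    (actLaurent s p).coeff w = ((character w s⁻¹ : Kˣ) : K) * p.coeff w := by
  classical
  induction p using AddMonoidAlgebra.induction_linear with
  | zero => simp
  | add p q hp hq => simp [hp, hq, mul_add]
  | single v c =>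
    rw [actLaurent_single, AddMonoidAlgebra.coeff_single, AddMonoidAlgebra.coeff_single,
      Finsupp.single_apply, Finsupp.single_apply]
    split_ifs with h
    · rw [h, mul_comm]
    · simp

lemma laurentMap_actPoly (P : Set (Fin n → ℝ)) (s : HatTorus K n)
    (F : MvPolynomial (LatticePts P) K) :
    laurentMap K P P (actPoly P s F) = actLaurent s (laurentMap K P P F) := by
  have h : (laurentMap K P P).comp (actPoly P s) = (actLaurent s).comp (laurentMap K P P) := by
    apply MvPolynomial.algHom_ext
    intro χ
    simp only [AlgHom.comp_apply, actPoly, MvPolynomial.aeval_X, laurentMap, χ.2, if_true,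
      actLaurent_single, map_mul, MvPolynomial.algHom_C, one_mul]
    rw [AddMonoidAlgebra.coe_algebraMap]
    simp [AddMonoidAlgebra.single_mul_single]
  exact DFunLike.congr_fun h F

variable [CharZero K] {P : Set (Fin n → ℝ)}

lemma lau_act_coeff (s : HatTorus K n) (g : CoordRing K P P) (w : HatM n) :
    (lau P P (act P s g)).coeff w = ((character w s⁻¹ : Kˣ) : K) * (lau P P g).coeff w := by
  obtain ⟨F, rfl⟩ := Ideal.Quotient.mk_surjective g
  rw [← actLaurent_coeff, lau_mk, ← laurentMap_actPoly]
  rfl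

lemma character_inv (w : HatM n) (s : HatTorus K n) : character w s⁻¹ = character (-w) s := by
  simp [character]

lemma lau_coeff_injective {σ : Set (Fin n → ℝ)} {a b : CoordRing K P σ}
    (h : ∀ w, (lau P σ a).coeff w = (lau P σ b).coeff w) : a = b :=
  lau_injective (AddMonoidAlgebra.coeff_injective (Finsupp.ext h))

/-- The sign comes from the inverse in the action. Distinct exponents give distinct characters, so
an eigenfunction has at most one exponent. -/
lemma mem_weightSpace_iff {g : CoordRing K P P} {w : HatM n} :
    g ∈ weightSpace K P w ↔ ∀ v, (lau P P g).coeff v ≠ 0 → v = -w := by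
  constructor
  · intro hg v hv
    have : (character (-v) : HatTorus K n →* Kˣ) = character w := by
      refine MonoidHom.ext fun s => Units.ext ?_
      have hs := congrArg (fun a => (lau P P a).coeff v) (hg s)
      simp only [lau_act_coeff, map_smul, AddMonoidAlgebra.coeff_smul, Finsupp.smul_apply,
        smul_eq_mul] at hs
      rw [← character_inv]
      exact mul_right_cancel₀ hv hs
    rw [← character_injective this, neg_neg]
  · intro h s
    refine lau_coeff_injective fun v => ?_
    rw [lau_act_coeff, map_smul, AddMonoidAlgebra.coeff_smul, Finsupp.smul_apply, smul_eq_mul]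
    by_cases hv : (lau P P g).coeff v = 0
    · rw [hv, mul_zero, mul_zero]
    · rw [character_inv, h v hv, neg_neg]

lemma IsEigenfunction.exists_lau_eq {g : CoordRing K P P} {w : HatM n}
    (h : IsEigenfunction g w) : ∃ c : K, c ≠ 0 ∧ lau P P g = AddMonoidAlgebra.single (-w) c := by
  classical
  have hw := mem_weightSpace_iff.1 h.2
  have hsingle : lau P P g = AddMonoidAlgebra.single (-w) ((lau P P g).coeff (-w)) := by
    refine AddMonoidAlgebra.coeff_injective (Finsupp.ext fun v => ?_)
    rw [AddMonoidAlgebra.coeff_single, Finsupp.single_apply]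
    split_ifs with hv
    · rw [hv]
    · by_contra hne
      exact hv (hw v hne).symm
  refine ⟨_, fun h0 => ?_, hsingle⟩
  rw [h0, AddMonoidAlgebra.single_zero] at hsingle
  exact lau_ne_zero h.1 hsingle

/-- The decomposition into eigenfunctions is the decomposition into monomials; each monomial of `g`
is itself regular because its exponent lies in the semigroup. -/
lemma mem_weightsOf_iff {g : CoordRing K P P} {w : HatM n} :
    w ∈ weightsOf g ↔ (lau P P g).coeff (-w) ≠ 0 := by
  classical
  constructor
  · rintro ⟨G, hG, rfl, hw⟩
    have key : ∀ v, v ≠ w → (lau P P (G v)).coeff (-w) = 0 := by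
      intro v hv
      by_contra hne
      exact hv (neg_injective (mem_weightSpace_iff.1 (hG v) _ hne)).symm
    rw [Finsupp.sum, map_sum, AddMonoidAlgebra.coeff_sum, Finset.sum_apply',
      Finset.sum_eq_single w (fun v _ hv => key v hv)
        (fun h => absurd (Finsupp.mem_support_iff.2 hw) h)]
    obtain ⟨c, hc, h⟩ := IsEigenfunction.exists_lau_eq ⟨hw, hG w⟩
    rw [h]
    simpa [AddMonoidAlgebra.coeff_single] using hc
  · intro hw
    have hex : ∀ v, ∃ a : CoordRing K P P,
        lau P P a = AddMonoidAlgebra.single v ((lau P P g).coeff v) := by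
      intro v
      refine Toric.exists_lau_eq fun u hu => ?_
      rw [AddMonoidAlgebra.coeff_single, Finsupp.single_apply] at hu
      split_ifs at hu with h
      · rw [← h]
        exact mem_semi_of_lau hu
      · exact absurd rfl hu
    choose G hG using hex
    have hG0 : ∀ v, G v = 0 ↔ (lau P P g).coeff v = 0 := by
      intro v
      rw [← map_eq_zero_iff _ lau_injective, hG, AddMonoidAlgebra.single_eq_zero]
    refine ⟨Finsupp.onFinset ((lau P P g).coeff.support.image Neg.neg) (fun v => G (-v)) ?_,
      ?_, ?_, ?_⟩
    · intro v hv
      rw [Finset.mem_image]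
      exact ⟨-v, Finsupp.mem_support_iff.2 (fun h => hv ((hG0 _).2 h)), neg_neg v⟩
    · intro v
      refine mem_weightSpace_iff.2 fun u hu => ?_
      rw [Finsupp.onFinset_apply, hG, AddMonoidAlgebra.coeff_single, Finsupp.single_apply] at hu
      split_ifs at hu with h
      · exact h.symm
      · exact absurd rfl hu
    · rw [Finsupp.onFinset_sum _ (fun _ => rfl),
        Finset.sum_image (fun a _ b _ h => neg_injective h)]
      apply lau_injective
      conv_rhs => rw [← AddMonoidAlgebra.sum_coeff_single (lau P P g)]
      rw [map_sum, Finsupp.sum]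
      exact Finset.sum_congr rfl fun v _ => by rw [neg_neg, hG]
    · rw [Finsupp.onFinset_apply, Ne, hG0]
      exact hw

/-! ### The linear-algebra valuation -/

section Chain

variable {S : CombSeshadri K P} {C : MaxChain (Face P)} {co : HatM n →+ (Fin (C.r + 1) → ℚ)}

/-- The two signs cancel: a weight expressed in the `μ_{τ_i}` has the same coordinates as the
opposite exponent expressed in the `-μ_{τ_i}`. -/
theorem nuChain_eq
    (hrat : ∀ w a, toRat w = ∑ i, a i • toRat (S.μ (C.face i)) ↔ a = co (-w))
    {g : CoordRing K P P} (hg : g ≠ 0) :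
    S.nuChain C g = co (lead ((revLex C.r).comp co) g) := by
  have hlead := isLead_lead ((revLex C.r).comp co) hg
  refine IsLexMin.lexMin_eq inferInstance ⟨⟨-lead ((revLex C.r).comp co) g, ?_, ?_⟩, ?_⟩
  · rw [mem_weightsOf_iff, neg_neg]
    exact hlead.1
  · rw [hrat, neg_neg]
  · rintro a ⟨w, hw, ha⟩
    rw [hrat] at ha
    subst ha
    rw [mem_weightsOf_iff] at hw
    rw [← revLex_lt_iff]
    rcases (hlead.2 _ hw).eq_or_lt with h | h
    · exact Or.inl (revLex_injective h).symm
    · exact Or.inr h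

end Chain

end

end Toric

namespace Toric

noncomputable section

open scoped Pointwise

variable {n : ℕ} {P σ τ : Set (Fin n → ℝ)}

/-! ### Cones over polytopes -/

/-- The inclusion `M̂ ⊆ M̂_ℝ`. -/
def emb : HatM n →+ ℝ × (Fin n → ℝ) where
  toFun w := ((w.1 : ℝ), toReal w.2)
  map_zero' := by ext <;> simp [toReal]
  map_add' v w := by ext <;> simp [toReal]

/-- The cone over `{1} × σ`. -/
def InCone (σ : Set (Fin n → ℝ)) (v : ℝ × (Fin n → ℝ)) : Prop := 0 ≤ v.1 ∧ v.2 ∈ v.1 • σ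

/-- The linear span of `{1} × σ`. -/
def hatSpan (σ : Set (Fin n → ℝ)) : Submodule ℝ (ℝ × (Fin n → ℝ)) :=
  Submodule.span ℝ ((fun x => ((1 : ℝ), x)) '' σ)

lemma mem_hatSpan {x : Fin n → ℝ} (hx : x ∈ σ) : ((1 : ℝ), x) ∈ hatSpan σ :=
  Submodule.subset_span ⟨x, hx, rfl⟩

lemma hatSpan_mono (h : σ ⊆ τ) : hatSpan σ ≤ hatSpan τ :=
  Submodule.span_mono (Set.image_mono h)

lemma emb_mem_hatSpan {w : HatM n} (hw : w ∈ semi P σ) : emb w ∈ hatSpan σ := by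
  induction hw using AddSubmonoid.closure_induction with
  | mem w h =>
    obtain ⟨χ, hχ, rfl⟩ := h
    have : emb ((1, χ.1) : HatM n) = (1, toReal χ.1) := by simp [emb]
    rw [this]
    exact mem_hatSpan hχ
  | zero => rw [map_zero]; exact zero_mem _
  | add v w _ _ hv hw => rw [map_add]; exact add_mem hv hw

lemma inCone_iff {v : ℝ × (Fin n → ℝ)} :
    InCone σ v ↔ ∃ c : ℝ, 0 ≤ c ∧ ∃ x ∈ σ, v = c • ((1 : ℝ), x) := by
  constructor
  · rintro ⟨h, x, hx, hv⟩
    exact ⟨v.1, h, x, hx, Prod.ext (by simp) (by simpa using hv.symm)⟩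
  · rintro ⟨c, hc, x, hx, rfl⟩
    exact ⟨by simpa using hc, x, hx, by simp⟩

lemma InCone.mono (h : σ ⊆ τ) {v : ℝ × (Fin n → ℝ)} (hv : InCone σ v) : InCone τ v :=
  ⟨hv.1, Set.smul_set_mono h hv.2⟩

lemma InCone.add (hσ : Convex ℝ σ) {v w : ℝ × (Fin n → ℝ)} (hv : InCone σ v)
    (hw : InCone σ w) : InCone σ (v + w) := by
  refine ⟨add_nonneg hv.1 hw.1, ?_⟩
  rw [Prod.fst_add, hσ.add_smul hv.1 hw.1]
  exact Set.add_mem_add hv.2 hw.2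

lemma InCone.smul {v : ℝ × (Fin n → ℝ)} (hv : InCone σ v) {c : ℝ} (hc : 0 ≤ c) :
    InCone σ (c • v) := by
  obtain ⟨d, hd, x, hx, rfl⟩ := inCone_iff.1 hv
  exact inCone_iff.2 ⟨c * d, mul_nonneg hc hd, x, hx, by rw [mul_smul]⟩

lemma InCone.map_nonneg {f : ℝ × (Fin n → ℝ) →ₗ[ℝ] ℝ} (hf : ∀ x ∈ σ, 0 ≤ f (1, x))
    {v : ℝ × (Fin n → ℝ)} (hv : InCone σ v) : 0 ≤ f v := by
  obtain ⟨d, hd, x, hx, rfl⟩ := inCone_iff.1 hv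
  rw [map_smul]
  exact mul_nonneg hd (hf x hx)

lemma eq_zero_of_mem_hatSpan {f : ℝ × (Fin n → ℝ) →ₗ[ℝ] ℝ} (hf : ∀ x ∈ σ, f (1, x) = 0)
    {v : ℝ × (Fin n → ℝ)} (hv : v ∈ hatSpan σ) : f v = 0 := by
  have : hatSpan σ ≤ LinearMap.ker f := by
    rw [hatSpan, Submodule.span_le]
    rintro _ ⟨x, hx, rfl⟩
    exact hf x hx
  exact this hv

lemma InCone.mem_hatSpan {v : ℝ × (Fin n → ℝ)} (hv : InCone σ v) : v ∈ hatSpan σ := by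
  obtain ⟨d, hd, x, hx, rfl⟩ := inCone_iff.1 hv
  exact Submodule.smul_mem _ _ (Toric.mem_hatSpan hx)

/-- A point of the relative interior of `σ` can be moved a little beyond itself, away from any
point of `σ`. -/
lemma exists_extend_of_mem_intrinsicInterior {x e : Fin n → ℝ}
    (hx : x ∈ intrinsicInterior ℝ σ) (he : e ∈ σ) :
    ∃ ε : ℝ, 0 < ε ∧ x + ε • (x - e) ∈ σ := by
  obtain ⟨y, hy, rfl⟩ := mem_intrinsicInterior.1 hx
  have he' : e ∈ affineSpan ℝ σ := subset_affineSpan ℝ σ he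
  -- The line through the point and `e`, inside the affine span and parametrized so that positive
  -- `ε` leads away from `e`.
  let φ : ℝ → affineSpan ℝ σ := fun ε =>
    ⟨AffineMap.lineMap (y : Fin n → ℝ) e (-ε), AffineMap.lineMap_mem _ y.2 he'⟩
  have hφ : Continuous φ := by
    refine Continuous.subtype_mk ?_ _
    exact AffineMap.lineMap_continuous.comp continuous_neg
  have hφ0 : φ 0 = y := Subtype.ext (by simp [φ])
  have hnhds : φ ⁻¹' ((↑) ⁻¹' σ) ∈ nhds (0 : ℝ) := by
    refine hφ.continuousAt ?_
    rw [hφ0]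
    exact mem_interior_iff_mem_nhds.1 hy
  obtain ⟨δ, hδ, hball⟩ := Metric.mem_nhds_iff.1 hnhds
  refine ⟨δ / 2, half_pos hδ, ?_⟩
  have := hball (show δ / 2 ∈ Metric.ball (0 : ℝ) δ by
    rw [Metric.mem_ball, dist_zero_right, Real.norm_of_nonneg (half_pos hδ).le]
    exact half_lt_self hδ)
  have h2 : (AffineMap.lineMap (y : Fin n → ℝ) e (-(δ / 2)) : Fin n → ℝ) ∈ σ := this
  rw [AffineMap.lineMap_apply] at h2
  convert h2 using 1
  simp only [vsub_eq_sub, vadd_eq_add]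
  module

/-- Every vector of the span of the cone over `σ` is moved into the cone by a large multiple of a
point of the relative interior. -/
lemma exists_inCone_add_smul (hσ : Convex ℝ σ) {x : Fin n → ℝ}
    (hx : x ∈ intrinsicInterior ℝ σ) {v : ℝ × (Fin n → ℝ)} (hv : v ∈ hatSpan σ) :
    ∃ N : ℝ, 0 ≤ N ∧ ∀ M, N ≤ M → InCone σ (v + M • ((1 : ℝ), x)) := by
  have hxσ : InCone σ ((1 : ℝ), x) :=
    inCone_iff.2 ⟨1, zero_le_one, x, intrinsicInterior_subset hx, by simp⟩
  -- Treating `v` and `-v` together lets the induction pass through negative scalars.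
  suffices h : ∃ N : ℝ, 0 ≤ N ∧ InCone σ (v + N • ((1 : ℝ), x)) ∧
      InCone σ (-v + N • ((1 : ℝ), x)) by
    obtain ⟨N, hN, h1, -⟩ := h
    refine ⟨N, hN, fun M hM => ?_⟩
    have := h1.add hσ (hxσ.smul (sub_nonneg.2 hM))
    rwa [add_assoc, ← add_smul, add_sub_cancel] at this
  induction hv using Submodule.span_induction with
  | mem v hv =>
    obtain ⟨e, he, rfl⟩ := hv
    obtain ⟨ε, hε, h⟩ := exists_extend_of_mem_intrinsicInterior hx he
    have he' : InCone σ ((1 : ℝ), e) := inCone_iff.2 ⟨1, zero_le_one, e, he, by simp⟩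
    -- This vector is `ε⁻¹ • (1, x + ε • (x - e))`.
    have h' : InCone σ (-((1 : ℝ), e) + ((1 + ε) / ε) • ((1 : ℝ), x)) := by
      refine inCone_iff.2 ⟨ε⁻¹, by positivity, _, h, ?_⟩
      refine Prod.ext ?_ ?_
      · simp
        field_simp
        ring
      · simp only [Prod.snd_add, Prod.snd_neg, Prod.smul_snd]
        rw [smul_add, smul_smul, inv_mul_cancel₀ hε.ne', add_div, div_self hε.ne', one_div]
        module
    exact ⟨(1 + ε) / ε, by positivity, he'.add hσ (hxσ.smul (by positivity)), h'⟩
  | zero => exact ⟨0, le_rfl, by simpa using hxσ.smul le_rfl, by simpa using hxσ.smul le_rfl⟩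
  | add v w _ _ hv hw =>
    obtain ⟨N, hN, h1, h2⟩ := hv
    obtain ⟨M, hM, h3, h4⟩ := hw
    refine ⟨N + M, add_nonneg hN hM, ?_, ?_⟩
    · convert h1.add hσ h3 using 1
      module
    · convert h2.add hσ h4 using 1
      module
  | smul a v _ hv =>
    obtain ⟨N, hN, h1, h2⟩ := hv
    refine ⟨|a| * N, by positivity, ?_⟩
    rcases le_total 0 a with ha | ha
    · rw [abs_of_nonneg ha]
      constructor
      · convert h1.smul ha using 1
        module
      · convert h2.smul ha using 1
        module
    · rw [abs_of_nonpos ha]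
      constructor
      · convert h2.smul (neg_nonneg.2 ha) using 1
        module
      · convert h1.smul (neg_nonneg.2 ha) using 1
        module

/-- Were `f` zero at `x`, its value at a cone point `-(1, e) + N • (1, x)` would be `-f (1, e)`,
forcing `f (1, e) ≤ 0`. -/
lemma pos_of_mem_intrinsicInterior (hσ : Convex ℝ σ) {x e : Fin n → ℝ}
    (hx : x ∈ intrinsicInterior ℝ σ) (he : e ∈ σ) {f : ℝ × (Fin n → ℝ) →ₗ[ℝ] ℝ}
    (hf : ∀ x ∈ σ, 0 ≤ f (1, x)) (hfe : f (1, e) ≠ 0) : 0 < f (1, x) := by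
  refine lt_of_le_of_ne (hf x (intrinsicInterior_subset hx)) fun h0 => ?_
  obtain ⟨N, -, hN⟩ := exists_inCone_add_smul hσ hx (neg_mem (mem_hatSpan he))
  have h1 := (hN N le_rfl).map_nonneg hf
  rw [map_add, map_neg, map_smul, ← h0, smul_zero, add_zero] at h1
  exact hfe (le_antisymm (by linarith) (hf e he))

/-! ### Faces of lattice polytopes -/

lemma map_one_eq (f : ℝ × (Fin n → ℝ) →ₗ[ℝ] ℝ) (x : Fin n → ℝ) :
    f (1, x) = f (1, 0) + f (0, x) := by
  rw [← map_add]
  simp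

/-- `f` is nonnegative on the cone over `P`, and vanishes exactly on the cone over `σ`. -/
structure Supports (P σ : Set (Fin n → ℝ)) (f : ℝ × (Fin n → ℝ) →ₗ[ℝ] ℝ) : Prop where
  nonneg : ∀ x ∈ P, 0 ≤ f (1, x)
  eq_zero_iff : ∀ x ∈ P, f (1, x) = 0 ↔ x ∈ σ

/-- Homogenize the exposing functional: maximum times height minus functional. For the empty face
the height alone works. -/
lemma exists_supports (hσ : IsExposed ℝ P σ) : ∃ f, Supports P σ f := by
  rcases Set.eq_empty_or_nonempty σ with rfl | hne
  · exact ⟨LinearMap.fst ℝ ℝ _, by simp, by simp⟩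
  · obtain ⟨l, hl⟩ := hσ hne
    obtain ⟨x0, hx0⟩ := hne
    have hx0' := hx0
    rw [hl] at hx0'
    refine ⟨l x0 • LinearMap.fst ℝ ℝ _ - (l : (Fin n → ℝ) →ₗ[ℝ] ℝ) ∘ₗ LinearMap.snd ℝ ℝ _,
      fun x hx => ?_, fun x hx => ?_⟩
    · simpa using hx0'.2 x hx
    · have h1 := hx0'.2 x hx
      simp only [LinearMap.sub_apply, LinearMap.smul_apply, LinearMap.fst_apply, smul_eq_mul,
        mul_one, LinearMap.comp_apply, LinearMap.snd_apply, ContinuousLinearMap.coe_coe]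
      rw [hl]
      constructor
      · intro h
        exact ⟨hx, fun y hy => (hx0'.2 y hy).trans (by linarith)⟩
      · intro h
        have := h.2 x0 hx0'.1
        linarith

lemma isExposed_of_nonneg {f : ℝ × (Fin n → ℝ) →ₗ[ℝ] ℝ} (hf : ∀ x ∈ P, 0 ≤ f (1, x)) :
    IsExposed ℝ P {x ∈ P | f (1, x) = 0} := by
  rintro ⟨x0, hx0, h0⟩
  refine ⟨-(LinearMap.toContinuousLinearMap (f ∘ₗ LinearMap.inr ℝ ℝ (Fin n → ℝ))), ?_⟩
  ext x
  simp only [Set.mem_ofPred_eq, neg_apply,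
    LinearMap.coe_toContinuousLinearMap', LinearMap.comp_apply, LinearMap.inr_apply]
  refine and_congr_right fun hx => ⟨fun h y hy => ?_, fun h => ?_⟩
  · have := hf y hy
    rw [map_one_eq] at h this
    linarith
  · have h1 := h x0 hx0
    have h2 := hf x hx
    rw [map_one_eq] at h0 h2 ⊢
    linarith

lemma nonneg_of_convexHull {E : Set (Fin n → ℝ)} {f : ℝ × (Fin n → ℝ) →ₗ[ℝ] ℝ}
    (hf : ∀ x ∈ E, 0 ≤ f (1, x)) {x : Fin n → ℝ} (hx : x ∈ convexHull ℝ E) : 0 ≤ f (1, x) := by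
  have : convexHull ℝ E ⊆ {x | 0 ≤ f (1, x)} := by
    refine convexHull_min hf ?_
    intro x hx y hy a b ha hb hab
    have h1 : ((1 : ℝ), a • x + b • y) = a • ((1 : ℝ), x) + b • ((1 : ℝ), y) := by
      ext <;> simp [hab]
    have h2 : 0 ≤ f (1, x) := hx
    have h3 : 0 ≤ f (1, y) := hy
    rw [Set.mem_ofPred_eq, h1, map_add, map_smul, map_smul, smul_eq_mul, smul_eq_mul]
    positivity
  exact this hx

/-- A functional that is nonnegative at the vertices where `g ≥ 0` vanishes becomes nonnegative on
the polytope after adding a large multiple of `g`. -/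
lemma exists_nonneg_add_smul {E : Set (Fin n → ℝ)} (hE : E.Finite)
    {f g : ℝ × (Fin n → ℝ) →ₗ[ℝ] ℝ} (hg : ∀ x ∈ E, 0 ≤ g (1, x))
    (hf : ∀ x ∈ E, g (1, x) = 0 → 0 ≤ f (1, x)) :
    ∃ N : ℝ, ∀ x ∈ convexHull ℝ E, 0 ≤ f (1, x) + N * g (1, x) := by
  obtain ⟨N, hN⟩ := (hE.image fun x => -f (1, x) / g (1, x)).bddAbove
  refine ⟨N, fun x hx => ?_⟩
  refine nonneg_of_convexHull (f := f + N • g) (fun y hy => ?_) hx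
  rw [LinearMap.add_apply, LinearMap.smul_apply, smul_eq_mul]
  rcases (hg y hy).eq_or_lt with h | h
  · rw [← h, mul_zero, add_zero]
    exact hf y hy h.symm
  · have := hN ⟨y, hy, rfl⟩
    dsimp only at this
    rw [div_le_iff₀ h] at this
    linarith

/-- The dimension of a face exceeds that of a maximal proper face by one. -/
lemma hatSpan_le_of_covers {E : Set (Fin n → ℝ)} (hE : E.Finite) (hP : P = convexHull ℝ E)
    (hσ : IsExposed ℝ P σ) (hτ : IsExposed ℝ P τ) (hστ : σ ⊂ τ)
    (hcov : ∀ F, F.Nonempty → IsExposed ℝ P F → σ ⊂ F → F ⊆ τ → F = τ)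
    {y : Fin n → ℝ} (hy : y ∈ intrinsicInterior ℝ τ) :
    hatSpan τ ≤ hatSpan σ ⊔ Submodule.span ℝ {((1 : ℝ), y)} := by
  obtain ⟨l, hl⟩ := exists_supports hσ
  obtain ⟨m, hm⟩ := exists_supports hτ
  have hPconv : Convex ℝ P := hP ▸ convex_convexHull ℝ E
  have hEP : E ⊆ P := hP ▸ subset_convexHull ℝ E
  have hτP : τ ⊆ P := hτ.subset
  have hly : 0 < l (1, y) := by
    obtain ⟨e, heτ, heσ⟩ := Set.exists_of_ssubset hστ
    exact pos_of_mem_intrinsicInterior (hτ.convex hPconv) hy heτ (fun x hx => hl.nonneg x (hτP hx))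
      fun h => heσ ((hl.eq_zero_iff e (hτP heτ)).1 h)
  by_contra hcon
  obtain ⟨v, hv, hvW⟩ := SetLike.not_le_iff_exists.1 hcon
  -- If the dimension jumped by more, there would be a second functional on the span of `τ`, zero on
  -- `σ` and at `y`. Tilting `l` with it produces a face strictly between.
  obtain ⟨φ, hφv, hφ⟩ := Submodule.exists_le_ker_of_notMem hvW
  have hφσ : ∀ x ∈ σ, φ (1, x) = 0 := fun x hx =>
    hφ (Submodule.mem_sup_left (mem_hatSpan hx))
  have hφy : φ (1, y) = 0 :=
    hφ (Submodule.mem_sup_right (Submodule.mem_span_singleton_self _))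
  -- Otherwise `-l` plus a multiple of `m` would be nonnegative on `P`, contradicting `l > 0` and `m
  -- = 0` at `y`.
  have hT : {p ∈ E | p ∈ τ ∧ 0 < l (1, p)}.Nonempty := by
    by_contra hempty
    rw [Set.not_nonempty_iff_eq_empty] at hempty
    obtain ⟨N, hN⟩ := exists_nonneg_add_smul hE (f := -l) (g := m)
      (fun x hx => hm.nonneg x (hEP hx)) (fun x hx h0 => by
        by_contra hneg
        rw [LinearMap.neg_apply, neg_nonneg, not_le] at hneg
        exact hempty.subset ⟨hx, (hm.eq_zero_iff x (hEP hx)).1 h0, hneg⟩)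
    have h1 := hN y (hP ▸ hτP (intrinsicInterior_subset hy))
    rw [(hm.eq_zero_iff y (hτP (intrinsicInterior_subset hy))).2 (intrinsicInterior_subset hy),
      mul_zero, add_zero, LinearMap.neg_apply] at h1
    linarith
  -- With the smallest ratio `c`, the functional `φ - c • l` is nonnegative on the generators in `τ`
  -- and vanishes on `σ` and at the additional point `p`.
  obtain ⟨p, ⟨hpE, hpτ, hp⟩, hmin⟩ := Set.exists_min_image _ (fun p => φ (1, p) / l (1, p))
    (hE.subset (Set.sep_subset _ _)) hT
  set c := φ (1, p) / l (1, p) with hc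
  obtain ⟨N, hN⟩ := exists_nonneg_add_smul hE (f := φ - c • l) (g := m)
    (fun x hx => hm.nonneg x (hEP hx)) (fun x hx h0 => by
      have hxτ := (hm.eq_zero_iff x (hEP hx)).1 h0
      rw [LinearMap.sub_apply, LinearMap.smul_apply, smul_eq_mul, sub_nonneg]
      rcases (hl.nonneg x (hEP hx)).eq_or_lt with h | h
      · rw [← h, hφσ x ((hl.eq_zero_iff x (hEP hx)).1 h.symm), mul_zero]
      · exact (le_div_iff₀ h).1 (hmin x ⟨hx, hxτ, h⟩))
  -- The extra copy of `m` makes `θ ≥ m`, so that the face where `θ` vanishes is contained in `τ`.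
  set θ := φ - c • l + (N + 1) • m with hθ
  have hθ' : ∀ x, θ (1, x) = φ (1, x) - c * l (1, x) + N * m (1, x) + m (1, x) := by
    intro x
    simp only [hθ, LinearMap.add_apply, LinearMap.sub_apply, LinearMap.smul_apply, smul_eq_mul]
    ring
  have hθm : ∀ x ∈ P, m (1, x) ≤ θ (1, x) := by
    intro x hx
    have h1 := hN x (hP ▸ hx)
    rw [LinearMap.sub_apply, LinearMap.smul_apply, smul_eq_mul] at h1
    rw [hθ']
    linarith
  have hF := isExposed_of_nonneg fun x hx => (hm.nonneg x hx).trans (hθm x hx)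
  have hpF : p ∈ {x ∈ P | θ (1, x) = 0} := by
    refine ⟨hEP hpE, ?_⟩
    rw [hθ', (hm.eq_zero_iff p (hEP hpE)).2 hpτ, hc, div_mul_cancel₀ _ hp.ne']
    ring
  have hFτ := hcov _ ⟨p, hpF⟩ hF (by
    refine ⟨fun x hx => ⟨hτP (hστ.1 hx), ?_⟩, fun h => ?_⟩
    · rw [hθ', hφσ x hx, (hm.eq_zero_iff x (hτP (hστ.1 hx))).2 (hστ.1 hx),
        (hl.eq_zero_iff x (hτP (hστ.1 hx))).2 hx]
      ring
    · exact hp.ne' ((hl.eq_zero_iff p (hEP hpE)).2 (h hpF))) (fun x hx =>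
      (hm.eq_zero_iff x hx.1).1 (le_antisymm ((hθm x hx.1).trans hx.2.le) (hm.nonneg x hx.1)))
  have hφl : ∀ x ∈ τ, φ (1, x) = c * l (1, x) := by
    intro x hx
    have h1 := hx
    rw [← hFτ] at h1
    have h2 := h1.2
    rw [hθ', (hm.eq_zero_iff x (hτP hx)).2 hx] at h2
    linarith
  have hc0 : c = 0 := by
    have := hφl y (intrinsicInterior_subset hy)
    rw [hφy] at this
    exact (mul_eq_zero.1 this.symm).resolve_right hly.ne'
  exact hφv (eq_zero_of_mem_hatSpan (fun x hx => by rw [hφl x hx, hc0, zero_mul]) hv)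

lemma hatSpan_eq_top (hP : (interior P).Nonempty) : hatSpan P = ⊤ := by
  obtain ⟨x, hx⟩ := hP
  have hxP := mem_hatSpan (interior_subset hx)
  have hdir : ∀ d : Fin n → ℝ, ((0 : ℝ), d) ∈ hatSpan P := by
    intro d
    have hcont : Continuous fun ε : ℝ => x + ε • d := by fun_prop
    have hnhds : (fun ε : ℝ => x + ε • d) ⁻¹' P ∈ nhds (0 : ℝ) := by
      refine hcont.continuousAt ?_
      rw [zero_smul, add_zero]
      exact mem_interior_iff_mem_nhds.1 hx
    obtain ⟨δ, hδ, hball⟩ := Metric.mem_nhds_iff.1 hnhds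
    have h1 := hball (show δ / 2 ∈ Metric.ball (0 : ℝ) δ by
      rw [Metric.mem_ball, dist_zero_right, Real.norm_of_nonneg (half_pos hδ).le]
      exact half_lt_self hδ)
    have h2 := (hatSpan P).smul_mem (δ / 2)⁻¹ (sub_mem (mem_hatSpan h1) hxP)
    convert h2 using 1
    ext i
    · simp
    · simp
      field_simp
  rw [eq_top_iff]
  rintro ⟨c, y⟩ -
  have := add_mem ((hatSpan P).smul_mem c hxP) (hdir (y - c • x))
  convert this using 1
  ext <;> simp

lemma finite_latticePts (hP : IsLatticePolytope P) : Finite (LatticePts P) := by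
  obtain ⟨E, -, rfl⟩ := hP
  have hb : Bornology.IsBounded (convexHull ℝ (toReal '' (E : Set (Fin n → ℤ)))) :=
    isBounded_convexHull.2 (E.finite_toSet.image _).isBounded
  obtain ⟨R, hR⟩ := hb.exists_norm_le
  refine Set.Finite.subset (Set.finite_Icc (fun _ => -⌈R⌉ : Fin n → ℤ) (fun _ => ⌈R⌉)) ?_
  intro χ hχ
  have h : ∀ i, |(χ i : ℝ)| ≤ ⌈R⌉ := fun i =>
    (norm_le_pi_norm (toReal χ) i).trans ((hR _ hχ).trans (Int.le_ceil R))
  exact ⟨fun i => by exact_mod_cast (abs_le.1 (h i)).1, fun i => by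
    exact_mod_cast (abs_le.1 (h i)).2⟩

/-- A face is determined by the generators of `P` that it contains, and there are finitely many
generators. -/
lemma finite_face (hP : IsLatticePolytope P) : Finite (Face P) := by
  obtain ⟨E, -, hE⟩ := hP
  set V := toReal '' (E : Set (Fin n → ℤ))
  have hV : V.Finite := E.finite_toSet.image _
  have hVP : V ⊆ P := hE ▸ subset_convexHull ℝ V
  have key : ∀ F G : Face P, F.1 ∩ V ⊆ G.1 ∩ V → F.1 ⊆ G.1 := by
    intro F G h x hx
    obtain ⟨f, hf⟩ := exists_supports F.2.2
    obtain ⟨g, hg⟩ := exists_supports G.2.2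
    obtain ⟨N, hN⟩ := exists_nonneg_add_smul hV (f := -g) (g := f)
      (fun x hx => hf.nonneg x (hVP hx)) (fun x hx h0 => by
        have := (h ⟨(hf.eq_zero_iff x (hVP hx)).1 h0, hx⟩).1
        rw [LinearMap.neg_apply, (hg.eq_zero_iff x (hVP hx)).2 this, neg_zero])
    have hxP := F.2.2.subset hx
    have h1 := hN x (hE ▸ hxP)
    rw [(hf.eq_zero_iff x hxP).2 hx, mul_zero, add_zero, LinearMap.neg_apply, neg_nonneg] at h1
    exact (hg.eq_zero_iff x hxP).1 (le_antisymm h1 (hg.nonneg x hxP))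
  have : Finite (Set.powerset V) := hV.powerset
  refine Finite.of_injective
    (fun F : Face P => (⟨F.1 ∩ V, Set.inter_subset_right⟩ : Set.powerset V)) fun F G h => ?_
  have h' : F.1 ∩ V = G.1 ∩ V := congrArg Subtype.val h
  exact Subtype.ext ((key F G h'.subset).antisymm (key G F h'.symm.subset))

lemma IsLatticePolytope.convex (hP : IsLatticePolytope P) : Convex ℝ P := by
  obtain ⟨E, -, rfl⟩ := hP
  exact convex_convexHull ℝ _

/-- By normality, the lattice points of the cone over a face are sums of elements of height one. -/
lemma mem_semi_of_inCone (hnormal : IsNormalPolytope P) (hσ : IsExposed ℝ P σ) {w : HatM n}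
    (hw : InCone σ (emb w)) : w ∈ semi P σ := by
  -- Normality splits off one lattice point of `P` at a time.
  have key : ∀ (k : ℕ) (a : Fin n → ℤ), toReal a ∈ (k : ℝ) • P →
      (((k : ℤ), a) : HatM n) ∈ semi P P := by
    intro k
    induction k with
    | zero =>
      rintro a ⟨x, -, hx⟩
      have : a = 0 := by
        funext i
        have := congrFun hx i
        simp only [toReal, Nat.cast_zero, zero_smul, Pi.zero_apply] at this
        exact_mod_cast this.symm
      rw [this]
      exact zero_mem _
    | succ k ih =>
      intro a ha
      have h1 : a ∈ {a : Fin n → ℤ | toReal a ∈ ((k + 1 : ℕ) : ℝ) • P} := ha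
      rw [← hnormal k 1] at h1
      obtain ⟨b, hb, c, hc, rfl⟩ := h1
      have hc' : toReal c ∈ P := by simpa using hc
      have h2 := add_mem (ih b hb) (mem_semi_of_mem (P := P) ⟨c, hc'⟩ hc')
      simpa using h2
  obtain ⟨l, hl⟩ := exists_supports hσ
  obtain ⟨k, hk⟩ := Int.eq_ofNat_of_zero_le (show (0 : ℤ) ≤ w.1 from (Int.cast_nonneg_iff (R := ℝ)).1 hw.1)
  have hwP : w ∈ semi P P := by
    have := key k w.2 (by
      have := (hw.mono hσ.subset).2
      have h1 : (emb w).1 = (k : ℝ) := by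
        change ((w.1 : ℤ) : ℝ) = k
        rw [hk]
        simp
      rwa [h1] at this)
    rwa [← hk] at this
  have hemb : ∀ χ : LatticePts P, emb ((1, χ.1) : HatM n) = (1, toReal χ.1) := fun χ => by
    simp [emb]
  -- The functional supporting `σ` vanishes at `w`, hence at every summand.
  refine mem_semi_of_eq_zero (l := (l : ℝ × (Fin n → ℝ) →+ ℝ).comp emb) (τ := P) ?_ ?_ hwP ?_
  · intro χ _
    simpa [hemb] using hl.nonneg _ χ.2
  · intro χ _ h
    refine (hl.eq_zero_iff _ χ.2).1 ?_
    simpa [hemb] using h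
  · exact eq_zero_of_mem_hatSpan (fun x hx => (hl.eq_zero_iff x (hσ.subset hx)).2 hx) hw.mem_hatSpan

end

end Toric

namespace Toric

noncomputable section

variable {n : ℕ} {K : Type*} [Field K] {P : Set (Fin n → ℝ)}

/-! ### Coordinates attached to a maximal chain of faces -/

section ChainBasis

variable (S : CombSeshadri K P) (C : MaxChain (Face P))

/-- The vector `-μ_{τ_i}` of `M̂_ℝ`. -/
def chainVec (i : Fin (C.r + 1)) : ℝ × (Fin n → ℝ) := emb (-S.μ (C.face i))

lemma chain_mono {i j : Fin (C.r + 1)} (h : i ≤ j) : (C.face i).1 ⊆ (C.face j).1 :=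
  (Fin.strictMono_iff_lt_succ.2 fun i => (C.covBy i).lt).monotone h

lemma prevFace_exposed (i : Fin (C.r + 1)) : IsExposed ℝ P (prevFace C i) := by
  induction i using Fin.cases with
  | zero => exact fun h => absurd h Set.not_nonempty_empty
  | succ j => exact (C.face j.castSucc).2.2

lemma prevFace_ssubset (i : Fin (C.r + 1)) : prevFace C i ⊂ (C.face i).1 := by
  induction i using Fin.cases with
  | zero => exact Set.empty_ssubset.2 (C.face 0).2.1
  | succ j => exact (C.covBy j).lt

lemma subset_prevFace {i j : Fin (C.r + 1)} (h : j < i) : (C.face j).1 ⊆ prevFace C i := by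
  induction i using Fin.cases with
  | zero => exact absurd h (Fin.not_lt_zero j)
  | succ i => exact chain_mono C (Fin.le_castSucc_iff.2 h)

lemma eq_of_prevFace_ssubset (i : Fin (C.r + 1)) (F : Set (Fin n → ℝ)) (hne : F.Nonempty)
    (hF : IsExposed ℝ P F) (h1 : prevFace C i ⊂ F) (h2 : F ⊆ (C.face i).1) :
    F = (C.face i).1 := by
  let F' : Face P := ⟨F, hne, hF⟩
  induction i using Fin.cases with
  | zero => exact h2.antisymm (C.isMin (b := F') h2)
  | succ j =>
    by_contra hcon
    exact (C.covBy j).2 (c := F') h1 (lt_of_le_of_ne h2 fun h => hcon (congrArg Subtype.val h))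

lemma chainVec_eq (i : Fin (C.r + 1)) : ∃ D : ℝ, 1 ≤ D ∧
    ∃ x ∈ intrinsicInterior ℝ (C.face i).1, chainVec S C i = D • ((1 : ℝ), x) := by
  have h1 := S.one_le_deg (C.face i)
  have hD : (1 : ℝ) ≤ ((-(S.μ (C.face i)).1 : ℤ) : ℝ) := by exact_mod_cast h1
  refine ⟨_, hD, _, S.marking (C.face i), ?_⟩
  have hD0 : ((-(S.μ (C.face i)).1 : ℤ) : ℝ) ≠ 0 := by positivity
  refine Prod.ext ?_ ?_
  · simp [chainVec, emb]
  · rw [Prod.smul_snd, smul_smul, mul_inv_cancel₀ hD0, one_smul]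
    rfl

lemma chainVec_inCone (i : Fin (C.r + 1)) : InCone (C.face i).1 (chainVec S C i) := by
  obtain ⟨D, hD, x, hx, h⟩ := chainVec_eq S C i
  exact inCone_iff.2 ⟨D, by linarith, x, intrinsicInterior_subset hx, h⟩

variable {C} in
lemma chain_supports_pos (hP : Convex ℝ P) {i : Fin (C.r + 1)} {l : ℝ × (Fin n → ℝ) →ₗ[ℝ] ℝ}
    (hl : Supports P (prevFace C i) l) : 0 < l (chainVec S C i) := by
  obtain ⟨D, hD, x, hx, h⟩ := chainVec_eq S C i
  obtain ⟨e, heτ, heσ⟩ := Set.exists_of_ssubset (prevFace_ssubset C i)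
  have hsub := (C.face i).2.2.subset
  have := pos_of_mem_intrinsicInterior ((C.face i).2.2.convex hP) hx heτ
    (fun x hx => hl.nonneg x (hsub hx)) fun h => heσ ((hl.eq_zero_iff e (hsub heτ)).1 h)
  rw [h, map_smul, smul_eq_mul]
  positivity

variable {C} in
lemma chain_supports_eq_zero {i j : Fin (C.r + 1)} (hij : j < i)
    {l : ℝ × (Fin n → ℝ) →ₗ[ℝ] ℝ} (hl : Supports P (prevFace C i) l) :
    l (chainVec S C j) = 0 :=
  eq_zero_of_mem_hatSpan (fun x hx => (hl.eq_zero_iff x ((C.face j).2.2.subset hx)).2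
    (subset_prevFace C hij hx)) (chainVec_inCone S C j).mem_hatSpan

/-- Triangularity: the functional supporting the previous face is positive on the `i`-th vector and
kills all earlier ones. Apply it at the largest index of a relation. -/
lemma chainVec_linearIndependent (hP : Convex ℝ P) : LinearIndependent ℝ (chainVec S C) := by
  rw [Fintype.linearIndependent_iff]
  intro c hc
  by_contra! hne
  obtain ⟨i, hi, hmax⟩ := Set.exists_max_image {i | c i ≠ 0} id (Set.toFinite _) hne
  obtain ⟨l, hl⟩ := exists_supports (prevFace_exposed C i)
  have h := congrArg l hc
  rw [map_sum, map_zero, Finset.sum_eq_single i] at h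
  · rw [map_smul, smul_eq_mul] at h
    exact hi ((mul_eq_zero.1 h).resolve_right (chain_supports_pos S hP hl).ne')
  · intro j _ hj
    rw [map_smul, smul_eq_mul]
    rcases lt_or_gt_of_ne hj with h | h
    · rw [chain_supports_eq_zero S h hl, mul_zero]
    · have : c j = 0 := by
        by_contra hcj
        exact (hmax j hcj).not_gt h
      rw [this, zero_mul]
  · simp

lemma hatSpan_le_span_chainVec (hP : IsLatticePolytope P) (i : Fin (C.r + 1)) :
    hatSpan (C.face i).1 ≤ Submodule.span ℝ (chainVec S C '' Set.Iic i) := by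
  obtain ⟨E, -, hE⟩ := hP
  have key : ∀ i, hatSpan (C.face i).1 ≤
      hatSpan (prevFace C i) ⊔ Submodule.span ℝ (chainVec S C '' Set.Iic i) := by
    intro i
    obtain ⟨D, hD, x, hx, h⟩ := chainVec_eq S C i
    refine (hatSpan_le_of_covers (E.finite_toSet.image _) hE (prevFace_exposed C i)
      (C.face i).2.2 (prevFace_ssubset C i) (eq_of_prevFace_ssubset C i) hx).trans ?_
    refine sup_le_sup_left ?_ _
    rw [Submodule.span_singleton_le_iff_mem]
    have h1 : ((1 : ℝ), x) = D⁻¹ • chainVec S C i := by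
      rw [h, smul_smul, inv_mul_cancel₀ (by positivity), one_smul]
    rw [h1]
    exact Submodule.smul_mem _ _ (Submodule.subset_span ⟨i, Set.self_mem_Iic, rfl⟩)
  induction i using Fin.induction with
  | zero =>
    refine (key 0).trans (sup_le ?_ le_rfl)
    simp [hatSpan, prevFace]
  | succ i ih =>
    refine (key i.succ).trans (sup_le (ih.trans ?_) le_rfl)
    refine Submodule.span_mono (Set.image_mono fun j hj => ?_)
    exact le_trans hj Fin.castSucc_lt_succ.le

lemma last_eq (hP : IsLatticePolytope P) : (C.face (Fin.last C.r)).1 = P := by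
  obtain ⟨E, hE, h⟩ := hP
  have hne : P.Nonempty := h ▸ (hE.to_set.image _).convexHull
  let T : Face P := ⟨P, hne, IsExposed.refl P⟩
  have := C.isMax (b := T) (C.face (Fin.last C.r)).2.2.subset
  exact (C.face (Fin.last C.r)).2.2.subset.antisymm this

/-- The vectors `-μ_{τ_i}` as a basis of `M̂_ℝ`. -/
def chainBasis (hP : IsLatticePolytope P) (hfull : (interior P).Nonempty) :
    Module.Basis (Fin (C.r + 1)) ℝ (ℝ × (Fin n → ℝ)) :=
  Module.Basis.mk (chainVec_linearIndependent S C hP.convex) (by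
    have h := hatSpan_le_span_chainVec S C hP (Fin.last C.r)
    rw [last_eq C hP, hatSpan_eq_top hfull] at h
    exact h.trans (Submodule.span_mono (Set.image_subset_range _ _)))

lemma chainBasis_apply (hP : IsLatticePolytope P) (hfull : (interior P).Nonempty)
    (i : Fin (C.r + 1)) : chainBasis S C hP hfull i = chainVec S C i := by
  simp [chainBasis]

include S in
-- Gives the cardinality needed for the rational basis, and later the finiteness of the set of
-- maximal chains.
lemma chain_length (hP : IsLatticePolytope P) (hfull : (interior P).Nonempty) : C.r = n := by
  have h := Module.finrank_eq_card_basis (chainBasis S C hP hfull)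
  simp only [Module.finrank_prod, Module.finrank_self, Module.finrank_fin_fun,
    Fintype.card_fin] at h
  omega

/-- The inclusion `M̂_ℚ ⊆ M̂_ℝ`. -/
def ratToReal : (ℚ × (Fin n → ℚ)) →ₗ[ℚ] (ℝ × (Fin n → ℝ)) where
  toFun v := ((v.1 : ℝ), fun i => (v.2 i : ℝ))
  map_add' v w := by ext <;> simp
  map_smul' c v := by ext <;> simp [Rat.smul_def]

lemma ratToReal_toRat (w : HatM n) : ratToReal (toRat w) = emb w := by
  ext <;> simp [ratToReal, toRat, emb, toReal]

lemma toRat_add (v w : HatM n) : toRat (v + w) = toRat v + toRat w := by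
  ext <;> simp [toRat]

lemma toRat_neg (w : HatM n) : toRat (-w) = -toRat w := by
  ext <;> simp [toRat]

lemma toRat_injective : Function.Injective (toRat : HatM n → _) := by
  intro v w h
  refine Prod.ext ?_ (funext fun i => ?_)
  · exact Int.cast_injective (α := ℚ) (congrArg Prod.fst h)
  · exact Int.cast_injective (α := ℚ) (congrFun (congrArg Prod.snd h) i)

lemma ratVec_linearIndependent (hP : Convex ℝ P) :
    LinearIndependent ℚ fun i => toRat (-S.μ (C.face i)) := by
  rw [Fintype.linearIndependent_iff]
  intro c hc i
  have h := congrArg ratToReal hc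
  rw [map_sum, map_zero] at h
  have h' : ∑ i, (c i : ℝ) • chainVec S C i = 0 := by
    rw [← h]
    refine Finset.sum_congr rfl fun i _ => ?_
    rw [map_smul, ratToReal_toRat, Rat.cast_smul_eq_qsmul]
    rfl
  have := Fintype.linearIndependent_iff.1 (chainVec_linearIndependent S C hP) _ h' i
  exact_mod_cast this

/-- The vectors `-μ_{τ_i}` as a basis of `M̂_ℚ`. -/
def ratBasis (hP : IsLatticePolytope P) (hfull : (interior P).Nonempty) :
    Module.Basis (Fin (C.r + 1)) ℚ (ℚ × (Fin n → ℚ)) :=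
  basisOfLinearIndependentOfCardEqFinrank (ratVec_linearIndependent S C hP.convex) (by
    simp only [Module.finrank_prod, Module.finrank_self, Module.finrank_fin_fun,
      Fintype.card_fin, chain_length S C hP hfull]
    omega)

lemma ratBasis_apply (hP : IsLatticePolytope P) (hfull : (interior P).Nonempty)
    (i : Fin (C.r + 1)) : ratBasis S C hP hfull i = toRat (-S.μ (C.face i)) := by
  simp [ratBasis]

/-- The coordinates of the elements of `M̂` in the basis `(-μ_{τ_i})_i` of `M̂_ℚ`. -/
def chainCoord (hP : IsLatticePolytope P) (hfull : (interior P).Nonempty) :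
    HatM n →+ (Fin (C.r + 1) → ℚ) where
  toFun w := (ratBasis S C hP hfull).equivFun (toRat w)
  map_zero' := by
    rw [show toRat (0 : HatM n) = 0 by ext <;> simp [toRat], map_zero]
  map_add' v w := by rw [toRat_add, map_add]

variable (hP : IsLatticePolytope P) (hfull : (interior P).Nonempty)

lemma chainCoord_injective : Function.Injective (chainCoord S C hP hfull) :=
  (ratBasis S C hP hfull).equivFun.injective.comp toRat_injective

lemma chainCoord_neg_weight (i : Fin (C.r + 1)) :
    chainCoord S C hP hfull (-S.μ (C.face i)) = Pi.single i 1 := by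
  classical
  funext j
  change (ratBasis S C hP hfull).equivFun (toRat (-S.μ (C.face i))) j = _
  rw [← ratBasis_apply S C hP hfull, Module.Basis.equivFun_self, Pi.single_apply]
  simp [eq_comm]

lemma toRat_eq_sum_iff (w : HatM n) (a : Fin (C.r + 1) → ℚ) :
    toRat w = ∑ i, a i • toRat (S.μ (C.face i)) ↔ a = chainCoord S C hP hfull (-w) := by
  have h : (ratBasis S C hP hfull).equivFun.symm a = -∑ i, a i • toRat (S.μ (C.face i)) := by
    rw [Module.Basis.equivFun_symm_apply, ← Finset.sum_neg_distrib]
    refine Finset.sum_congr rfl fun i _ => ?_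
    rw [ratBasis_apply, toRat_neg, smul_neg]
  change _ ↔ a = (ratBasis S C hP hfull).equivFun (toRat (-w))
  rw [← LinearEquiv.symm_apply_eq, h, toRat_neg, neg_inj, eq_comm]

lemma emb_eq_sum (w : HatM n) :
    emb w = ∑ i, (chainCoord S C hP hfull w i : ℝ) • chainVec S C i := by
  have h := (ratBasis S C hP hfull).sum_equivFun (toRat w)
  rw [← ratToReal_toRat, ← h, map_sum]
  refine Finset.sum_congr rfl fun i _ => ?_
  rw [map_smul, ratBasis_apply, ratToReal_toRat, Rat.cast_smul_eq_qsmul]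
  rfl

lemma chainCoord_eq_zero {i j : Fin (C.r + 1)} {w : HatM n} (hw : emb w ∈ hatSpan (C.face i).1)
    (hij : i < j) : chainCoord S C hP hfull w j = 0 := by
  have h1 := hatSpan_le_span_chainVec S C hP i hw
  have hb : chainVec S C = chainBasis S C hP hfull :=
    funext fun i => (chainBasis_apply S C hP hfull i).symm
  have h2 : (chainBasis S C hP hfull).repr (emb w) j = chainCoord S C hP hfull w j := by
    rw [← Module.Basis.equivFun_apply, emb_eq_sum S C hP hfull, hb,
      ← Module.Basis.equivFun_symm_apply (chainBasis S C hP hfull)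
        (fun i => (chainCoord S C hP hfull w i : ℝ)), LinearEquiv.apply_symm_apply]
  rw [hb, Module.Basis.mem_span_image] at h1
  by_contra hne
  have h3 : j ∈ ((chainBasis S C hP hfull).repr (emb w)).support := by
    rw [Finsupp.mem_support_iff, h2]
    exact_mod_cast hne
  exact (h1 h3).not_gt hij

/-- On the span of `τ_i` a real supporting functional is a multiple of the rational `i`-th
coordinate, which thereby inherits its sign and zeros. -/
lemma map_emb_eq {i : Fin (C.r + 1)} {l : ℝ × (Fin n → ℝ) →ₗ[ℝ] ℝ}
    (hl : Supports P (prevFace C i) l) {w : HatM n} (hw : emb w ∈ hatSpan (C.face i).1) :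
    l (emb w) = chainCoord S C hP hfull w i * l (chainVec S C i) := by
  rw [emb_eq_sum S C hP hfull, map_sum, Finset.sum_eq_single i]
  · rw [map_smul, smul_eq_mul]
  · intro j _ hj
    rw [map_smul, smul_eq_mul]
    rcases lt_or_gt_of_ne hj with h | h
    · rw [chain_supports_eq_zero S h hl, mul_zero]
    · rw [chainCoord_eq_zero S C hP hfull hw h, Rat.cast_zero, zero_mul]
  · simp

lemma sub_smul_mem_hatSpan {i : Fin (C.r + 1)} {w : HatM n}
    (hw : emb w ∈ hatSpan (C.face i).1) :
    emb w - (chainCoord S C hP hfull w i : ℝ) • chainVec S C i ∈ hatSpan (prevFace C i) := by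
  rw [emb_eq_sum S C hP hfull, ← Finset.add_sum_erase _ _ (Finset.mem_univ i), add_sub_cancel_left]
  refine sum_mem fun j hj => ?_
  rcases lt_or_gt_of_ne (Finset.ne_of_mem_erase hj) with h | h
  · exact Submodule.smul_mem _ _ (hatSpan_mono (subset_prevFace C h)
      (chainVec_inCone S C j).mem_hatSpan)
  · rw [chainCoord_eq_zero S C hP hfull hw h, Rat.cast_zero, zero_smul]
    exact zero_mem _

lemma neg_weight_mem_semi (hnormal : IsNormalPolytope P) (i : Fin (C.r + 1)) :
    -S.μ (C.face i) ∈ semi P (C.face i).1 :=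
  mem_semi_of_inCone hnormal (C.face i).2.2 (chainVec_inCone S C i)

include S hP in
-- For `i > 0` take `u = -μ_{τ_{i-1}}`, which is interior to the cone over `τ_{i-1}`. For `i = 0`
-- the previous span is zero and `u = 0` suffices.
lemma exists_shift_prevFace (hnormal : IsNormalPolytope P) (i : Fin (C.r + 1)) :
    ∃ u ∈ semi P (prevFace C i), ∀ v ∈ hatSpan (prevFace C i), ∃ N : ℕ,
      InCone (C.face i).1 (v + N • emb u) := by
  induction i using Fin.cases with
  | zero =>
    refine ⟨0, zero_mem _, fun v hv => ⟨0, ?_⟩⟩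
    have hv0 : v = 0 := by simpa [hatSpan, prevFace] using hv
    obtain ⟨x, hx⟩ := (C.face 0).2.1
    exact inCone_iff.2 ⟨0, le_rfl, x, hx, by simp [hv0]⟩
  | succ j =>
    refine ⟨-S.μ (C.face j.castSucc), neg_weight_mem_semi S C hnormal _, fun v hv => ?_⟩
    obtain ⟨D, hD, x, hx, h⟩ := chainVec_eq S C j.castSucc
    obtain ⟨N, hN, hcone⟩ := exists_inCone_add_smul
      ((C.face j.castSucc).2.2.convex hP.convex) hx hv
    obtain ⟨M, hM⟩ := exists_nat_ge N
    refine ⟨M, ?_⟩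
    have h1 := hcone (M * D) (hM.trans (le_mul_of_one_le_right (Nat.cast_nonneg _) hD))
    have h2 : emb (-S.μ (C.face j.castSucc)) = D • ((1 : ℝ), x) := h
    rw [h2, ← Nat.cast_smul_eq_nsmul ℝ, smul_smul]
    exact h1.mono (chain_mono C Fin.castSucc_lt_succ.le)

theorem isChainCoord (hnormal : IsNormalPolytope P) :
    IsChainCoord S C (chainCoord S C hP hfull) where
  inj := chainCoord_injective S C hP hfull
  neg_weight := chainCoord_neg_weight S C hP hfull
  mem_semi := neg_weight_mem_semi S C hnormal
  eq_zero i w hw j hij := chainCoord_eq_zero S C hP hfull (emb_mem_hatSpan hw) hij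
  step i := by
    obtain ⟨l, hl⟩ := exists_supports (prevFace_exposed C i)
    have hpos := chain_supports_pos S hP.convex hl
    have hsub := (C.face i).2.2.subset
    have hemb : ∀ χ : LatticePts P, emb ((1, χ.1) : HatM n) = (1, toReal χ.1) := fun χ => by
      simp [emb]
    have hco : ∀ χ : LatticePts P, toReal χ.1 ∈ (C.face i).1 → l (1, toReal χ.1) =
        chainCoord S C hP hfull (1, χ.1) i * l (chainVec S C i) := by
      intro χ hχ
      rw [← hemb]
      exact map_emb_eq S C hP hfull hl (emb_mem_hatSpan (mem_semi_of_mem χ hχ))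
    obtain ⟨u, hu, hshift⟩ := exists_shift_prevFace S C hP hnormal i
    have hzero : ∀ χ : LatticePts P, toReal χ.1 ∈ (C.face i).1 →
        (chainCoord S C hP hfull (1, χ.1) i = 0 ↔ toReal χ.1 ∈ prevFace C i) := by
      intro χ hχ
      rw [← hl.eq_zero_iff _ χ.2, hco χ hχ, mul_eq_zero, or_iff_left hpos.ne', Rat.cast_eq_zero]
    refine ⟨u, (prevFace_ssubset C i).1, ?_, hzero, semi_mono (prevFace_ssubset C i).1 hu, ?_, ?_⟩
    · intro χ hχ
      have h := hl.nonneg _ χ.2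
      rw [hco χ hχ] at h
      exact_mod_cast nonneg_of_mul_nonneg_left h hpos
    · refine eq_zero_of_mem_semi (fun χ hχ => ?_) hu
      exact (hzero χ ((prevFace_ssubset C i).1 hχ)).2 hχ
    · intro w hw w0 hw0 hle
      have hmem : emb (w - w0) ∈ hatSpan (C.face i).1 := by
        rw [map_sub]
        exact sub_mem (emb_mem_hatSpan hw) (emb_mem_hatSpan hw0)
      -- Split `w - w0` into a nonnegative multiple of `-μ_{τ_i}` and a vector in the span of the
      -- previous face; `N • u` moves the latter into the cone.
      obtain ⟨N, hN⟩ := hshift _ (sub_smul_mem_hatSpan S C hP hfull hmem)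
      refine ⟨N, mem_semi_of_inCone hnormal (C.face i).2.2 ?_⟩
      have hc : (0 : ℝ) ≤ chainCoord S C hP hfull (w - w0) i := by
        have : 0 ≤ chainCoord S C hP hfull (w - w0) i := by
          rw [map_sub, Pi.sub_apply, sub_nonneg]
          exact hle
        exact_mod_cast this
      have := hN.add ((C.face i).2.2.convex hP.convex) ((chainVec_inCone S C i).smul hc)
      rw [map_add, map_nsmul]
      convert this using 1
      abel

end ChainBasis

/-! ### Comparison along a chain -/

variable [CharZero K] (S : CombSeshadri K P) (C : MaxChain (Face P))
  (hP : IsLatticePolytope P) (hfull : (interior P).Nonempty) (hnormal : IsNormalPolytope P)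

include hnormal in
-- The single exponent of `f_{τ_i}` lies in the cone over `τ_i`, so restriction leaves the monomial
-- unchanged.
lemma lau_restr_extremal (i : Fin (C.r + 1)) : ∃ c : K, c ≠ 0 ∧
    lau P (C.face i).1 (restr (hatIdeal_le (C.face i).2.2 (C.face i).2.2.subset)
      (S.f (C.face i))) = AddMonoidAlgebra.single (-S.μ (C.face i)) c := by
  classical
  obtain ⟨c, hc, h⟩ := (S.eigen (C.face i)).exists_lau_eq
  refine ⟨c, hc, AddMonoidAlgebra.coeff_injective (Finsupp.ext fun w => ?_)⟩
  obtain ⟨l, hl⟩ := exists_supports (C.face i).2.2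
  have hemb : ∀ χ : LatticePts P, emb ((1, χ.1) : HatM n) = (1, toReal χ.1) := fun χ => by
    simp [emb]
  rw [lau_restr_coeff (l := (l : ℝ × (Fin n → ℝ) →+ ℝ).comp emb) (C.face i).2.2.subset
    (fun χ _ => by simpa [hemb] using hl.nonneg _ χ.2)
    (fun χ _ => by simpa [hemb] using hl.eq_zero_iff _ χ.2), h]
  split_ifs with hw
  · rfl
  · rw [AddMonoidAlgebra.coeff_single, Finsupp.single_apply, if_neg]
    rintro rfl
    refine hw ?_
    exact eq_zero_of_mem_hatSpan
      (fun x hx => (hl.eq_zero_iff x ((C.face i).2.2.subset hx)).2 hx)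
      (chainVec_inCone S C i).mem_hatSpan

include hnormal in
theorem cflChain_eq_lead {g : CoordRing K P P} (hg : g ≠ 0) :
    S.cflChain C (algebraMap _ (FractionRing (CoordRing K P P)) g) =
      chainCoord S C hP hfull (lead ((revLex C.r).comp (chainCoord S C hP hfull)) g) := by
  have := finite_latticePts hP
  exact (isChainCoord S C hP hfull hnormal).cflChain_eq (lau_restr_extremal S C hnormal) hg
    (last_eq C hP)

theorem nuChain_eq_lead {g : CoordRing K P P} (hg : g ≠ 0) :
    S.nuChain C g =
      chainCoord S C hP hfull (lead ((revLex C.r).comp (chainCoord S C hP hfull)) g) :=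
  nuChain_eq (toRat_eq_sum_iff S C hP hfull) hg

end

end Toric

/-! ### Gradings of associated graded algebras -/

section General

variable {k Q : Type*} [Field k] [Ring Q] [Algebra k Q]

lemma isInternal_of_sum_eq_zero {D : ℕ → Submodule k Q}
    (hindep : ∀ (s : Finset ℕ) (y : ℕ → Q), (∀ m, y m ∈ D m) → ∑ m ∈ s, y m = 0 →
      ∀ m ∈ s, y m = 0) (htop : ∀ x, x ∈ ⨆ m, D m) : DirectSum.IsInternal D := by
  classical
  constructor
  · rw [injective_iff_map_eq_zero]
    intro d hd
    rw [DirectSum.coeAddMonoidHom_eq_dfinsuppSum, DFinsupp.sum] at hd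
    ext m
    rw [DirectSum.zero_apply, ZeroMemClass.coe_zero]
    by_cases hm : m ∈ DFinsupp.support d
    · exact hindep _ (fun m => (d m : Q)) (fun m => (d m).2) hd m hm
    · rw [DFinsupp.notMem_support_iff.1 hm, ZeroMemClass.coe_zero]
  · have hrange : (DirectSum.coeLinearMap D).range = ⊤ := by
      rw [DirectSum.range_coeLinearMap, eq_top_iff]
      exact fun x _ => htop x
    exact LinearMap.range_eq_top.1 hrange

/-- The graded algebra structure given by independent subspaces that span. -/
@[reducible]
noncomputable def gradedAlgebraOfSumEqZero {D : ℕ → Submodule k Q} (hD : SetLike.GradedMonoid D)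
    (hindep : ∀ (s : Finset ℕ) (y : ℕ → Q), (∀ m, y m ∈ D m) → ∑ m ∈ s, y m = 0 →
      ∀ m ∈ s, y m = 0) (htop : ∀ x, x ∈ ⨆ m, D m) : GradedAlgebra D :=
  { hD, (isInternal_of_sum_eq_zero hindep htop).chooseDecomposition with }

lemma mul_mem_span_of_mul_mem {s t u : Set Q} (h : ∀ x ∈ s, ∀ y ∈ t, x * y ∈ u) {x y : Q}
    (hx : x ∈ Submodule.span k s) (hy : y ∈ Submodule.span k t) :
    x * y ∈ Submodule.span k u := by
  have h1 := Submodule.mul_mem_mul hx hy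
  rw [Submodule.span_mul_span] at h1
  refine Submodule.span_mono ?_ h1
  rintro _ ⟨x, hx, y, hy, rfl⟩
  exact h x hx y hy

end General

noncomputable section Graded

variable {k R ι : Type*} [Field k] [CommRing R] [Algebra k R]

/-- A multiplicative filtration of `R` by `F a`, with the subspaces `G a` of elements of higher
value. -/
structure IsMulFiltration (F G : (ι → ℚ) → Submodule k R) : Prop where
  one_mem : 1 ∈ F 0
  mul_mem : ∀ {a b x y}, x ∈ F a → y ∈ F b → x * y ∈ F (a + b)
  mul_mem_gt : ∀ {a b x y}, x ∈ F a → y ∈ G b → x * y ∈ G (a + b)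
  le : ∀ a, G a ≤ F a

variable {lt : ι → ι → Prop} {v : R → ι → ℚ} {F G : (ι → ℚ) → Submodule k R}
  (hFG : IsMulFiltration F G) (hF : ∀ a, filtGE lt v a = F a) (hG : ∀ a, filtGT lt v a = G a)
include hFG hF

lemma coeff_mul_mem {F G H : (ι → ℚ) → Submodule k R}
    (h : ∀ {a b x y}, x ∈ F a → y ∈ G b → x * y ∈ H (a + b))
    {x y : AddMonoidAlgebra R (ι → ℚ)} (hx : ∀ a, x.coeff a ∈ F a) (hy : ∀ a, y.coeff a ∈ G a)
    (a : ι → ℚ) : (x * y).coeff a ∈ H a := by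
  classical
  rw [AddMonoidAlgebra.coeff_mul]
  refine sum_mem fun b _ => sum_mem fun c _ => ?_
  dsimp only
  split_ifs with hbc
  · rw [← hbc]
    exact h (hx b) (hy c)
  · exact zero_mem _

lemma coeff_single_mem {H : (ι → ℚ) → Submodule k R} {a : ι → ℚ} {h : R} (hh : h ∈ H a)
    (b : ι → ℚ) : (AddMonoidAlgebra.single a h).coeff b ∈ H b := by
  classical
  rw [AddMonoidAlgebra.coeff_single, Finsupp.single_apply]
  split_ifs with hab
  · exact hab ▸ hh
  · exact zero_mem _

lemma single_mem_Rees {a : ι → ℚ} {h : R} (hh : h ∈ F a) :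
    AddMonoidAlgebra.single a h ∈ Rees k lt v :=
  Algebra.subset_adjoin ⟨a, h, by rw [hF]; exact hh, rfl⟩

/-- Multiplicativity of the filtration makes the direct sum of the `F a` already a subalgebra, so
adjoining creates nothing new. -/
lemma mem_Rees_iff {x : AddMonoidAlgebra R (ι → ℚ)} :
    x ∈ Rees k lt v ↔ ∀ a, x.coeff a ∈ F a := by
  constructor
  · intro hx
    induction hx using Algebra.adjoin_induction with
    | mem x hx =>
      obtain ⟨a, h, hh, rfl⟩ := hx
      rw [hF] at hh
      exact coeff_single_mem hFG hF hh
    | algebraMap c =>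
      rw [AddMonoidAlgebra.coe_algebraMap, Function.comp_apply, Algebra.algebraMap_eq_smul_one]
      exact coeff_single_mem hFG hF (Submodule.smul_mem _ _ hFG.one_mem)
    | add x y _ _ hx hy =>
      intro a
      rw [AddMonoidAlgebra.coeff_add, Finsupp.add_apply]
      exact add_mem (hx a) (hy a)
    | mul x y _ _ hx hy => exact coeff_mul_mem hFG hF hFG.mul_mem hx hy
  · intro hx
    rw [← AddMonoidAlgebra.sum_coeff_single x]
    exact sum_mem fun a _ => single_mem_Rees hFG hF (hx a)

include hG

lemma mem_reesIdeal_iff {x : Rees k lt v} :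
    x ∈ reesIdeal k lt v ↔ ∀ a, (x : AddMonoidAlgebra R (ι → ℚ)).coeff a ∈ G a := by
  constructor
  · intro hx
    induction hx using Submodule.span_induction with
    | mem x hx =>
      obtain ⟨a, h, hh, hx⟩ := hx
      rw [hG] at hh
      rw [hx]
      exact coeff_single_mem hFG hF hh
    | zero => simp
    | add x y _ _ hx hy =>
      intro a
      rw [Subalgebra.coe_add, AddMonoidAlgebra.coeff_add, Finsupp.add_apply]
      exact add_mem (hx a) (hy a)
    | smul r x _ hx =>
      rw [smul_eq_mul, Subalgebra.coe_mul]
      exact coeff_mul_mem hFG hF hFG.mul_mem_gt ((mem_Rees_iff hFG hF).1 r.2) hx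
  · intro hx
    have hmem := fun a => single_mem_Rees hFG hF (hFG.le a (hx a))
    have hsum : x = ∑ a ∈ (x : AddMonoidAlgebra R (ι → ℚ)).coeff.support,
        (⟨AddMonoidAlgebra.single a ((x : AddMonoidAlgebra R (ι → ℚ)).coeff a), hmem a⟩ :
          Rees k lt v) := by
      apply Subtype.ext
      rw [AddSubmonoidClass.coe_finsetSum]
      exact (AddMonoidAlgebra.sum_coeff_single _).symm
    rw [hsum]
    exact sum_mem fun a _ => Ideal.subset_span ⟨a, _, by rw [hG]; exact hx a, rfl⟩

variable {𝒜 : ℕ → Submodule k R}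

omit hG in
lemma exists_lift_of_mem_grDegree {m : ℕ} {y : Gr k lt v} (hy : y ∈ grDegree lt v 𝒜 m) :
    ∃ x : Rees k lt v, y = Ideal.Quotient.mk _ x ∧
      ∀ a, (x : AddMonoidAlgebra R (ι → ℚ)).coeff a ∈ 𝒜 m := by
  induction hy using Submodule.span_induction with
  | mem y hy =>
    obtain ⟨a, h, hh, x, hx, rfl⟩ := hy
    refine ⟨x, rfl, ?_⟩
    rw [hx]
    exact coeff_single_mem (H := fun _ => 𝒜 m) hFG hF hh
  | zero => exact ⟨0, by simp, by simp⟩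
  | add y z _ _ hy hz =>
    obtain ⟨x, rfl, hx⟩ := hy
    obtain ⟨x', rfl, hx'⟩ := hz
    refine ⟨x + x', by simp, fun a => ?_⟩
    rw [Subalgebra.coe_add, AddMonoidAlgebra.coeff_add, Finsupp.add_apply]
    exact add_mem (hx a) (hx' a)
  | smul c y _ hy =>
    obtain ⟨x, rfl, hx⟩ := hy
    refine ⟨c • x, rfl, fun a => ?_⟩
    rw [Subalgebra.coe_smul, AddMonoidAlgebra.coeff_smul, Finsupp.smul_apply]
    exact Submodule.smul_mem _ _ (hx a)

omit hFG hF hG in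
lemma grDegree_gradedMonoid (h1 : 1 ∈ 𝒜 0)
    (hmul : ∀ {m l x y}, x ∈ 𝒜 m → y ∈ 𝒜 l → x * y ∈ 𝒜 (m + l)) :
    SetLike.GradedMonoid (grDegree lt v 𝒜) where
  one_mem := Submodule.subset_span ⟨0, 1, h1, 1, by
    rw [Subalgebra.coe_one, AddMonoidAlgebra.one_def], by simp⟩
  mul_mem := by
    intro m l y z hy hz
    refine mul_mem_span_of_mul_mem (k := k) (Q := Gr k lt v) ?_ hy hz
    rintro _ ⟨a, h, hh, x, hx, rfl⟩ _ ⟨b, h', hh', x', hx', rfl⟩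
    refine ⟨a + b, h * h', hmul hh hh', x * x', ?_, by simp⟩
    rw [Subalgebra.coe_mul, hx, hx', AddMonoidAlgebra.single_mul_single]

/-- Lift each `y m` to a Rees element with coefficients in `𝒜 m`. Membership in the ideal is
coefficientwise, which reduces independence to `hindep` in `R`. -/
lemma eq_zero_of_sum_mem_grDegree_eq_zero
    (hindep : ∀ a (s : Finset ℕ) (y : ℕ → R), (∀ m, y m ∈ 𝒜 m) → ∑ m ∈ s, y m ∈ G a →
      ∀ m ∈ s, y m ∈ G a) (s : Finset ℕ) (y : ℕ → Gr k lt v)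
    (hy : ∀ m, y m ∈ grDegree lt v 𝒜 m) (hsum : ∑ m ∈ s, y m = 0) : ∀ m ∈ s, y m = 0 := by
  choose x hx hxA using fun m => exists_lift_of_mem_grDegree hFG hF (hy m)
  rw [Finset.sum_congr rfl (fun m _ => hx m), ← map_sum, Ideal.Quotient.eq_zero_iff_mem,
    mem_reesIdeal_iff hFG hF hG] at hsum
  intro m hm
  rw [hx m, Ideal.Quotient.eq_zero_iff_mem, mem_reesIdeal_iff hFG hF hG]
  intro a
  refine hindep a s (fun m => (x m : AddMonoidAlgebra R (ι → ℚ)).coeff a)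
    (fun m => hxA m a) ?_ m hm
  have := hsum a
  rwa [AddSubmonoidClass.coe_finsetSum, AddMonoidAlgebra.coeff_sum, Finset.sum_apply'] at this

omit hG in
lemma mem_iSup_grDegree
    (hdecomp : ∀ a, ∀ x ∈ F a, ∃ (s : Finset ℕ) (y : ℕ → R),
      (∀ m, y m ∈ 𝒜 m ∧ y m ∈ F a) ∧ x = ∑ m ∈ s, y m) (z : Gr k lt v) :
    z ∈ ⨆ m, grDegree lt v 𝒜 m := by
  obtain ⟨x, rfl⟩ := Ideal.Quotient.mk_surjective z
  have hx := (mem_Rees_iff hFG hF).1 x.2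
  choose s y hy hsum using fun a => hdecomp a _ (hx a)
  have hmem := fun a m => single_mem_Rees hFG hF (hy a m).2
  have hxs : x = ∑ a ∈ (x : AddMonoidAlgebra R (ι → ℚ)).coeff.support, ∑ m ∈ s a,
      (⟨AddMonoidAlgebra.single a (y a m), hmem a m⟩ : Rees k lt v) := by
    apply Subtype.ext
    rw [AddSubmonoidClass.coe_finsetSum]
    conv_lhs => rw [← AddMonoidAlgebra.sum_coeff_single (x : AddMonoidAlgebra R (ι → ℚ))]
    refine Finset.sum_congr rfl fun a _ => ?_
    rw [AddSubmonoidClass.coe_finsetSum]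
    conv_lhs => rw [hsum a]
    exact map_sum (AddMonoidAlgebra.singleAddHom a) _ _
  rw [hxs, map_sum]
  refine sum_mem fun a _ => ?_
  rw [map_sum]
  exact sum_mem fun m _ => Submodule.mem_iSup_of_mem m
    (Submodule.subset_span ⟨a, _, (hy a m).1, _, rfl, rfl⟩)


/-- The associated graded algebra is graded by the degree of functions. -/
@[reducible]
def grDegreeGradedAlgebra (h1 : 1 ∈ 𝒜 0)
    (hmul : ∀ {m l x y}, x ∈ 𝒜 m → y ∈ 𝒜 l → x * y ∈ 𝒜 (m + l))
    (hdecomp : ∀ a, ∀ x ∈ F a, ∃ (s : Finset ℕ) (y : ℕ → R),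
      (∀ m, y m ∈ 𝒜 m ∧ y m ∈ F a) ∧ x = ∑ m ∈ s, y m)
    (hindep : ∀ a (s : Finset ℕ) (y : ℕ → R), (∀ m, y m ∈ 𝒜 m) → ∑ m ∈ s, y m ∈ G a →
      ∀ m ∈ s, y m ∈ G a) : GradedAlgebra (grDegree lt v 𝒜) :=
  gradedAlgebraOfSumEqZero (grDegree_gradedMonoid h1 hmul)
    (eq_zero_of_sum_mem_grDegree_eq_zero hFG hF hG hindep) (mem_iSup_grDegree hFG hF hdecomp)

end Graded

/-! ### The degeneration depends on the filtration only -/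

noncomputable section Transport

variable {k R ι : Type*} [Field k] [CommRing R] [Algebra k R]

lemma filt_congr {lt : ι → ι → Prop} {v v' : R → ι → ℚ} (h : ∀ x, x ≠ 0 → v x = v' x) :
    filtGE lt v = filtGE lt v' ∧ filtGT lt v = filtGT lt v' := by
  constructor <;> funext a <;> ext x
  · exact forall_congr' fun hx => by rw [h x hx]
  · exact forall_congr' fun hx => by rw [h x hx]

variable (k) in
/-- The Rees algebra of a filtration by the sets `F a`. -/
def ReesOf (F : (ι → ℚ) → Set R) : Subalgebra k (AddMonoidAlgebra R (ι → ℚ)) :=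
  Algebra.adjoin k {x | ∃ a, ∃ h ∈ F a, x = AddMonoidAlgebra.single a h}

variable (k) in
/-- The ideal of the Rees algebra generated by the elements of higher value. -/
def reesIdealOf (F G : (ι → ℚ) → Set R) : Ideal (ReesOf k F) :=
  Ideal.span {x | ∃ a, ∃ h ∈ G a,
    (x : AddMonoidAlgebra R (ι → ℚ)) = AddMonoidAlgebra.single a h}

variable (k) in
/-- The associated graded algebra of a filtration. -/
abbrev GrOf (F G : (ι → ℚ) → Set R) : Type _ := ReesOf k F ⧸ reesIdealOf k F G

variable (k) in
/-- The leaves of the associated graded algebra of a filtration. -/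
def grLeafOf (F G : (ι → ℚ) → Set R) (a : ι → ℚ) : Submodule k (GrOf k F G) :=
  Submodule.span k {y | ∃ h, ∃ x : ReesOf k F,
    (x : AddMonoidAlgebra R (ι → ℚ)) = AddMonoidAlgebra.single a h ∧
      y = Ideal.Quotient.mk (reesIdealOf k F G) x}

/-- The components of the associated graded algebra of a filtration for a grading of `R`. -/
def grDegreeOf (F G : (ι → ℚ) → Set R) (𝒜 : ℕ → Submodule k R) (m : ℕ) :
    Submodule k (GrOf k F G) :=
  Submodule.span k {y | ∃ a, ∃ h ∈ 𝒜 m, ∃ x : ReesOf k F,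
    (x : AddMonoidAlgebra R (ι → ℚ)) = AddMonoidAlgebra.single a h ∧
      y = Ideal.Quotient.mk (reesIdealOf k F G) x}

/-- The two valuations are only known to agree away from zero and cannot be substituted for each
other; their filtrations can. -/
lemma exists_grOf_equiv {F F' G G' : (ι → ℚ) → Set R} (hF : F = F') (hG : G = G')
    (𝒜 : ℕ → Submodule k R) :
    ∃ e : GrOf k F G ≃ₐ[k] GrOf k F' G',
      (∀ (x : ReesOf k F) (y : ReesOf k F'),
        (x : AddMonoidAlgebra R (ι → ℚ)) = y →
        e (Ideal.Quotient.mk _ x) = Ideal.Quotient.mk _ y) ∧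
      (∀ a, (grLeafOf k F G a).map e.toLinearMap = grLeafOf k F' G' a) ∧
      (∀ m, (grDegreeOf F G 𝒜 m).map e.toLinearMap = grDegreeOf F' G' 𝒜 m) := by
  subst hF hG
  refine ⟨AlgEquiv.refl, fun x y h => ?_, fun a => Submodule.map_id _, fun m => Submodule.map_id _⟩
  rw [Subtype.ext h]
  rfl

set_option maxHeartbeats 2000000 in
lemma exists_proj_iso {F F' G G' : (ι → ℚ) → Set R} (hF : F = F') (hG : G = G')
    (𝒜 : ℕ → Submodule k R) (h : Nonempty (GradedAlgebra (grDegreeOf F' G' 𝒜))) :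
    ∃ (_ : GradedAlgebra (grDegreeOf F G 𝒜)) (_ : GradedAlgebra (grDegreeOf F' G' 𝒜)),
      Nonempty (AlgebraicGeometry.Proj (grDegreeOf F G 𝒜) ≅
        AlgebraicGeometry.Proj (grDegreeOf F' G' 𝒜)) := by
  subst hF hG
  obtain ⟨h⟩ := h
  exact ⟨h, h, ⟨CategoryTheory.Iso.refl _⟩⟩

variable {lt : ι → ι → Prop} {v v' : R → ι → ℚ} (h : ∀ x, x ≠ 0 → v x = v' x)
include h

lemma Rees_congr : Rees k lt v = Rees k lt v' :=
  congrArg (ReesOf k) (filt_congr h).1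

theorem exists_gr_equiv (𝒜 : ℕ → Submodule k R) :
    ∃ e : Gr k lt v ≃ₐ[k] Gr k lt v',
      (∀ (x : Rees k lt v) (y : Rees k lt v'),
        (x : AddMonoidAlgebra R (ι → ℚ)) = y →
        e (Ideal.Quotient.mk _ x) = Ideal.Quotient.mk _ y) ∧
      (∀ a, (grLeaf k lt v a).map e.toLinearMap = grLeaf k lt v' a) ∧
      (∀ m, (grDegree lt v 𝒜 m).map e.toLinearMap = grDegree lt v' 𝒜 m) :=
  exists_grOf_equiv (filt_congr h).1 (filt_congr h).2 𝒜

set_option maxHeartbeats 2000000 in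
theorem exists_gr_proj_iso (𝒜 : ℕ → Submodule k R)
    (hgr : Nonempty (GradedAlgebra (grDegree lt v' 𝒜))) :
    ∃ (_ : GradedAlgebra (grDegree lt v 𝒜)) (_ : GradedAlgebra (grDegree lt v' 𝒜)),
      Nonempty (AlgebraicGeometry.Proj (grDegree lt v 𝒜) ≅
        AlgebraicGeometry.Proj (grDegree lt v' 𝒜)) :=
  exists_proj_iso (filt_congr h).1 (filt_congr h).2 𝒜 hgr

end Transport

/-! ### The lexicographic order as an ordered group -/

universe u

lemma exists_lexHom {ι : Type u} [Finite ι] {lt : ι → ι → Prop} (hlt : IsStrictTotalOrder ι lt) :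
    ∃ (Γ : Type u) (_ : AddCommGroup Γ) (_ : LinearOrder Γ) (_ : IsOrderedAddMonoid Γ)
      (φ : (ι → ℚ) →+ Γ), Function.Injective φ ∧ ∀ a b, φ a < φ b ↔ lexLT lt a b := by
  classical
  -- The order is reversed because `Lex` compares the smallest index first and `lexLT` the largest.
  let : LinearOrder ι := linearOrderOfSTO (Function.swap lt)
  exact ⟨Lex (ι → ℚ), inferInstance, inferInstance, inferInstance,
    ⟨⟨toLex, rfl⟩, fun _ _ => rfl⟩, toLex.injective, fun a b => Iff.rfl⟩

lemma nonempty_maxChain (α : Type*) [PartialOrder α] [Finite α] [Nonempty α] :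
    Nonempty (MaxChain α) := by
  obtain ⟨a, h0, r, hr, h⟩ := exists_covBy_seq_of_wellFoundedLT_wellFoundedGT α
  exact ⟨⟨r, fun i => a i, h0, fun i => h i i.2, hr⟩⟩

/-! ### The inclusion `ℚ^C ⊆ ℚ^A` and its compatibility with the orders -/

namespace MaxChain

variable {α : Type*} [PartialOrder α] (C : MaxChain α)

lemma face_strictMono : StrictMono C.face :=
  Fin.strictMono_iff_lt_succ.2 fun i => (C.covBy i).lt

lemma incl_face (a : Fin (C.r + 1) → ℚ) (i : Fin (C.r + 1)) : C.incl a (C.face i) = a i := by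
  classical
  rw [incl, Finset.sum_eq_single i]
  · simp
  · intro j _ hj
    exact if_neg fun h => hj (C.face_strictMono.injective h)
  · simp

lemma incl_eq_zero (a : Fin (C.r + 1) → ℚ) {σ : α} (h : ∀ i, C.face i ≠ σ) : C.incl a σ = 0 := by
  classical
  exact Finset.sum_eq_zero fun i _ => if_neg (h i)

/-- The inclusion `ℚ^C ⊆ ℚ^A` as a homomorphism. -/
noncomputable def inclHom : (Fin (C.r + 1) → ℚ) →+ (α → ℚ) where
  toFun := C.incl
  map_zero' := by
    funext σ
    simp [incl]
  map_add' a b := by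
    classical
    funext σ
    simp only [incl, Pi.add_apply, ← Finset.sum_add_distrib]
    exact Finset.sum_congr rfl fun i _ => by split_ifs <;> simp

/-- Entries off the chain are zero on both sides, and along the chain the linearization agrees with
the order of the indices. -/
lemma incl_lexLT {lt : α → α → Prop} (hlt : IsStrictTotalOrder α lt)
    (hext : ∀ σ τ : α, σ < τ → lt σ τ) {a b : Fin (C.r + 1) → ℚ} (h : lexLT (· < ·) a b) :
    lexLT lt (C.incl a) (C.incl b) := by
  obtain ⟨i, hi, hlt'⟩ := h
  refine ⟨C.face i, fun σ hσ => ?_, by rwa [incl_face, incl_face]⟩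
  by_cases hex : ∃ j, C.face j = σ
  · obtain ⟨j, rfl⟩ := hex
    rw [incl_face, incl_face]
    refine hi j ?_
    rcases lt_trichotomy i j with h | rfl | h
    · exact h
    · exact absurd hσ (irrefl_of lt _)
    · exact absurd hσ (asymm_of lt (hext _ _ (C.face_strictMono h)))
  · push Not at hex
    rw [incl_eq_zero C a hex, incl_eq_zero C b hex]

end MaxChain

namespace Toric

noncomputable section

variable {n : ℕ} {K : Type*} [Field K] {P : Set (Fin n → ℝ)}

lemma finite_maxChain (S : CombSeshadri K P) (hP : IsLatticePolytope P)
    (hfull : (interior P).Nonempty) : Finite (MaxChain (Face P)) := by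
  have := finite_face hP
  have hr := fun C => chain_length S C hP hfull
  refine Finite.of_injective (fun C : MaxChain (Face P) => fun i : Fin (n + 1) =>
    C.face (Fin.cast (by rw [hr C]) i)) fun C D h => ?_
  obtain ⟨r, f, h1, h2, h3⟩ := C
  obtain ⟨s, g, h4, h5, h6⟩ := D
  obtain rfl : r = n := hr ⟨r, f, h1, h2, h3⟩
  obtain rfl : s = r := hr ⟨s, g, h4, h5, h6⟩
  obtain rfl : f = g := h
  rfl

lemma nonempty_face (hP : IsLatticePolytope P) : Nonempty (Face P) := by
  obtain ⟨E, hE, rfl⟩ := hP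
  exact ⟨⟨_, (hE.to_set.image _).convexHull, IsExposed.refl _⟩⟩

/-! ### Homogeneous components -/

section Homogeneous

variable [CharZero K]

lemma exists_homogeneous_lau_eq_single {w : HatM n} (hw : w ∈ semi P P) :
    ∃ (m : ℕ) (a : CoordRing K P P), w.1 = m ∧ a ∈ homogeneousPart K P m ∧
      lau P P a = AddMonoidAlgebra.single w 1 := by
  classical
  suffices h : ∃ (m : ℕ) (F : MvPolynomial (LatticePts P) K), w.1 = m ∧ F.IsHomogeneous m ∧
      laurentMap K P P F = AddMonoidAlgebra.single w 1 by
    obtain ⟨m, F, hm, hF, h⟩ := h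
    exact ⟨m, Ideal.Quotient.mk _ F, hm, ⟨F, hF, rfl⟩, h⟩
  induction hw using AddSubmonoid.closure_induction with
  | mem w h =>
    obtain ⟨χ, hχ, rfl⟩ := h
    exact ⟨1, MvPolynomial.X χ, rfl, MvPolynomial.isHomogeneous_X _ _, by simp [laurentMap, hχ]⟩
  | zero =>
    exact ⟨0, 1, rfl, MvPolynomial.isHomogeneous_one _ _, by
      rw [map_one, AddMonoidAlgebra.one_def]⟩
  | add v w _ _ hv hw =>
    obtain ⟨m, F, hm, hF, h⟩ := hv
    obtain ⟨l, G, hl, hG, h'⟩ := hw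
    refine ⟨m + l, F * G, by rw [Prod.fst_add, hm, hl, Nat.cast_add], hF.mul hG, ?_⟩
    rw [map_mul, h, h', AddMonoidAlgebra.single_mul_single, one_mul]

/-- All generators have height one, so the degree of a monomial is the first coordinate of its
exponent. -/
lemma mem_homogeneousPart_iff {m : ℕ} {a : CoordRing K P P} :
    a ∈ homogeneousPart K P m ↔ ∀ w, (lau P P a).coeff w ≠ 0 → w.1 = m := by
  classical
  constructor
  · rintro ⟨F, hF, rfl⟩ w hw
    have hF' : F.IsHomogeneous m := hF
    change (laurentMap K P P F).coeff w ≠ 0 at hw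
    rw [F.as_sum, map_sum, AddMonoidAlgebra.coeff_sum, Finset.sum_apply'] at hw
    obtain ⟨d, hd, hne⟩ := Finset.exists_ne_zero_of_sum_ne_zero hw
    rw [laurentMap_monomial] at hne
    split_ifs at hne with h
    · rw [AddMonoidAlgebra.coeff_single, Finsupp.single_apply] at hne
      split_ifs at hne with hw'
      · rw [← hw', Prod.fst_sum]
        have := hF'.degree_eq_sum_deg_support hd
        simp only [nsmul_eq_mul]
        rw [this]
        simp
      · exact absurd rfl hne
    · simp at hne
  · intro h
    have key : ∀ w, (lau P P a).coeff w ≠ 0 → ∃ b ∈ homogeneousPart K P m,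
        lau P P b = AddMonoidAlgebra.single w 1 := by
      intro w hw
      obtain ⟨l, b, hl, hb, hb'⟩ := exists_homogeneous_lau_eq_single (K := K) (mem_semi_of_lau hw)
      obtain rfl : l = m := by
        have := h w hw
        rw [hl] at this
        exact_mod_cast this
      exact ⟨b, hb, hb'⟩
    choose! b hb hb' using key
    have : a = ∑ w ∈ (lau P P a).coeff.support, (lau P P a).coeff w • b w := by
      apply lau_injective
      conv_lhs => rw [← AddMonoidAlgebra.sum_coeff_single (lau P P a)]
      rw [map_sum]
      refine Finset.sum_congr rfl fun w hw => ?_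
      rw [map_smul, hb' w (Finsupp.mem_support_iff.1 hw), AddMonoidAlgebra.smul_single, smul_eq_mul,
        mul_one]
    rw [this]
    exact sum_mem fun w hw => Submodule.smul_mem _ _ (hb w (Finsupp.mem_support_iff.1 hw))

lemma exists_homogeneous_component (a : CoordRing K P P) (m : ℕ) :
    ∃ b : CoordRing K P P, ∀ w, (lau P P b).coeff w =
      if w.1 = (m : ℤ) then (lau P P a).coeff w else 0 := by
  obtain ⟨b, hb⟩ := exists_lau_eq (K := K) (P := P) (σ := P) (p := AddMonoidAlgebra.ofCoeff
    ((lau P P a).coeff.filter fun w => w.1 = (m : ℤ))) (by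
      intro w hw
      rw [AddMonoidAlgebra.coeff_ofCoeff, Finsupp.filter_apply] at hw
      split_ifs at hw with h
      · exact mem_semi_of_lau hw
      · exact absurd rfl hw)
  refine ⟨b, fun w => ?_⟩
  rw [hb, AddMonoidAlgebra.coeff_ofCoeff, Finsupp.filter_apply]

lemma fst_nonneg_of_mem_semi {w : HatM n} (hw : w ∈ semi P P) : 0 ≤ w.1 :=
  nonneg_of_mem_semi (l := AddMonoidHom.fst ℤ (Fin n → ℤ)) (fun _ _ => zero_le_one) hw

lemma one_mem_homogeneousPart : (1 : CoordRing K P P) ∈ homogeneousPart K P 0 :=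
  ⟨1, MvPolynomial.isHomogeneous_one _ _, rfl⟩

lemma mul_mem_homogeneousPart {m l : ℕ} {a b : CoordRing K P P} (ha : a ∈ homogeneousPart K P m)
    (hb : b ∈ homogeneousPart K P l) : a * b ∈ homogeneousPart K P (m + l) := by
  obtain ⟨F, hF, rfl⟩ := ha
  obtain ⟨G, hG, rfl⟩ := hb
  exact ⟨F * G, MvPolynomial.IsHomogeneous.mul hF hG, rfl⟩

/-! ### Filtrations by exponents -/

/-- The functions with all exponents in a set `s`. -/
def exponentsIn (K : Type*) [Field K] [CharZero K] (P : Set (Fin n → ℝ)) (s : Set (HatM n)) :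
    Submodule K (CoordRing K P P) where
  carrier := {a | ∀ w, (lau P P a).coeff w ≠ 0 → w ∈ s}
  zero_mem' := by simp
  add_mem' {a b} ha hb w hw := by
    by_cases h : (lau P P a).coeff w = 0
    · refine hb w fun h' => hw ?_
      rw [map_add, AddMonoidAlgebra.coeff_add, Finsupp.add_apply, h, h', add_zero]
    · exact ha w h
  smul_mem' c a ha w hw := by
    refine ha w fun h => hw ?_
    rw [map_smul, AddMonoidAlgebra.coeff_smul, Finsupp.smul_apply, h, smul_zero]

lemma mul_mem_exponentsIn {s t u : Set (HatM n)} (h : ∀ v ∈ s, ∀ w ∈ t, v + w ∈ u)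
    {a b : CoordRing K P P} (ha : a ∈ exponentsIn K P s) (hb : b ∈ exponentsIn K P t) :
    a * b ∈ exponentsIn K P u := by
  intro w hw
  rw [map_mul] at hw
  obtain ⟨v, v', hv, hv', rfl⟩ := exists_add_of_coeff_mul_ne_zero hw
  exact h _ (ha _ hv) _ (hb _ hv')

lemma one_mem_exponentsIn {s : Set (HatM n)} (h : 0 ∈ s) : 1 ∈ exponentsIn K P s := by
  classical
  intro w hw
  rw [map_one, AddMonoidAlgebra.one_def, AddMonoidAlgebra.coeff_single, Finsupp.single_apply] at hw
  split_ifs at hw with h0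
  · exact h0 ▸ h
  · exact absurd rfl hw

lemma exponentsIn_mono {s t : Set (HatM n)} (h : s ⊆ t) : exponentsIn K P s ≤ exponentsIn K P t :=
  fun _ ha w hw => h (ha w hw)

/-- Passing to a homogeneous component only drops exponents, so any condition on exponents is
inherited. -/
lemma exists_decomposition {s : Set (HatM n)} {a : CoordRing K P P} (ha : a ∈ exponentsIn K P s) :
    ∃ (t : Finset ℕ) (b : ℕ → CoordRing K P P),
      (∀ m, b m ∈ homogeneousPart K P m ∧ b m ∈ exponentsIn K P s) ∧ a = ∑ m ∈ t, b m := by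
  classical
  choose b hb using exists_homogeneous_component a
  refine ⟨(lau P P a).coeff.support.image fun w => w.1.toNat, b, fun m => ⟨?_, ?_⟩, ?_⟩
  · rw [mem_homogeneousPart_iff]
    intro w hw
    rw [hb] at hw
    by_contra h
    exact hw (if_neg h)
  · intro w hw
    rw [hb] at hw
    exact ha w fun h => hw (by rw [h, ite_self])
  · refine lau_coeff_injective fun w => ?_
    rw [map_sum, AddMonoidAlgebra.coeff_sum, Finset.sum_apply']
    by_cases hw : (lau P P a).coeff w = 0
    · rw [hw, Finset.sum_eq_zero fun m _ => by rw [hb, hw, ite_self]]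
    · have h0 := fst_nonneg_of_mem_semi (mem_semi_of_lau hw)
      rw [Finset.sum_eq_single w.1.toNat, hb, if_pos (Int.toNat_of_nonneg h0).symm]
      · intro m _ hm
        rw [hb, if_neg]
        intro h
        exact hm (by rw [h, Int.toNat_natCast])
      · intro h
        exact absurd (Finset.mem_image_of_mem _ (Finsupp.mem_support_iff.2 hw)) h

/-- Components of different degrees have disjoint sets of exponents, so nothing cancels in the sum.
-/
lemma mem_of_sum_mem_exponentsIn {s : Set (HatM n)} (t : Finset ℕ) (b : ℕ → CoordRing K P P)
    (hb : ∀ m, b m ∈ homogeneousPart K P m) (hsum : ∑ m ∈ t, b m ∈ exponentsIn K P s) :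
    ∀ m ∈ t, b m ∈ exponentsIn K P s := by
  intro m hm w hw
  refine hsum w ?_
  rw [map_sum, AddMonoidAlgebra.coeff_sum, Finset.sum_apply', Finset.sum_eq_single m]
  · exact hw
  · intro l _ hl
    by_contra hne
    have h1 := mem_homogeneousPart_iff.1 (hb m) w hw
    have h2 := mem_homogeneousPart_iff.1 (hb l) w hne
    rw [h1] at h2
    exact hl (by exact_mod_cast h2.symm)
  · exact fun h => absurd hm h

end Homogeneous

/-! ### The filtration of the quasi-valuation `ν` -/

section Nu

variable [CharZero K] (S : CombSeshadri K P) (hP : IsLatticePolytope P)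
  (hfull : (interior P).Nonempty) {lt : Face P → Face P → Prop}
  (hlt : IsStrictTotalOrder (Face P) lt) (hext : ∀ σ τ : Face P, σ < τ → lt σ τ)

/-- The vector of `ℚ^A` belonging to an exponent and a maximal chain. -/
def chainVal (C : MaxChain (Face P)) : HatM n →+ (Face P → ℚ) :=
  C.inclHom.comp (chainCoord S C hP hfull)

include hlt hext

/-- `ν` is the minimum, over all maximal chains and all exponents. -/
lemma exists_nu_eq {Γ : Type*} [AddCommGroup Γ] [LinearOrder Γ] {φ : (Face P → ℚ) →+ Γ}
    (hφ : Function.Injective φ) (hφlt : ∀ a b, φ a < φ b ↔ lexLT lt a b)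
    {g : CoordRing K P P} (hg : g ≠ 0) :
    (∃ C w, (lau P P g).coeff w ≠ 0 ∧ S.nu lt g = chainVal S hP hfull C w) ∧
      ∀ C w, (lau P P g).coeff w ≠ 0 → φ (S.nu lt g) ≤ φ (chainVal S hP hfull C w) := by
  have := finite_maxChain S hP hfull
  have := finite_face hP
  have := nonempty_face hP
  have := nonempty_maxChain (Face P)
  obtain ⟨C, hC⟩ := Finite.exists_min fun C : MaxChain (Face P) => φ (C.incl (S.nuChain C g))
  have hnu : S.nu lt g = C.incl (S.nuChain C g) := by
    refine IsLexMin.lexMin_eq hlt ⟨⟨C, rfl⟩, ?_⟩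
    rintro _ ⟨D, rfl⟩
    rw [← hφlt]
    exact (hC D).eq_or_lt.imp (fun h => (hφ h).symm) id
  have hlead := fun D => isLead_lead ((revLex D.r).comp (chainCoord S D hP hfull)) hg
  rw [hnu]
  refine ⟨⟨C, _, (hlead C).1, ?_⟩, fun D w hw => (hC D).trans ?_⟩
  · rw [nuChain_eq_lead S C hP hfull hg]
    rfl
  · rw [nuChain_eq_lead S D hP hfull hg]
    -- Minimality of the leading exponent inside `ℚ^D` is carried to `ℚ^A` by `incl_lexLT`.
    rcases ((hlead D).2 w hw).eq_or_lt with h | h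
    · exact (congrArg (fun a => φ (D.incl a)) (revLex_injective h)).le
    · exact ((hφlt _ _).2 (D.incl_lexLT hlt hext (revLex_lt_iff.1 h))).le

/-- A minimum over chains and exponents is at least `a` exactly when every term is; the filtration
is therefore monomial. -/
lemma filtGE_nu {Γ : Type*} [AddCommGroup Γ] [LinearOrder Γ] {φ : (Face P → ℚ) →+ Γ}
    (hφ : Function.Injective φ) (hφlt : ∀ a b, φ a < φ b ↔ lexLT lt a b) (a : Face P → ℚ) :
    filtGE lt (S.nu lt) a =
      exponentsIn K P {w | ∀ C, φ a ≤ φ (chainVal S hP hfull C w)} := by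
  ext g
  have hle : ∀ b, (b = a ∨ lexLT lt a b) ↔ φ a ≤ φ b := fun b => by
    rw [← hφlt, le_iff_eq_or_lt, hφ.eq_iff, eq_comm]
  constructor
  · intro h w hw C
    have hg : g ≠ 0 := by
      rintro rfl
      simp at hw
    exact ((hle _).1 (h hg)).trans ((exists_nu_eq S hP hfull hlt hext hφ hφlt hg).2 C w hw)
  · intro h hg
    obtain ⟨C, w, hw, hnu⟩ := (exists_nu_eq S hP hfull hlt hext hφ hφlt hg).1
    rw [hle, hnu]
    exact h w hw C

lemma filtGT_nu {Γ : Type*} [AddCommGroup Γ] [LinearOrder Γ] {φ : (Face P → ℚ) →+ Γ}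
    (hφ : Function.Injective φ) (hφlt : ∀ a b, φ a < φ b ↔ lexLT lt a b) (a : Face P → ℚ) :
    filtGT lt (S.nu lt) a =
      exponentsIn K P {w | ∀ C, φ a < φ (chainVal S hP hfull C w)} := by
  ext g
  constructor
  · intro h w hw C
    have hg : g ≠ 0 := by
      rintro rfl
      simp at hw
    exact ((hφlt _ _).2 (h hg)).trans_le ((exists_nu_eq S hP hfull hlt hext hφ hφlt hg).2 C w hw)
  · intro h hg
    obtain ⟨C, w, hw, hnu⟩ := (exists_nu_eq S hP hfull hlt hext hφ hφlt hg).1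
    rw [← hφlt, hnu]
    exact h w hw C

include hP hfull in
-- Additivity of every `chainVal` makes the monomial filtration multiplicative, and conditions on
-- exponents respect homogeneous components.
theorem nonempty_gradedAlgebra_nu :
    Nonempty (GradedAlgebra (grDegree lt (S.nu lt) (homogeneousPart K P))) := by
  have := finite_face hP
  obtain ⟨Γ, _, _, _, φ, hφ, hφlt⟩ := exists_lexHom hlt
  refine ⟨grDegreeGradedAlgebra (F := fun a => exponentsIn K P
      {w | ∀ C, φ a ≤ φ (chainVal S hP hfull C w)}) (G := fun a => exponentsIn K P
      {w | ∀ C, φ a < φ (chainVal S hP hfull C w)}) ⟨?_, ?_, ?_, ?_⟩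
    (filtGE_nu S hP hfull hlt hext hφ hφlt) (filtGT_nu S hP hfull hlt hext hφ hφlt)
    one_mem_homogeneousPart mul_mem_homogeneousPart (fun a x hx => exists_decomposition hx)
    (fun a => mem_of_sum_mem_exponentsIn)⟩
  · exact one_mem_exponentsIn fun C => by rw [map_zero, map_zero, map_zero]
  · intro a b x y hx hy
    refine mul_mem_exponentsIn (fun v hv w hw => ?_) hx hy
    intro C
    rw [map_add, map_add, map_add]
    exact add_le_add (hv C) (hw C)
  · intro a b x y hx hy
    refine mul_mem_exponentsIn (fun v hv w hw => ?_) hx hy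
    intro C
    rw [map_add, map_add, map_add]
    exact add_lt_add_of_le_of_lt (hv C) (hw C)
  · exact fun a => exponentsIn_mono fun w hw C => (hw C).le

end Nu

/-- The families indexed by chains agree term by term, so the sets being minimized are equal,
whatever the relation `lt`. -/
theorem cfl_eq_nu [CharZero K] (S : CombSeshadri K P) (hP : IsLatticePolytope P)
    (hfull : (interior P).Nonempty) (hnormal : IsNormalPolytope P)
    (lt : Face P → Face P → Prop) {g : CoordRing K P P} (hg : g ≠ 0) :
    S.cfl lt g = S.nu lt g := by
  rw [CombSeshadri.cfl, CombSeshadri.nu]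
  congr 2
  funext C
  rw [cflChain_eq_lead S C hP hfull hnormal hg, nuChain_eq_lead S C hP hfull hg]

end

end Toric

theorem mainTheorem8 {K : Type*} [Field K] [IsAlgClosed K] [CharZero K] {n : ℕ}
    (P : Set (Fin n → ℝ)) (hP : Toric.IsLatticePolytope P) (hfull : (interior P).Nonempty)
    (hnormal : Toric.IsNormalPolytope P) (S : Toric.CombSeshadri K P)
    (lt : Toric.Face P → Toric.Face P → Prop) (hlt : IsStrictTotalOrder (Toric.Face P) lt)
    (hext : ∀ σ τ : Toric.Face P, σ < τ → lt σ τ) :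
    -- the two valuations attached to a maximal chain coincide
    (∀ (C : MaxChain (Toric.Face P)) (g : Toric.CoordRing K P P), g ≠ 0 →
      S.cflChain C (algebraMap _ (FractionRing (Toric.CoordRing K P P)) g) = S.nuChain C g) ∧
    -- the two quasi-valuations coincide
    (∀ g : Toric.CoordRing K P P, g ≠ 0 → S.cfl lt g = S.nu lt g) ∧
    -- the filtrations and the Rees algebras coincide
    (∀ a, filtGE lt (S.cfl lt) a = filtGE lt (S.nu lt) a ∧
      filtGT lt (S.cfl lt) a = filtGT lt (S.nu lt) a) ∧
    Rees K lt (S.cfl lt) = Rees K lt (S.nu lt) ∧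
    -- the associated graded algebras coincide, with both their gradings
    (∃ e : Gr K lt (S.cfl lt) ≃ₐ[K] Gr K lt (S.nu lt),
      (∀ (x : Rees K lt (S.cfl lt)) (y : Rees K lt (S.nu lt)),
        (x : AddMonoidAlgebra (Toric.CoordRing K P P) (Toric.Face P → ℚ)) = y →
        e (Ideal.Quotient.mk _ x) = Ideal.Quotient.mk _ y) ∧
      (∀ a, (grLeaf K lt (S.cfl lt) a).map e.toLinearMap = grLeaf K lt (S.nu lt) a) ∧
      (∀ m, (grDegree lt (S.cfl lt) (Toric.homogeneousPart K P) m).map e.toLinearMap =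
        grDegree lt (S.nu lt) (Toric.homogeneousPart K P) m)) ∧
    -- the degenerate varieties `Proj` of the associated graded algebras coincide
    (∃ (_ : GradedAlgebra (grDegree lt (S.cfl lt) (Toric.homogeneousPart K P)))
        (_ : GradedAlgebra (grDegree lt (S.nu lt) (Toric.homogeneousPart K P))),
      Nonempty (AlgebraicGeometry.Proj (grDegree lt (S.cfl lt) (Toric.homogeneousPart K P)) ≅
        AlgebraicGeometry.Proj (grDegree lt (S.nu lt) (Toric.homogeneousPart K P)))) := by
  have h : ∀ g, g ≠ 0 → S.cfl lt g = S.nu lt g :=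
    fun g hg => Toric.cfl_eq_nu S hP hfull hnormal lt hg
  exact ⟨fun C g hg => (Toric.cflChain_eq_lead S C hP hfull hnormal hg).trans
      (Toric.nuChain_eq_lead S C hP hfull hg).symm, h,
    fun a => ⟨congrFun (filt_congr h).1 a, congrFun (filt_congr h).2 a⟩, Rees_congr h,
    exists_gr_equiv h _,
    exists_gr_proj_iso h _ (Toric.nonempty_gradedAlgebra_nu S hP hfull hlt hext)⟩
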